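/- Let $M\ge 1$ be an integer. For $m=1,\dots,M$ let $\alpha_m>0$, $\beta_m>0$, $\gamma_m\in\mathbb{R}$, and let $\Psi_m:\mathbb{R}\to\mathbb{R}$ be twice continuously differentiable with $\Psi_m'(0)=0$ and $|\Psi_m''(r)|\le\gamma_m r^2$ for all $|r|\le 1$. Put $\Phi_m(r)=\tfrac12\alpha_m r^2+\tfrac13\beta_m r^3+\Psi_m(r)$, and for $\varepsilon>0$ let $c_\varepsilon>0$ be given by $c_\varepsilon^2=\sum_{m=1}^M\alpha_m m^2+\varepsilon^2$. Let $L^2_{\mathrm{even}}(\mathbb{R})$ be the space of even real-valued functions in $L^2(\mathbb{R})$, with the norm $\|\cdot\|_2$. For $\eta>0$ let $(\mathcal A_\eta Y)(x)=\frac1\eta\int_{x-\eta/2}^{x+\eta/2}Y(\xi)\,d\xi$. For $\varepsilon>0$ and $V,W\in L^2_{\mathrm{even}}(\mathbb{R})$ define $$\mathcal B_\varepsilon W=W+\sum_{m=1}^M\alpha_m m^2\,\frac{W-\mathcal A_{m\varepsilon}^2W}{\varepsilon^2},\qquad \mathcal Q_\varepsilon[W]=\sum_{m=1}^M\beta_m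 m^3\,\mathcal A_{m\varepsilon}\big((\mathcal A_{m\varepsilon}W)^2\big),$$ $$\mathcal P_\varepsilon[W]=\frac1{\varepsilon^6}\sum_{m=1}^M m\,\mathcal A_{m\varepsilon}\Psi_m'\big(m\varepsilon^2\mathcal A_{m\varepsilon}W\big).$$ There is exactly one $W_0\in L^2_{\mathrm{even}}(\mathbb{R})$, $W_0\ne0$, with a $C^2$ representative that satisfies $$W_0-\frac{\sum_{m=1}^M\alpha_m m^4}{12}\,W_0''=\Big(\sum_{m=1}^M\beta_m m^3\Big)W_0^2\quad\text{on }\mathbb{R}.$$ With this $W_0$ define $$\mathcal L_\varepsilon V=\mathcal B_\varepsilon V-2\sum_{m=1}^M\beta_m m^3\,\mathcal A_{m\varepsilon}\big((\mathcal A_{m\varepsilon}W_0)(\mathcal A_{m\varepsilon}V)\big),$$ $$R_\varepsilon=\frac{\mathcal Q_\varepsilon[W_0]-\mathcal B_\varepsilon W_0}{\varepsilon^2},\qquad S_\varepsilon=\mathcal P_\varepsilon[W_0],\qquad \mathcal N_\varepsilon[V]=\frac{\mathcal P_\varepsilon[W_0+\varepsilon^2V]-\mathcal P_\varepsilon[W_0]}{\varepsilon^2}.$$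 Then there exist constants $D>0$ and $0<\varepsilon_*\le1$ such that for every $0<\varepsilon\le\varepsilon_*$ the following holds. The operator $\mathcal L_\varepsilon$ is continuously invertible on $L^2_{\mathrm{even}}(\mathbb{R})$, and the map $$\mathcal F_\varepsilon[V]=\mathcal L_\varepsilon^{-1}\big(R_\varepsilon+S_\varepsilon+\varepsilon^2\mathcal Q_\varepsilon[V]+\varepsilon^2\mathcal N_\varepsilon[V]\big)$$ is a contraction of the ball $B_D=\{V\in L^2_{\mathrm{even}}(\mathbb{R}):\|V\|_2\le D\}$ into itself and has a unique fixed point $V_\varepsilon$ in $B_D$. Moreover, $W_\varepsilon=W_0+\varepsilon^2V_\varepsilon$ solves the rescaled traveling-wave equation $\mathcal B_\varepsilon W_\varepsilon=\mathcal Q_\varepsilon[W_\varepsilon]+\varepsilon^2\mathcal P_\varepsilon[W_\varepsilon]$, and there is $U_\varepsilon\in C^2(\mathbb{R})$ with $U_\varepsilon'=W_\varepsilon$ almost everywhere such that, on $\mathbb{R}$, $$\varepsilon^3c_\varepsilon^2\,U_\varepsilon''=\sum_{m=1}^M m\varepsilon\,\nabla_{-m\varepsilon}\Phi_m'\big(m\varepsilon^2\nabla_{+m\varepsilon}U_\varepsilon\big),$$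 where $(\nabla_{+h}Y)(x)=\frac{Y(x+h)-Y(x)}h$ and $(\nabla_{-h}Y)(x)=\frac{Y(x)-Y(x-h)}h$. -/

import Mathlib

namespace FPU

open MeasureTheory Set
open scoped ENNReal

/-- The averaging operator `(A_η Y)(x) = (1/η) ∫_{x-η/2}^{x+η/2} Y(ξ) dξ` on functions. -/
noncomputable def avg (η : ℝ) (Y : ℝ → ℝ) (x : ℝ) : ℝ :=
  1 / η * ∫ ξ in (x - η / 2)..(x + η / 2), Y ξ

theorem avg_abs (η : ℝ) (Y : ℝ → ℝ) : avg |η| Y = avg η Y := by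
  rcases le_total 0 η with h | h
  · rw [abs_of_nonneg h]
  · funext x
    simp only [avg, abs_of_nonpos h]
    rw [intervalIntegral.integral_symm]
    rw [show x + -η / 2 = x - η / 2 by ring, show x - -η / 2 = x + η / 2 by ring]
    rw [one_div, one_div, inv_neg]
    ring

theorem avg_congr {f g : ℝ → ℝ} (h : f =ᵐ[volume] g) (η : ℝ) : avg η f = avg η g := by
  funext x
  simp only [avg]
  rw [intervalIntegral.integral_congr_ae (h.mono fun _ hx _ => hx)]

theorem intervalIntegrable_of_memLp {f : ℝ → ℝ} (hf : MemLp f 2 volume) (a b : ℝ) :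
    IntervalIntegrable f volume a b := by
  rw [intervalIntegrable_iff]
  have : IsFiniteMeasure (volume.restrict (uIoc a b)) := by unfold uIoc; infer_instance
  have : MemLp f 2 (volume.restrict (uIoc a b)) := hf.restrict _
  exact this.integrable (by norm_num)

theorem avg_add {f g : ℝ → ℝ} (hf : MemLp f 2 volume) (hg : MemLp g 2 volume) (η : ℝ) :
    avg η (f + g) = avg η f + avg η g := by
  funext x
  simp only [avg, Pi.add_apply]
  rw [intervalIntegral.integral_add (intervalIntegrable_of_memLp hf _ _)
    (intervalIntegrable_of_memLp hg _ _)]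
  ring

theorem avg_smul (c : ℝ) (f : ℝ → ℝ) (η : ℝ) : avg η (c • f) = c • avg η f := by
  funext x
  simp only [avg, Pi.smul_apply, smul_eq_mul, intervalIntegral.integral_const_mul]
  ring

theorem continuous_avg {f : ℝ → ℝ} (hf : MemLp f 2 volume) (η : ℝ) : Continuous (avg η f) := by
  have hi := intervalIntegrable_of_memLp hf
  have hc := intervalIntegral.continuous_primitive hi 0
  have : avg η f = fun x => 1 / η *
      ((∫ ξ in (0 : ℝ)..(x + η / 2), f ξ) - ∫ ξ in (0 : ℝ)..(x - η / 2), f ξ) := by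
    funext x
    simp only [avg]
    rw [intervalIntegral.integral_interval_sub_left (hi _ _) (hi _ _)]
  rw [this]
  exact continuous_const.mul ((hc.comp (by fun_prop)).sub (hc.comp (by fun_prop)))

theorem avg_even {f : ℝ → ℝ} (hf : (fun x => f (-x)) =ᵐ[volume] f) (η x : ℝ) :
    avg η f (-x) = avg η f x := by
  rw [← congrFun (avg_congr hf η) x]
  simp only [avg]
  rw [intervalIntegral.integral_comp_neg]
  congr 2 <;> ring

theorem sq_lintegral_le {f : ℝ → ℝ≥0∞} (hf : AEMeasurable f volume) (S : Set ℝ) :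
    (∫⁻ t in S, f t) ^ 2 ≤ volume S * ∫⁻ t in S, f t ^ 2 := by
  have h := ENNReal.lintegral_mul_le_Lp_mul_Lq (volume.restrict S)
    (Real.HolderConjugate.two_two) (f := fun _ => 1) (g := f) aemeasurable_const hf.restrict
  simp only [Pi.mul_apply, one_mul, ENNReal.one_rpow, lintegral_const, Measure.restrict_apply,
    MeasurableSet.univ, univ_inter] at h
  calc (∫⁻ t in S, f t) ^ 2
      ≤ (volume S ^ (1 / (2 : ℝ)) * (∫⁻ t in S, f t ^ (2 : ℝ)) ^ (1 / (2 : ℝ))) ^ 2 := by gcongr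
    _ = _ := by
      rw [mul_pow, ← ENNReal.rpow_natCast, ← ENNReal.rpow_mul, ← ENNReal.rpow_natCast,
        ← ENNReal.rpow_mul]
      norm_num

theorem enorm_avg_sq_le {f : ℝ → ℝ} (hf : MemLp f 2 volume) {η : ℝ} (hη : 0 < η) (x : ℝ) :
    ‖avg η f x‖ₑ ^ 2 ≤
      (ENNReal.ofReal η)⁻¹ * ∫⁻ t in Ioc (x - η / 2) (x + η / 2), ‖f t‖ₑ ^ 2 := by
  have h1 : ‖avg η f x‖ₑ ≤
      (ENNReal.ofReal η)⁻¹ * ∫⁻ t in Ioc (x - η / 2) (x + η / 2), ‖f t‖ₑ := by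
    simp only [avg]
    rw [enorm_mul, intervalIntegral.integral_of_le (by linarith)]
    gcongr
    · rw [one_div, enorm_inv hη.ne', Real.enorm_of_nonneg hη.le]
    · exact enorm_integral_le_lintegral_enorm _
  have h2 := sq_lintegral_le (f := fun t => ‖f t‖ₑ) hf.1.aemeasurable.enorm
    (Ioc (x - η / 2) (x + η / 2))
  rw [Real.volume_Ioc, show x + η / 2 - (x - η / 2) = η by ring] at h2
  have hne : ENNReal.ofReal η ≠ 0 := by simpa using hη
  calc ‖avg η f x‖ₑ ^ 2 ≤ _ := by gcongr
    _ = (ENNReal.ofReal η)⁻¹ ^ 2 * (∫⁻ t in Ioc (x - η / 2) (x + η / 2), ‖f t‖ₑ) ^ 2 := mul_pow ..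
    _ ≤ (ENNReal.ofReal η)⁻¹ ^ 2 * (ENNReal.ofReal η *
        ∫⁻ t in Ioc (x - η / 2) (x + η / 2), ‖f t‖ₑ ^ 2) := by gcongr
    _ = _ := by
      rw [sq, mul_assoc, ← mul_assoc _ (ENNReal.ofReal η), ENNReal.inv_mul_cancel hne (by simp),
        one_mul]

theorem eLpNorm_two_sq (f : ℝ → ℝ) : eLpNorm f 2 volume ^ 2 = ∫⁻ t, ‖f t‖ₑ ^ 2 := by
  rw [eLpNorm_eq_lintegral_rpow_enorm_toReal (by norm_num) (by norm_num), ← ENNReal.rpow_natCast,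
    ← ENNReal.rpow_mul]
  norm_num

theorem eLpNorm_avg_le {f : ℝ → ℝ} (hf : MemLp f 2 volume) (η : ℝ) :
    eLpNorm (avg η f) 2 volume ≤ eLpNorm f 2 volume := by
  rw [← avg_abs]
  rcases (abs_nonneg η).eq_or_lt with h | hη
  · have : avg |η| f = 0 := by funext x; simp [avg, ← h]
    simp [this]
  generalize |η| = η at hη
  rw [← ENNReal.pow_le_pow_left_iff (n := 2) (by norm_num), eLpNorm_two_sq, eLpNorm_two_sq]
  have hne : ENNReal.ofReal η ≠ 0 := by simpa using hη
  have hg : AEMeasurable (fun t => ‖f t‖ₑ ^ 2) volume := hf.1.aemeasurable.enorm.pow_const _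
  calc ∫⁻ x, ‖avg η f x‖ₑ ^ 2
      ≤ ∫⁻ x, (ENNReal.ofReal η)⁻¹ * ∫⁻ t in Ioc (x - η / 2) (x + η / 2), ‖f t‖ₑ ^ 2 :=
        lintegral_mono fun x => enorm_avg_sq_le hf hη x
    _ = (ENNReal.ofReal η)⁻¹ * ∫⁻ x, ∫⁻ t in Ioc (x - η / 2) (x + η / 2), ‖f t‖ₑ ^ 2 :=
        lintegral_const_mul' _ _ (by simpa using hη)
    _ = (ENNReal.ofReal η)⁻¹ * ∫⁻ x, ∫⁻ t,
          {p : ℝ × ℝ | p.2 ∈ Ioc (p.1 - η / 2) (p.1 + η / 2)}.indicator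
            (fun p => ‖f p.2‖ₑ ^ 2) (x, t) := by
        congr 1
        refine lintegral_congr fun x => ?_
        rw [← lintegral_indicator measurableSet_Ioc]
        rfl
    _ = (ENNReal.ofReal η)⁻¹ * ∫⁻ t, ∫⁻ x,
          {p : ℝ × ℝ | p.2 ∈ Ioc (p.1 - η / 2) (p.1 + η / 2)}.indicator
            (fun p => ‖f p.2‖ₑ ^ 2) (x, t) := by
        rw [lintegral_lintegral_swap]
        refine AEMeasurable.indicator hg.comp_snd ?_
        have m1 : Measurable fun p : ℝ × ℝ => p.1 - η / 2 := by fun_prop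
        have m2 : Measurable fun p : ℝ × ℝ => p.1 + η / 2 := by fun_prop
        exact (measurableSet_lt m1 measurable_snd).inter (measurableSet_le measurable_snd m2)
    _ = (ENNReal.ofReal η)⁻¹ * ∫⁻ t, ENNReal.ofReal η * ‖f t‖ₑ ^ 2 := by
        congr 1
        refine lintegral_congr fun t => ?_
        have : (fun x => {p : ℝ × ℝ | p.2 ∈ Ioc (p.1 - η / 2) (p.1 + η / 2)}.indicator
            (fun p => ‖f p.2‖ₑ ^ 2) (x, t)) =
            (Ico (t - η / 2) (t + η / 2)).indicator fun _ => ‖f t‖ₑ ^ 2 := by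
          funext x
          simp only [indicator, mem_ofPred_eq, mem_Ioc, mem_Ico]
          congr 1
          apply propext
          constructor <;> rintro ⟨h1, h2⟩ <;> constructor <;> linarith
        rw [this, lintegral_indicator_const measurableSet_Ico, Real.volume_Ico, mul_comm]
        congr 2; ring
    _ = _ := by
        rw [lintegral_const_mul' _ _ (by simp), ← mul_assoc, ENNReal.inv_mul_cancel hne (by simp),
          one_mul]

theorem memLp_avg {f : ℝ → ℝ} (hf : MemLp f 2 volume) (η : ℝ) : MemLp (avg η f) 2 volume :=
  ⟨(continuous_avg hf η).aestronglyMeasurable, (eLpNorm_avg_le hf η).trans_lt hf.2⟩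

theorem abs_avg_le {f : ℝ → ℝ} (hf : MemLp f 2 volume) (η x : ℝ) :
    |avg η f x| ≤ (√|η|)⁻¹ * (eLpNorm f 2 volume).toReal := by
  rw [← avg_abs]
  rcases (abs_nonneg η).eq_or_lt with h | hη
  · simp [avg, ← h]
  generalize |η| = η at hη
  have h1 : ‖avg η f x‖ₑ ^ 2 ≤ (ENNReal.ofReal η)⁻¹ * eLpNorm f 2 volume ^ 2 := by
    rw [eLpNorm_two_sq]
    refine (enorm_avg_sq_le hf hη x).trans ?_
    gcongr
    exact Measure.restrict_le_self
  have h2 := ENNReal.toReal_mono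
    (ENNReal.mul_ne_top (by simpa using hη) (ENNReal.pow_ne_top hf.2.ne)) h1
  simp only [ENNReal.toReal_pow, ENNReal.toReal_mul, ENNReal.toReal_inv, toReal_enorm,
    ENNReal.toReal_ofReal hη.le, Real.norm_eq_abs] at h2
  refine abs_le_of_sq_le_sq' ?_ (by positivity) |>.2
  rw [mul_pow, inv_pow, Real.sq_sqrt hη.le]
  exact h2

/-- The real Hilbert space `L²(ℝ)`. -/
abbrev L2 : Type := Lp ℝ 2 (volume : Measure ℝ)

theorem ae_neg {p : ℝ → Prop} (h : ∀ᵐ x, p x) : ∀ᵐ x : ℝ, p (-x) :=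
  (Measure.measurePreserving_neg (volume : Measure ℝ)).quasiMeasurePreserving.ae h

/-- The subspace `L²_even(ℝ)` of even functions in `L²(ℝ)`, with the `L²` norm. -/
def L2even : Submodule ℝ L2 where
  carrier := {V | ∀ᵐ x : ℝ, V (-x) = V x}
  zero_mem' := by
    have h := Lp.coeFn_zero ℝ 2 (volume : Measure ℝ)
    have h' := ae_neg h
    change ∀ᵐ x : ℝ, _
    filter_upwards [h, h'] with x hx hx'
    rw [hx, hx']; rfl
  add_mem' := by
    intro V W hV hW
    have h := Lp.coeFn_add V W
    have h' := ae_neg h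
    change ∀ᵐ x : ℝ, _
    filter_upwards [h, h', hV, hW] with x hx hx' h1 h2
    rw [hx, hx', Pi.add_apply, Pi.add_apply, h1, h2]
  smul_mem' := by
    intro c V hV
    have h := Lp.coeFn_smul c V
    have h' := ae_neg h
    change ∀ᵐ x : ℝ, _
    filter_upwards [h, h', hV] with x hx hx' h1
    rw [hx, hx', Pi.smul_apply, Pi.smul_apply, h1]

/-- The class in `L²_even(ℝ)` of an even square-integrable function. -/
noncomputable def toL2even (f : ℝ → ℝ) (hf : MemLp f 2 volume) (he : ∀ x, f (-x) = f x) :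
    L2even :=
  ⟨hf.toLp f, by
    have h := hf.coeFn_toLp
    have h' := ae_neg h
    change ∀ᵐ x : ℝ, _
    filter_upwards [h, h'] with x hx hx'
    rw [hx, hx', he]⟩

theorem toL2even_add {f g h : ℝ → ℝ} (hf : MemLp f 2 volume) (hg : MemLp g 2 volume)
    (hh : MemLp h 2 volume) (ef : ∀ x, f (-x) = f x) (eg : ∀ x, g (-x) = g x)
    (eh : ∀ x, h (-x) = h x) (H : h = f + g) :
    toL2even h hh eh = toL2even f hf ef + toL2even g hg eg := by
  subst H
  apply Subtype.ext
  exact MemLp.toLp_add hf hg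

theorem toL2even_smul {f h : ℝ → ℝ} (c : ℝ) (hf : MemLp f 2 volume)
    (hh : MemLp h 2 volume) (ef : ∀ x, f (-x) = f x)
    (eh : ∀ x, h (-x) = h x) (H : h = c • f) :
    toL2even h hh eh = c • toL2even f hf ef := by
  subst H
  apply Subtype.ext
  exact MemLp.toLp_const_smul c hf

theorem norm_toL2even {f : ℝ → ℝ} (hf : MemLp f 2 volume) (he : ∀ x, f (-x) = f x) :
    ‖toL2even f hf he‖ = (eLpNorm f 2 volume).toReal :=
  Lp.norm_toLp f hf

theorem norm_toL2even_le {f : ℝ → ℝ} (hf : MemLp f 2 volume) (he : ∀ x, f (-x) = f x)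
    {V : L2} {C : ℝ} (hC : 0 ≤ C) (h : eLpNorm f 2 volume ≤ ENNReal.ofReal C * eLpNorm V 2 volume) :
    ‖toL2even f hf he‖ ≤ C * ‖V‖ := by
  have := ENNReal.toReal_mono (ENNReal.mul_ne_top (by simp) (Lp.eLpNorm_ne_top _)) h
  rwa [ENNReal.toReal_mul, ENNReal.toReal_ofReal hC, ← Lp.norm_def, ← norm_toL2even hf he] at this

theorem avg_coe_add (η : ℝ) (V W : L2even) :
    avg η ((V + W : L2even) : L2) = avg η (V : L2) + avg η (W : L2) := by
  rw [← avg_add (Lp.memLp _) (Lp.memLp _)]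
  exact avg_congr (Lp.coeFn_add _ _) η

theorem avg_coe_smul (η c : ℝ) (V : L2even) :
    avg η ((c • V : L2even) : L2) = c • avg η (V : L2) := by
  rw [← avg_smul]
  exact avg_congr (Lp.coeFn_smul _ _) η

/-- The averaging operator `A_η` as a bounded linear operator on `L²_even(ℝ)`. -/
noncomputable def opA (η : ℝ) : L2even →L[ℝ] L2even :=
  LinearMap.mkContinuous
    { toFun := fun V => toL2even (avg η (V : L2)) (memLp_avg (Lp.memLp _) η) (avg_even V.2 η)
      map_add' := fun V W => toL2even_add _ _ _ _ _ _ (avg_coe_add η V W)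
      map_smul' := fun c V => toL2even_smul _ _ _ _ _ (avg_coe_smul η c V) }
    1 (fun V => norm_toL2even_le (memLp_avg (Lp.memLp _) η) (avg_even V.2 η) zero_le_one (by
      simpa using eLpNorm_avg_le (Lp.memLp (V : L2)) η))

theorem norm_avg_mul_le {f g : ℝ → ℝ} (hf : MemLp f 2 volume) (η x : ℝ) :
    ‖avg η f x * avg η g x‖ ≤
      ((√|η|)⁻¹ * (eLpNorm f 2 volume).toReal) * ‖avg η g x‖ := by
  rw [norm_mul]
  gcongr
  exact abs_avg_le hf η x

theorem memLp_avg_mul {f g : ℝ → ℝ} (hf : MemLp f 2 volume) (hg : MemLp g 2 volume) (η : ℝ) :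
    MemLp (fun x => avg η f x * avg η g x) 2 volume :=
  (memLp_avg hg η).of_le_mul
    ((continuous_avg hf η).mul (continuous_avg hg η)).aestronglyMeasurable
    (Filter.Eventually.of_forall fun x => norm_avg_mul_le hf η x)

/-- The bounded linear operator `V ↦ (A_η W) (A_η V)` on `L²_even(ℝ)`, for fixed `W`. -/
noncomputable def mulA (η : ℝ) (W : L2even) : L2even →L[ℝ] L2even :=
  LinearMap.mkContinuous
    { toFun := fun V => toL2even (fun x => avg η (W : L2) x * avg η (V : L2) x)
        (memLp_avg_mul (Lp.memLp _) (Lp.memLp _) η)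
        (fun x => by rw [avg_even W.2, avg_even V.2])
      map_add' := fun V V' => toL2even_add _ _ _ _ _ _ (by
        funext x
        simp only [avg_coe_add, Pi.add_apply, mul_add])
      map_smul' := fun c V => toL2even_smul _ _ _ _ _ (by
        funext x
        simp only [avg_coe_smul, Pi.smul_apply, smul_eq_mul, RingHom.id_apply]
        ring) }
    ((√|η|)⁻¹ * (eLpNorm (W : L2) 2 volume).toReal)
    (fun V => norm_toL2even_le (memLp_avg_mul (Lp.memLp _) (Lp.memLp _) η)
      (fun x => by rw [avg_even W.2, avg_even V.2]) (by positivity)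
      ((eLpNorm_le_mul_eLpNorm_of_ae_le_mul (Filter.Eventually.of_forall fun x =>
        norm_avg_mul_le (Lp.memLp _) η x) 2).trans
        (by gcongr; exact eLpNorm_avg_le (Lp.memLp (V : L2)) η)))

theorem memLp_comp_avg {f : ℝ → ℝ} (hf : MemLp f 2 volume) (η s : ℝ) {φ : ℝ → ℝ}
    (hφ : ContDiff ℝ 1 φ) (h0 : φ 0 = 0) :
    MemLp (fun x => φ (s * avg η f x)) 2 volume := by
  set R := |s| * ((√|η|)⁻¹ * (eLpNorm f 2 volume).toReal) with hR
  have hR0 : 0 ≤ R := by positivity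
  obtain ⟨K, hK⟩ := (hφ.contDiffOn (s := Icc (-R) R)).exists_lipschitzOnWith (by norm_num)
    (convex_Icc _ _) isCompact_Icc
  refine (memLp_avg hf η).of_le_mul (c := K * |s|)
    (hφ.continuous.comp (continuous_const.mul (continuous_avg hf η))).aestronglyMeasurable
    (Filter.Eventually.of_forall fun x => ?_)
  have hx : s * avg η f x ∈ Icc (-R) R := by
    rw [mem_Icc, ← abs_le, abs_mul]
    exact mul_le_mul_of_nonneg_left (abs_avg_le hf η x) (abs_nonneg s)
  have := hK.norm_sub_le hx (show (0 : ℝ) ∈ Icc (-R) R by simpa using hR0)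
  rw [h0, sub_zero, sub_zero, norm_mul, ← mul_assoc] at this
  exact this

/-- The superposition `x ↦ φ(s (A_η W)(x))` as an element of `L²_even(ℝ)`, for a continuously
differentiable `φ` with `φ(0) = 0`. -/
noncomputable def superA (φ : ℝ → ℝ) (hφ : ContDiff ℝ 1 φ) (h0 : φ 0 = 0) (s η : ℝ)
    (W : L2even) : L2even :=
  toL2even (fun x => φ (s * avg η (W : L2) x)) (memLp_comp_avg (Lp.memLp _) η s hφ h0)
    (fun x => by rw [avg_even W.2])

/-- The interaction potentials of the chain. The index `i : Fin M` stands for the range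
`m = i + 1 ∈ {1, …, M}` of the interaction; `Ψ i` is the part of the `m`-th potential
`Φ_m(r) = α_m r² / 2 + β_m r³ / 3 + Ψ_m(r)` beyond cubic order. -/
structure Chain (M : ℕ) where
  α : Fin M → ℝ
  β : Fin M → ℝ
  γ : Fin M → ℝ
  Ψ : Fin M → ℝ → ℝ
  α_pos : ∀ i, 0 < α i
  β_pos : ∀ i, 0 < β i
  differentiable_Ψ : ∀ i, Differentiable ℝ (Ψ i)
  contDiff_deriv_Ψ : ∀ i, ContDiff ℝ 1 (deriv (Ψ i))
  deriv_Ψ_zero : ∀ i, deriv (Ψ i) 0 = 0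
  abs_deriv_deriv_Ψ_le : ∀ i, ∀ r : ℝ, |r| ≤ 1 → |deriv (deriv (Ψ i)) r| ≤ γ i * r ^ 2

/-- The interaction range `m ∈ {1, …, M}` with index `i`, as a real number. -/
def range {M : ℕ} (i : Fin M) : ℝ := ((i : ℕ) : ℝ) + 1

namespace Chain

variable {M : ℕ} (c : Chain M)

/-- The potential `Φ_m`. -/
noncomputable def Φ (i : Fin M) (r : ℝ) : ℝ :=
  c.α i / 2 * r ^ 2 + c.β i / 3 * r ^ 3 + c.Ψ i r

/-- The wave speed `c_ε`, given by `c_ε² = c_0² + ε²` with `c_0² = ∑ α_m m²`. -/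
noncomputable def waveSpeed (ε : ℝ) : ℝ := √((∑ i, c.α i * range i ^ 2) + ε ^ 2)

/-- `W₀` is a KdV wave: a nontrivial element of `L²_even(ℝ)` which has a twice continuously
differentiable representative `w` with `w - (∑ α_m m⁴ / 12) w'' = (∑ β_m m³) w²`. -/
def IsKdVWave (W₀ : L2even) : Prop :=
  W₀ ≠ 0 ∧ ∃ w : ℝ → ℝ, ContDiff ℝ 2 w ∧ (W₀ : L2) =ᵐ[volume] w ∧
    ∀ x, w x - (∑ i, c.α i * range i ^ 4) / 12 * deriv (deriv w) x =
      (∑ i, c.β i * range i ^ 3) * w x ^ 2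

/-- `B_ε = id + ∑ α_m m² (id - A_{mε}²) / ε²`. -/
noncomputable def opB (ε : ℝ) : L2even →L[ℝ] L2even :=
  ContinuousLinearMap.id ℝ L2even + ∑ i, (c.α i * range i ^ 2 / ε ^ 2) •
    (ContinuousLinearMap.id ℝ L2even - (opA (range i * ε)).comp (opA (range i * ε)))

/-- `Q_ε[W] = ∑ β_m m³ A_{mε} ((A_{mε} W)²)`. -/
noncomputable def opQ (ε : ℝ) (W : L2even) : L2even :=
  ∑ i, (c.β i * range i ^ 3) • opA (range i * ε) (mulA (range i * ε) W W)

/-- `P_ε[W] = ε⁻⁶ ∑ m A_{mε} Ψ_m'(m ε² A_{mε} W)`. -/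
noncomputable def opP (ε : ℝ) (W : L2even) : L2even :=
  (1 / ε ^ 6) • ∑ i, range i • opA (range i * ε)
    (superA (deriv (c.Ψ i)) (c.contDiff_deriv_Ψ i) (c.deriv_Ψ_zero i)
      (range i * ε ^ 2) (range i * ε) W)

/-- `M_ε V = 2 ∑ β_m m³ A_{mε} ((A_{mε} W₀) (A_{mε} V))`. -/
noncomputable def opM (W₀ : L2even) (ε : ℝ) : L2even →L[ℝ] L2even :=
  (2 : ℝ) • ∑ i, (c.β i * range i ^ 3) •
    (opA (range i * ε)).comp (mulA (range i * ε) W₀)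

/-- `L_ε = B_ε - M_ε`. -/
noncomputable def opL (W₀ : L2even) (ε : ℝ) : L2even →L[ℝ] L2even :=
  c.opB ε - c.opM W₀ ε

/-- `R_ε = (Q_ε[W₀] - B_ε W₀) / ε²`. -/
noncomputable def resR (W₀ : L2even) (ε : ℝ) : L2even :=
  (1 / ε ^ 2) • (c.opQ ε W₀ - c.opB ε W₀)

/-- `S_ε = P_ε[W₀]`. -/
noncomputable def resS (W₀ : L2even) (ε : ℝ) : L2even := c.opP ε W₀

/-- `N_ε[V] = (P_ε[W₀ + ε² V] - P_ε[W₀]) / ε²`. -/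
noncomputable def opN (W₀ : L2even) (ε : ℝ) (V : L2even) : L2even :=
  (1 / ε ^ 2) • (c.opP ε (W₀ + ε ^ 2 • V) - c.opP ε W₀)

/-- `F_ε[V] = L_ε⁻¹ (R_ε + S_ε + ε² Q_ε[V] + ε² N_ε[V])`. The map `ContinuousLinearMap.inverse` is
the inverse where `L_ε` is invertible (and zero otherwise). -/
noncomputable def opF (W₀ : L2even) (ε : ℝ) (V : L2even) : L2even :=
  (c.opL W₀ ε).inverse
    (c.resR W₀ ε + c.resS W₀ ε + ε ^ 2 • c.opQ ε V + ε ^ 2 • c.opN W₀ ε V)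

end Chain

/-- The difference quotient `(∇_{+h} Y)(x) = (Y(x + h) - Y(x)) / h`. -/
noncomputable def forwardDiff (h : ℝ) (Y : ℝ → ℝ) (x : ℝ) : ℝ := (Y (x + h) - Y x) / h

/-- The difference quotient `(∇_{-h} Y)(x) = (Y(x) - Y(x - h)) / h`. -/
noncomputable def backwardDiff (h : ℝ) (Y : ℝ → ℝ) (x : ℝ) : ℝ := (Y x - Y (x - h)) / h

/-- `W` is the velocity profile of a rescaled traveling wave: `W = U'` almost everywhere for a
twice continuously differentiable `U` such that
`ε³ c_ε² U'' = ∑ m ε ∇_{-mε} Φ_m'(m ε² ∇_{+mε} U)` pointwise. -/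
def Chain.SolvesTravelingWave {M : ℕ} (c : Chain M) (ε : ℝ) (W : L2even) : Prop :=
  ∃ U : ℝ → ℝ, ContDiff ℝ 2 U ∧ (W : L2) =ᵐ[volume] deriv U ∧
    ∀ x, ε ^ 3 * c.waveSpeed ε ^ 2 * deriv (deriv U) x =
      ∑ i, range i * ε * backwardDiff (range i * ε)
        (fun y => deriv (c.Φ i) (range i * ε ^ 2 * forwardDiff (range i * ε) U y)) x

end FPU

/-! Write `a` for `kdvA` and `b` for `kdvB`. On smooth profiles, `(W - A_{mε}² W) / ε²` tends to
`-(m²/12) W''` and `A_{mε} W` tends to `W`. The rescaled equation is thus a perturbation of `W - a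
W'' = b W²`, and substituting `W₀ + ε² V` turns it into `V = F_ε[V]`. Three facts, all uniform in
small `ε`, make `F_ε` a contraction of a fixed ball: the residuals `R_ε` and `S_ε` are bounded
(`norm_resR_le`, `norm_resS_le`); `L_ε` is bounded from below (`exists_lower_bound`); and `ε² Q_ε`,
`ε² N_ε` have Lipschitz constants of order `ε` on balls (`norm_opQ_sub_le`, `norm_opN_sub_le`).

The wave `W₀` is explicit. A square-integrable solution decays together with its derivative, so its
first integral vanishes; evenness then fixes the initial data at `0`, and these determine the
`sech²` profile (`eq_soliton_of_kdv`). All derivatives of this profile are dominated by the profile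
itself, a weight of slow variation, so the Taylor expansions of averages hold pointwise against that
weight and hence in `L²`.

The heart is the lower bound, proved by contradiction. Suppose `‖V_n‖ = 1`, `ε_n → 0` and `L_ε V_n →
0`. The quadratic form of `B_ε` shows that averaging `V_n` over length `mε` loses only `O(ε²)` of
its squared norm. This makes the averages uniformly bounded and 1/2-Hölder (`exists_holder_bound`).
A subsequence converges pointwise to a bounded even weak solution of `U - a U'' = 2 b W₀ U`, and
this is zero: the Wronskian of `U` with `W₀'` vanishes (`eq_zero_of_linearized`). Since `W₀`
localizes, `M_ε V_n → 0` in norm along subsequences (`tendsto_norm_mulA`), which contradicts `1 =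
‖V_n‖ ≤ ‖B_ε V_n‖`. As `L_ε` is symmetric, the lower bound also gives invertibility.

Finally, a solution is a combination of averages of continuous functions, so it has a `C¹`
representative, and one differentiation of the integrated equation gives the lattice equation
(`solvesTravelingWave`). -/

namespace FPU

open MeasureTheory Set Filter Topology
open scoped ENNReal

/-! ### The `sech²` profile: derivatives, decay and slow variation. -/

/-- The solitary wave `A / cosh(k x)²`. -/
noncomputable def soliton (A k x : ℝ) : ℝ := A / Real.cosh (k * x) ^ 2

/-- The derivative of `soliton A k`. -/
noncomputable def solitonDeriv (A k x : ℝ) : ℝ :=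
  -(2 * k * A * Real.sinh (k * x)) / Real.cosh (k * x) ^ 3

theorem hasDerivAt_soliton (A k x : ℝ) : HasDerivAt (soliton A k) (solitonDeriv A k x) x := by
  have hc := (Real.cosh_pos (k * x)).ne'
  have h1 : HasDerivAt (fun x : ℝ => k * x) k x := by
    simpa using (hasDerivAt_id x).const_mul k
  have h2 := (hasDerivAt_const x A).fun_div (h1.cosh.fun_pow 2) (pow_ne_zero 2 hc)
  refine h2.congr_deriv ?_
  simp only [solitonDeriv]
  field_simp
  ring

theorem hasDerivAt_solitonDeriv {A : ℝ} (hA : A ≠ 0) (k x : ℝ) :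
    HasDerivAt (solitonDeriv A k)
      (4 * k ^ 2 * soliton A k x - 6 * k ^ 2 / A * soliton A k x ^ 2) x := by
  have hc := (Real.cosh_pos (k * x)).ne'
  have h1 : HasDerivAt (fun x : ℝ => k * x) k x := by
    simpa using (hasDerivAt_id x).const_mul k
  have h2 := ((h1.sinh.const_mul (2 * k * A)).fun_neg).fun_div (h1.cosh.fun_pow 3)
    (pow_ne_zero 3 hc)
  refine h2.congr_deriv ?_
  have h3 := Real.cosh_sq' (k * x)
  have h4 : Real.sinh (k * x) ^ 2 = Real.cosh (k * x) ^ 2 - 1 := by linarith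
  simp only [soliton]
  field_simp
  ring_nf
  rw [h4]
  ring

theorem soliton_neg (A k x : ℝ) : soliton A k (-x) = soliton A k x := by
  simp [soliton]

theorem soliton_pos {A : ℝ} (hA : 0 < A) (k x : ℝ) : 0 < soliton A k x := by
  have := Real.cosh_pos (k * x)
  simp only [soliton]; positivity

theorem soliton_le {A : ℝ} (hA : 0 < A) (k x : ℝ) : soliton A k x ≤ A := by
  have := Real.one_le_cosh (k * x)
  exact div_le_self hA.le (one_le_pow₀ this)

theorem abs_solitonDeriv_le {A k : ℝ} (hA : 0 < A) (hk : 0 < k) (x : ℝ) :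
    |solitonDeriv A k x| ≤ 2 * k * soliton A k x := by
  have hc := Real.cosh_pos (k * x)
  have hs : |Real.sinh (k * x)| ≤ Real.cosh (k * x) := by
    rw [Real.abs_sinh, ← Real.cosh_abs (k * x)]
    exact (Real.sinh_lt_cosh _).le
  simp only [solitonDeriv, soliton, abs_div, abs_neg, abs_mul, abs_pow, abs_of_pos hc,
    abs_of_pos hA, abs_of_pos hk, abs_two]
  rw [div_le_iff₀ (by positivity)]
  calc 2 * k * A * |Real.sinh (k * x)| ≤ 2 * k * A * Real.cosh (k * x) := by gcongr
    _ = _ := by field_simp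

theorem continuous_soliton (A k : ℝ) : Continuous (soliton A k) :=
  continuous_iff_continuousAt.2 fun x => (hasDerivAt_soliton A k x).continuousAt

theorem soliton_le_inv_one_add_sq {A k : ℝ} (hA : 0 < A) (x : ℝ) :
    soliton A k x ≤ A * (1 + (k * x) ^ 2)⁻¹ := by
  have h1 : (k * x) ^ 2 ≤ Real.sinh (k * x) ^ 2 := by
    rw [← sq_abs, ← sq_abs (Real.sinh _), Real.abs_sinh]
    gcongr
    exact Real.self_le_sinh_iff.2 (abs_nonneg _)
  simp only [soliton, Real.cosh_sq', div_eq_mul_inv]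
  gcongr

theorem integrable_soliton {A k : ℝ} (hA : 0 < A) (hk : 0 < k) :
    Integrable (soliton A k) := by
  have h := (integrable_inv_one_add_sq.comp_mul_left' hk.ne').const_mul A
  refine h.mono' (continuous_soliton A k).aestronglyMeasurable (Eventually.of_forall fun x => ?_)
  rw [Real.norm_eq_abs, abs_of_pos (soliton_pos hA k x)]
  exact soliton_le_inv_one_add_sq hA x

theorem memLp_soliton {A k : ℝ} (hA : 0 < A) (hk : 0 < k) :
    MemLp (soliton A k) 2 volume := by
  rw [memLp_two_iff_integrable_sq (continuous_soliton A k).aestronglyMeasurable]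
  refine ((integrable_soliton hA hk).const_mul A).mono'
    ((continuous_soliton A k).pow 2).aestronglyMeasurable (Eventually.of_forall fun x => ?_)
  have h := soliton_pos hA k x
  rw [Real.norm_eq_abs, abs_of_nonneg (by positivity), sq]
  exact mul_le_mul_of_nonneg_right (soliton_le hA k x) h.le

theorem cosh_add_le (u v : ℝ) : Real.cosh (u + v) ≤ Real.exp |u| * Real.cosh v := by
  have h1 : |Real.sinh v| ≤ Real.cosh v := by
    rw [Real.abs_sinh, ← Real.cosh_abs v]
    exact (Real.sinh_lt_cosh _).le
  have h2 : Real.cosh u * Real.cosh v + Real.sinh |u| * Real.cosh v =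
      Real.exp |u| * Real.cosh v := by
    rw [← Real.cosh_add_sinh, Real.cosh_abs]; ring
  rw [Real.cosh_add, ← h2, ← Real.abs_sinh]
  refine add_le_add_right ?_ _
  calc _ ≤ |Real.sinh u * Real.sinh v| := le_abs_self _
    _ = |Real.sinh u| * |Real.sinh v| := abs_mul _ _
    _ ≤ _ := by gcongr

/-- Since `cosh (u + v) ≤ e^|u| cosh v`, moving by at most `R` changes the profile by at most the
factor `e^(2kR)`. This is why local averages of functions dominated by the profile remain dominated
by it. -/
theorem soliton_le_exp_mul {A k : ℝ} (hA : 0 < A) (hk : 0 < k) {R x y : ℝ} (h : |x - y| ≤ R) :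
    soliton A k y ≤ Real.exp (k * R) ^ 2 * soliton A k x := by
  have hx := Real.cosh_pos (k * x)
  have hy := Real.cosh_pos (k * y)
  have h1 : Real.cosh (k * x) ≤ Real.exp (k * R) * Real.cosh (k * y) := by
    have := cosh_add_le (k * (x - y)) (k * y)
    rw [show k * (x - y) + k * y = k * x by ring, abs_mul, abs_of_pos hk] at this
    refine this.trans ?_
    gcongr
  simp only [soliton]
  rw [div_le_iff₀ (by positivity), mul_assoc, div_mul_eq_mul_div, mul_div_assoc',
    le_div_iff₀ (by positivity)]
  calc A * Real.cosh (k * x) ^ 2 ≤ A * (Real.exp (k * R) * Real.cosh (k * y)) ^ 2 := by gcongr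
    _ = _ := by ring

theorem contDiff_soliton (A k : ℝ) {n : WithTop ℕ∞} : ContDiff ℝ n (soliton A k) := by
  unfold soliton
  refine contDiff_const.div ((Real.contDiff_cosh.comp (contDiff_const.mul contDiff_id)).pow 2) ?_
  intro x
  exact pow_ne_zero 2 (Real.cosh_pos _).ne'

/-! ### Uniqueness for linear second-order equations and classification of KdV waves. -/

/-- Gronwall: a nonnegative-time solution of `d'' = q d` with trivial initial data vanishes. -/
theorem eq_zero_of_linear_ode {d d1 q : ℝ → ℝ} (hd : ∀ x, HasDerivAt d (d1 x) x)
    (hd1 : ∀ x, HasDerivAt d1 (q x * d x) x) (hq : Continuous q) (h0 : d 0 = 0) (h1 : d1 0 = 0)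
    {x : ℝ} (hx : 0 ≤ x) : d x = 0 := by
  obtain ⟨K, hK⟩ := (isCompact_Icc (a := 0) (b := x)).exists_bound_of_continuousOn hq.continuousOn
  have hE : ∀ y, HasDerivAt (fun y => (d y ^ 2 + d1 y ^ 2) * Real.exp (-((1 + K) * y)))
      ((2 * d y * d1 y + 2 * d1 y * (q y * d y)) * Real.exp (-((1 + K) * y)) +
        (d y ^ 2 + d1 y ^ 2) * (Real.exp (-((1 + K) * y)) * (-(1 + K)))) y := by
    intro y
    have e : HasDerivAt (fun y : ℝ => -((1 + K) * y)) (-(1 + K)) y := by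
      simpa using ((hasDerivAt_id y).const_mul (1 + K)).fun_neg
    refine ((((hd y).fun_pow 2).fun_add ((hd1 y).fun_pow 2)).fun_mul e.exp).congr_deriv ?_
    simp
  have hanti : AntitoneOn (fun y => (d y ^ 2 + d1 y ^ 2) * Real.exp (-((1 + K) * y)))
      (Icc 0 x) := by
    refine antitoneOn_of_deriv_nonpos (convex_Icc _ _)
      (fun y _ => (hE y).continuousAt.continuousWithinAt)
      (fun y _ => (hE y).differentiableAt.differentiableWithinAt) fun y hy => ?_
    rw [interior_Icc] at hy
    have hq' := abs_le.1 (hK y ⟨hy.1.le, hy.2.le⟩)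
    rw [(hE y).deriv]
    have : 2 * d y * d1 y + 2 * d1 y * (q y * d y) ≤ (1 + K) * (d y ^ 2 + d1 y ^ 2) := by
      have hp : 0 ≤ (d y - d1 y) ^ 2 := sq_nonneg _
      have hm : 0 ≤ (d y + d1 y) ^ 2 := sq_nonneg _
      -- The two products add up to `2 q d d' ≤ K (d² + d'²)`, and `hp` gives `2 d d' ≤ d² + d'²`.
      nlinarith [mul_nonneg (by linarith [hq'.2] : 0 ≤ K - q y) hm,
        mul_nonneg (by linarith [hq'.1] : 0 ≤ K + q y) hp]
    nlinarith [mul_le_mul_of_nonneg_right this (Real.exp_pos (-((1 + K) * y))).le]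
  have := hanti ⟨le_rfl, hx⟩ ⟨hx, le_rfl⟩ hx
  simp only [h0, h1] at this
  have hp := Real.exp_pos (-((1 + K) * x))
  have h2 : d x ^ 2 + d1 x ^ 2 ≤ 0 := by
    by_contra h
    push Not at h
    nlinarith [mul_pos h hp]
  have : d x ^ 2 = 0 := by nlinarith [sq_nonneg (d x), sq_nonneg (d1 x)]
  exact pow_eq_zero_iff (two_ne_zero) |>.1 this

theorem hasDerivAt_zero_of_even {f : ℝ → ℝ} {f' : ℝ} (he : ∀ x, f (-x) = f x)
    (h : HasDerivAt f f' 0) : f' = 0 := by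
  have h' : HasDerivAt (fun x => f (-x)) (-f') 0 := by
    have := HasDerivAt.scomp (0 : ℝ) (h := fun x : ℝ => -x) (g₁ := f) (by simpa using h)
      (hasDerivAt_neg 0)
    simpa [Function.comp_def] using this
  simp only [he] at h'
  linarith [h.unique h']

theorem even_eq_zero_of_linear_ode {d d1 q : ℝ → ℝ} (hd : ∀ x, HasDerivAt d (d1 x) x)
    (hd1 : ∀ x, HasDerivAt d1 (q x * d x) x) (hq : Continuous q) (he : ∀ x, d (-x) = d x)
    (h0 : d 0 = 0) (x : ℝ) : d x = 0 := by
  have h1 : d1 0 = 0 := hasDerivAt_zero_of_even he (hd 0)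
  rcases le_total 0 x with hx | hx
  · exact eq_zero_of_linear_ode hd hd1 hq h0 h1 hx
  · rw [← he]
    exact eq_zero_of_linear_ode hd hd1 hq h0 h1 (by linarith)

theorem tendsto_integral_unit_interval {f : ℝ → ℝ} (hf : Integrable f) :
    Tendsto (fun x => ∫ t in x..(x + 1), f t) atTop (𝓝 0) := by
  have h1 := intervalIntegral_tendsto_integral_Ioi 0 hf.integrableOn tendsto_id
  have h2 := intervalIntegral_tendsto_integral_Ioi 0 hf.integrableOn
    (tendsto_atTop_add_const_right atTop (1 : ℝ) tendsto_id)
  have h3 := h2.sub h1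
  rw [sub_self] at h3
  refine h3.congr fun x => ?_
  exact intervalIntegral.integral_interval_sub_left hf.intervalIntegrable hf.intervalIntegrable

/-- Interior control of a function and its derivative on a unit interval by means of a cutoff. -/
theorem abs_cutoff_le {w w1 w2 φ φ1 φ2 : ℝ → ℝ} (h1 : ∀ x, HasDerivAt w (w1 x) x)
    (h2 : ∀ x, HasDerivAt w1 (w2 x) x) (hc : Continuous w2)
    (g1 : ∀ x, HasDerivAt φ (φ1 x) x) (g2 : ∀ x, HasDerivAt φ1 (φ2 x) x) (gc : Continuous φ2)
    (e : φ 1 = 0) (e1 : φ1 1 = 0) {B : ℝ} (b : ∀ t ∈ Icc (0 : ℝ) 1, |φ t| ≤ B)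
    (b2 : ∀ t ∈ Icc (0 : ℝ) 1, |φ2 t| ≤ B) (x : ℝ) :
    |w x * φ1 0 - w1 x * φ 0| ≤ B * ∫ t in x..(x + 1), (|w2 t| + |w t|) := by
  have cw : Continuous w := continuous_iff_continuousAt.2 fun x => (h1 x).continuousAt
  have cφ : Continuous φ := continuous_iff_continuousAt.2 fun x => (g1 x).continuousAt
  -- Green's identity `(w' φ - w φ')' = w'' φ - w φ''`. As `φ` and `φ'` vanish at `1`, only the
  -- boundary term at the left end survives, so no bound on `w'` is needed.
  have hd : ∀ t, HasDerivAt (fun t => w1 t * φ (t - x) - w t * φ1 (t - x))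
      (w2 t * φ (t - x) - w t * φ2 (t - x)) t := by
    intro t
    have a1 := (g1 (t - x)).comp_sub_const t x
    have a2 := (g2 (t - x)).comp_sub_const t x
    refine (((h2 t).fun_mul a1).fun_sub ((h1 t).fun_mul a2)).congr_deriv ?_
    ring
  have hint := intervalIntegral.integral_eq_sub_of_hasDerivAt (a := x) (b := x + 1)
    (fun t _ => hd t) (Continuous.intervalIntegrable (by fun_prop) _ _)
  simp only [add_sub_cancel_left, sub_self, e, e1, mul_zero, zero_sub, neg_sub] at hint
  rw [← hint, ← intervalIntegral.integral_const_mul]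
  refine intervalIntegral.norm_integral_le_of_norm_le
    (f := fun t => w2 t * φ (t - x) - w t * φ2 (t - x)) (by linarith) ?_
    (Continuous.intervalIntegrable (by fun_prop) _ _)
  refine Eventually.of_forall fun t ht => ?_
  have ht' : t - x ∈ Icc (0 : ℝ) 1 := ⟨by linarith [ht.1], by linarith [ht.2]⟩
  calc |w2 t * φ (t - x) - w t * φ2 (t - x)|
      ≤ |w2 t| * |φ (t - x)| + |w t| * |φ2 (t - x)| := by
        rw [← abs_mul, ← abs_mul]; exact abs_sub _ _
    _ ≤ |w2 t| * B + |w t| * B := by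
        gcongr
        · exact b _ ht'
        · exact b2 _ ht'
    _ = _ := by ring

theorem tendsto_integral_abs_unit_interval {w : ℝ → ℝ} (hw : MemLp w 2 volume)
    (hc : Continuous w) : Tendsto (fun x => ∫ t in x..(x + 1), |w t|) atTop (𝓝 0) := by
  have h1 := tendsto_integral_unit_interval hw.integrable_sq
  have h2 : Tendsto (fun x => √(∫ t in x..(x + 1), w t ^ 2)) atTop (𝓝 0) := by
    simpa using h1.sqrt
  refine squeeze_zero (fun x => ?_) (fun x => ?_) h2
  · exact intervalIntegral.integral_nonneg (by linarith) fun t _ => abs_nonneg _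
  · refine Real.le_sqrt_of_sq_le ?_
    set m := ∫ t in x..(x + 1), |w t| with hm
    -- Cauchy–Schwarz on an interval of length one, as nonnegativity of the variance of `|w|`.
    have h3 : 0 ≤ ∫ t in x..(x + 1), (|w t| - m) ^ 2 :=
      intervalIntegral.integral_nonneg (by linarith) fun t _ => sq_nonneg _
    have h4 : ∫ t in x..(x + 1), (|w t| - m) ^ 2 =
        (∫ t in x..(x + 1), w t ^ 2) - m ^ 2 := by
      have : (fun t => (|w t| - m) ^ 2) = fun t => w t ^ 2 - (2 * m) * |w t| + m ^ 2 := by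
        funext t; rw [sub_sq, sq_abs]; ring
      rw [this, intervalIntegral.integral_add, intervalIntegral.integral_sub,
        intervalIntegral.integral_const_mul, ← hm]
      · simp; ring
      all_goals exact Continuous.intervalIntegrable (by fun_prop) _ _
    linarith

/-- A square-integrable solution of `w - a w'' = b w²` vanishes at infinity together with its
derivative. -/
theorem tendsto_zero_of_kdv {a b : ℝ} (ha : 0 < a) {w w1 w2 : ℝ → ℝ}
    (hw : MemLp w 2 volume) (h1 : ∀ x, HasDerivAt w (w1 x) x)
    (h2 : ∀ x, HasDerivAt w1 (w2 x) x) (hode : ∀ x, w x - a * w2 x = b * w x ^ 2) :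
    Tendsto w atTop (𝓝 0) ∧ Tendsto w1 atTop (𝓝 0) := by
  have cw : Continuous w := continuous_iff_continuousAt.2 fun x => (h1 x).continuousAt
  have e2 : w2 = fun x => (w x - b * w x ^ 2) / a := by
    funext x; rw [← hode]; field_simp; ring
  have cw2 : Continuous w2 := by rw [e2]; fun_prop
  have t0 : Tendsto (fun x => ∫ t in x..(x + 1), (|w2 t| + |w t|)) atTop (𝓝 0) := by
    have l1 := tendsto_integral_abs_unit_interval hw cw
    have l2 := tendsto_integral_unit_interval hw.integrable_sq
    have l3 := (l1.const_mul (1 / a + 1)).add (l2.const_mul (|b| / a))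
    rw [mul_zero, mul_zero, add_zero] at l3
    refine squeeze_zero (fun x => ?_) (fun x => ?_) l3
    · exact intervalIntegral.integral_nonneg (by linarith) fun t _ => by positivity
    · rw [← intervalIntegral.integral_const_mul, ← intervalIntegral.integral_const_mul,
        ← intervalIntegral.integral_add]
      · refine intervalIntegral.integral_mono (by linarith)
          (Continuous.intervalIntegrable (by fun_prop) _ _)
          (Continuous.intervalIntegrable (by fun_prop) _ _) fun t => ?_
        have : |w2 t| ≤ (|w t| + |b| * w t ^ 2) / a := by
          rw [e2, abs_div, abs_of_pos ha]
          gcongr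
          refine (abs_sub _ _).trans ?_
          rw [abs_mul, abs_of_nonneg (sq_nonneg (w t))]
        calc |w2 t| + |w t| ≤ (|w t| + |b| * w t ^ 2) / a + |w t| := by gcongr
          _ = _ := by ring
      all_goals exact Continuous.intervalIntegrable (by fun_prop) _ _
  -- Two cutoffs, both vanishing to second order at `1`. The first, `t (1 - t)²`, has value `0` and
  -- slope `1` at `0` and isolates `w x`; the second, `(1 - t)² (1 + 2t)`, has value `1` and slope
  -- `0` and isolates `w' x`.
  have d1 : ∀ x : ℝ, HasDerivAt (fun t : ℝ => t * (1 - t) ^ 2) ((1 - x) * (1 - 3 * x)) x := by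
    intro x
    refine ((hasDerivAt_id x).fun_mul (((hasDerivAt_id x).const_sub 1).fun_pow 2)).congr_deriv ?_
    simp; ring
  have d2 : ∀ x : ℝ, HasDerivAt (fun t : ℝ => (1 - t) * (1 - 3 * t)) (6 * x - 4) x := by
    intro x
    refine (((hasDerivAt_id x).const_sub 1).fun_mul
      (((hasDerivAt_id x).const_mul 3).const_sub 1)).congr_deriv ?_
    simp; ring
  have d3 : ∀ x : ℝ, HasDerivAt (fun t : ℝ => (1 - t) ^ 2 * (1 + 2 * t)) (6 * x ^ 2 - 6 * x) x := by
    intro x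
    refine ((((hasDerivAt_id x).const_sub 1).fun_pow 2).fun_mul
      (((hasDerivAt_id x).const_mul 2).const_add 1)).congr_deriv ?_
    simp; ring
  have d4 : ∀ x : ℝ, HasDerivAt (fun t : ℝ => 6 * t ^ 2 - 6 * t) (12 * x - 6) x := by
    intro x
    refine ((((hasDerivAt_id x).fun_pow 2).const_mul 6).fun_sub
      ((hasDerivAt_id x).const_mul 6)).congr_deriv ?_
    simp; ring
  have B1 := abs_cutoff_le h1 h2 cw2 d1 d2 (by fun_prop) (by simp) (by simp) (B := 6)
    (fun t ht => by
      rw [abs_le]; constructor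
      · have : 0 ≤ t * (1 - t) ^ 2 := mul_nonneg ht.1 (sq_nonneg _)
        linarith
      · nlinarith [ht.1, ht.2, mul_nonneg ht.1 (sub_nonneg.2 ht.2)])
    (fun t ht => by rw [abs_le]; constructor <;> linarith [ht.1, ht.2])
  have B2 := abs_cutoff_le h1 h2 cw2 d3 d4 (by fun_prop) (by simp) (by simp) (B := 6)
    (fun t ht => by
      rw [abs_le]; constructor
      · have : 0 ≤ (1 - t) ^ 2 * (1 + 2 * t) := mul_nonneg (sq_nonneg _) (by linarith [ht.1])
        linarith
      · nlinarith [ht.1, ht.2, mul_nonneg ht.1 (sub_nonneg.2 ht.2)])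
    (fun t ht => by rw [abs_le]; constructor <;> linarith [ht.1, ht.2])
  have t6 := t0.const_mul 6
  rw [mul_zero] at t6
  refine ⟨squeeze_zero_norm (fun x => ?_) t6, squeeze_zero_norm (fun x => ?_) t6⟩
  · simpa using B1 x
  · simpa using B2 x

/-- The only nontrivial even square-integrable solution of `w - a w'' = b w²` is the soliton. -/
theorem eq_soliton_of_kdv {a b A k : ℝ} (ha : 0 < a) (hb : 0 < b) (hA : 0 < A)
    (hAb : 2 * b * A = 3) (hk : 4 * k ^ 2 * a = 1) {w w1 w2 : ℝ → ℝ}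
    (hw : MemLp w 2 volume) (h1 : ∀ x, HasDerivAt w (w1 x) x)
    (h2 : ∀ x, HasDerivAt w1 (w2 x) x) (hode : ∀ x, w x - a * w2 x = b * w x ^ 2)
    (he : ∀ x, w (-x) = w x) (hne : ∃ x, w x ≠ 0) : w = soliton A k := by
  have cw : Continuous w := continuous_iff_continuousAt.2 fun x => (h1 x).continuousAt
  obtain ⟨t1, t2⟩ := tendsto_zero_of_kdv ha hw h1 h2 hode
  have e2 : w2 = fun x => (1 / a - b / a * w x) * w x := by
    funext x
    have := hode x
    field_simp
    linarith
  -- First integral: the equation multiplied by `w'`. The decay of `w` and `w'` forces its constant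
  -- value to be `0`.
  have hE : ∀ x, HasDerivAt (fun x => a / 2 * w1 x ^ 2 - w x ^ 2 / 2 + b / 3 * w x ^ 3) 0 x := by
    intro x
    refine (((((h2 x).fun_pow 2).const_mul (a / 2)).fun_sub
      (((h1 x).fun_pow 2).div_const 2)).fun_add
      (((h1 x).fun_pow 3).const_mul (b / 3))).congr_deriv ?_
    have := hode x
    simp
    linear_combination (-w1 x) * this
  have hconst : ∀ x y, (fun x => a / 2 * w1 x ^ 2 - w x ^ 2 / 2 + b / 3 * w x ^ 3) x =
      (fun x => a / 2 * w1 x ^ 2 - w x ^ 2 / 2 + b / 3 * w x ^ 3) y :=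
    is_const_of_deriv_eq_zero (fun x => (hE x).differentiableAt) fun x => (hE x).deriv
  have hlim : Tendsto (fun x => a / 2 * w1 x ^ 2 - w x ^ 2 / 2 + b / 3 * w x ^ 3) atTop (𝓝 0) := by
    have := (((t2.pow 2).const_mul (a / 2)).sub ((t1.pow 2).div_const 2)).add
      ((t1.pow 3).const_mul (b / 3))
    simpa using this
  have hE0 : a / 2 * w1 0 ^ 2 - w 0 ^ 2 / 2 + b / 3 * w 0 ^ 3 = 0 := by
    refine tendsto_nhds_unique (tendsto_const_nhds.congr fun x => ?_) hlim
    exact hconst 0 x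
  have w10 : w1 0 = 0 := hasDerivAt_zero_of_even he (h1 0)
  -- With `w' 0 = 0` the first integral reads `w(0)² (2 b w(0) - 3) = 0`. The root `w 0 = 0` is
  -- excluded, because the equation is linear in `w` with coefficient `1/a - (b/a) w`, so trivial
  -- data would make `w` vanish.
  have hw0 : w 0 = A := by
    by_contra hne'
    have : w 0 = 0 := by
      by_contra h0
      apply hne'
      rw [w10] at hE0
      have h3 : w 0 ^ 2 * (2 * b * w 0 - 3) = 0 := by linear_combination 6 * hE0
      have h4 : 2 * b * w 0 - 3 = 0 := (mul_eq_zero.1 h3).resolve_left (pow_ne_zero 2 h0)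
      have : 2 * b * (w 0 - A) = 0 := by linarith
      have := (mul_eq_zero.1 this).resolve_left (by positivity)
      linarith
    obtain ⟨x, hx⟩ := hne
    exact hx (even_eq_zero_of_linear_ode h1 (fun x => by simpa only [e2] using h2 x)
      (q := fun x => 1 / a - b / a * w x) (by fun_prop) he this x)
  have cs := continuous_soliton A k
  have hb' : b = 6 * k ^ 2 / A * a := by
    field_simp
    linear_combination hAb / 2 - 3 / 2 * hk
  funext x
  rw [← sub_eq_zero]
  -- By `w² - s² = (w + s)(w - s)`, the difference of the two solutions satisfies a linear equation
  -- with trivial data at `0`.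
  refine even_eq_zero_of_linear_ode (d := fun x => w x - soliton A k x)
    (d1 := fun x => w1 x - solitonDeriv A k x)
    (q := fun x => 1 / a - b / a * (w x + soliton A k x))
    (fun x => (h1 x).fun_sub (hasDerivAt_soliton A k x)) (fun x => ?_) (by fun_prop)
    (fun x => by simp [he, soliton_neg]) (by simp [hw0, soliton]) x
  refine ((h2 x).fun_sub (hasDerivAt_solitonDeriv hA.ne' k x)).congr_deriv ?_
  have hk' : 4 * k ^ 2 = 1 / a := by field_simp; linarith
  have hb'' : 6 * k ^ 2 / A = b / a := by rw [hb']; field_simp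
  rw [hk', hb'', e2]
  ring

/-! ### Coefficients of the limiting equation; existence and uniqueness of its wave. -/

namespace Chain

variable {M : ℕ} (c : Chain M)

/-- The dispersion coefficient `∑ α_m m⁴ / 12` of the limiting equation. -/
noncomputable def kdvA : ℝ := (∑ i, c.α i * range i ^ 4) / 12

/-- The coefficient `∑ β_m m³` of the nonlinearity in the limiting equation. -/
noncomputable def kdvB : ℝ := ∑ i, c.β i * range i ^ 3

end Chain

theorem range_pos {M : ℕ} (i : Fin M) : 0 < range i := by unfold range; positivity

theorem one_le_range {M : ℕ} (i : Fin M) : 1 ≤ range i := by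
  unfold range; linarith [Nat.cast_nonneg (α := ℝ) (i : ℕ)]

theorem range_le {M : ℕ} (i : Fin M) : range i ≤ M := by
  unfold range; exact_mod_cast i.2

namespace Chain

variable {M : ℕ} (c : Chain M)

theorem kdvA_pos (hM : 0 < M) : 0 < c.kdvA := by
  have : Nonempty (Fin M) := ⟨⟨0, hM⟩⟩
  refine div_pos (Finset.sum_pos (fun i _ => ?_) Finset.univ_nonempty) (by norm_num)
  exact mul_pos (c.α_pos i) (pow_pos (range_pos i) _)

theorem kdvB_pos (hM : 0 < M) : 0 < c.kdvB := by
  have : Nonempty (Fin M) := ⟨⟨0, hM⟩⟩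
  refine Finset.sum_pos (fun i _ => ?_) Finset.univ_nonempty
  exact mul_pos (c.β_pos i) (pow_pos (range_pos i) _)

/-- The amplitude of the solitary wave. -/
noncomputable def ampl : ℝ := 3 / (2 * c.kdvB)

/-- The inverse width of the solitary wave. -/
noncomputable def rate : ℝ := 1 / (2 * √c.kdvA)

/-- The profile of the solitary wave. -/
noncomputable def wave : ℝ → ℝ := soliton c.ampl c.rate

/-- The derivative of the profile of the solitary wave. -/
noncomputable def waveDeriv : ℝ → ℝ := solitonDeriv c.ampl c.rate

theorem ampl_pos (hM : 0 < M) : 0 < c.ampl := by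
  have := c.kdvB_pos hM; unfold ampl; positivity

theorem rate_pos (hM : 0 < M) : 0 < c.rate := by
  have := c.kdvA_pos hM; unfold rate; positivity

theorem two_mul_kdvB_mul_ampl (hM : 0 < M) : 2 * c.kdvB * c.ampl = 3 := by
  have := c.kdvB_pos hM; unfold ampl; field_simp

theorem four_mul_rate_sq (hM : 0 < M) : 4 * c.rate ^ 2 * c.kdvA = 1 := by
  have := c.kdvA_pos hM
  unfold rate
  rw [div_pow, mul_pow, Real.sq_sqrt this.le]
  field_simp
  norm_num

theorem hasDerivAt_wave (x : ℝ) : HasDerivAt c.wave (c.waveDeriv x) x :=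
  hasDerivAt_soliton _ _ x

theorem hasDerivAt_waveDeriv (hM : 0 < M) (x : ℝ) :
    HasDerivAt c.waveDeriv ((c.wave x - c.kdvB * c.wave x ^ 2) / c.kdvA) x := by
  have ha := c.kdvA_pos hM
  have hA := c.ampl_pos hM
  have h1 := c.two_mul_kdvB_mul_ampl hM
  have h2 := c.four_mul_rate_sq hM
  refine (hasDerivAt_solitonDeriv hA.ne' c.rate x).congr_deriv ?_
  have e1 : 4 * c.rate ^ 2 = 1 / c.kdvA := by field_simp; linarith
  have e2 : 6 * c.rate ^ 2 / c.ampl = c.kdvB / c.kdvA := by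
    field_simp
    linear_combination 3 / 2 * h2 - h1 / 2
  rw [e1, e2]
  simp only [wave]
  ring

theorem memLp_wave (hM : 0 < M) : MemLp c.wave 2 volume :=
  memLp_soliton (c.ampl_pos hM) (c.rate_pos hM)

theorem wave_neg (x : ℝ) : c.wave (-x) = c.wave x := soliton_neg _ _ x

theorem wave_pos (hM : 0 < M) (x : ℝ) : 0 < c.wave x := soliton_pos (c.ampl_pos hM) _ x

theorem wave_le (hM : 0 < M) (x : ℝ) : c.wave x ≤ c.ampl := soliton_le (c.ampl_pos hM) _ x

theorem contDiff_wave {n : WithTop ℕ∞} : ContDiff ℝ n c.wave := contDiff_soliton _ _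

theorem continuous_wave : Continuous c.wave := continuous_soliton _ _

/-- Makes the abstract `W₀` explicit, so that every later estimate can use the profile.
Almost-everywhere evenness of the class becomes evenness of the representative by continuity. -/
theorem IsKdVWave.ae_eq {c : Chain M} (hM : 0 < M) {W₀ : L2even} (h : c.IsKdVWave W₀) :
    (W₀ : L2) =ᵐ[volume] c.wave := by
  obtain ⟨hne, w, hw, hae, hode⟩ := h
  have hLp : MemLp w 2 volume := (memLp_congr_ae hae).1 (Lp.memLp _)
  have hev : ∀ x, w (-x) = w x := by
    have : (fun x => w (-x)) =ᵐ[volume] w := by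
      have h2 : ∀ᵐ x : ℝ, (W₀ : L2) (-x) = (W₀ : L2) x := W₀.2
      filter_upwards [hae, ae_neg hae, h2] with x h1 h2 h3
      rw [← h1, ← h2, h3]
    exact congrFun ((Continuous.ae_eq_iff_eq volume
      (hw.continuous.comp continuous_neg) hw.continuous).1 this)
  have d1 : ∀ x, HasDerivAt w (deriv w x) x := fun x =>
    (hw.differentiable (by norm_num) x).hasDerivAt
  have d2 : ∀ x, HasDerivAt (deriv w) (deriv (deriv w) x) x := fun x =>
    (((contDiff_succ_iff_deriv (n := 1)).1
      (by rw [one_add_one_eq_two]; exact hw)).2.2.differentiable (by norm_num) x).hasDerivAt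
  have hne' : ∃ x, w x ≠ 0 := by
    by_contra hcon
    push Not at hcon
    apply hne
    apply Subtype.ext
    apply Lp.ext
    filter_upwards [hae, Lp.coeFn_zero ℝ 2 (volume : Measure ℝ)] with x h1 h2
    rw [h1, hcon]
    exact h2.symm
  have := eq_soliton_of_kdv (c.kdvA_pos hM) (c.kdvB_pos hM) (c.ampl_pos hM)
    (c.two_mul_kdvB_mul_ampl hM) (c.four_mul_rate_sq hM) hLp d1 d2 hode hev hne'
  rw [this] at hae
  exact hae

theorem existsUnique_isKdVWave (hM : 0 < M) : ∃! W₀ : L2even, c.IsKdVWave W₀ := by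
  refine ⟨toL2even c.wave (c.memLp_wave hM) c.wave_neg, ?_, fun W hW => ?_⟩
  · have hae : (toL2even c.wave (c.memLp_wave hM) c.wave_neg : L2) =ᵐ[volume] c.wave :=
      (c.memLp_wave hM).coeFn_toLp
    refine ⟨fun h0 => ?_, c.wave, c.contDiff_wave, hae, fun x => ?_⟩
    · rw [h0] at hae
      have h1 : (0 : ℝ → ℝ) = c.wave := (Continuous.ae_eq_iff_eq volume continuous_zero
        c.continuous_wave).1 ((Lp.coeFn_zero ℝ 2 (volume : Measure ℝ)).symm.trans hae)
      exact (c.wave_pos hM 0).ne (congrFun h1 0)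
    · have e1 : deriv c.wave = c.waveDeriv := funext fun x => (c.hasDerivAt_wave x).deriv
      rw [e1, (c.hasDerivAt_waveDeriv hM x).deriv]
      have := c.kdvA_pos hM
      change c.wave x - c.kdvA * _ = c.kdvB * _
      field_simp
      ring
  · apply Subtype.ext
    apply Lp.ext
    exact (IsKdVWave.ae_eq hM hW).trans (c.memLp_wave hM).coeFn_toLp.symm

end Chain

/-! ### Functions whose derivatives are dominated by a slowly varying weight. -/

/-- A positive continuous square-integrable function of slow variation. -/
structure IsWeight (w : ℝ → ℝ) : Prop where
  continuous : Continuous w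
  pos : ∀ x, 0 < w x
  memLp : MemLp w 2 volume
  bdd : ∃ A, ∀ x, w x ≤ A
  slow : ∀ R, ∃ C, ∀ x y, |x - y| ≤ R → w y ≤ C * w x

/-- `f` is bounded by a multiple of the weight `w`. -/
def Dom (w f : ℝ → ℝ) : Prop := ∃ K, 0 ≤ K ∧ ∀ x, |f x| ≤ K * w x

/-- `f` is continuous and its derivatives up to order `n` are bounded by multiples of `w`. -/
def Nice (w : ℝ → ℝ) : ℕ → (ℝ → ℝ) → Prop
  | 0, f => Dom w f ∧ Continuous f
  | n + 1, f => Dom w f ∧ Differentiable ℝ f ∧ Nice w n (deriv f)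

section Nice

variable {w f g : ℝ → ℝ} {n : ℕ}

theorem Dom.add (hf : Dom w f) (hg : Dom w g) : Dom w (fun x => f x + g x) := by
  obtain ⟨K, hK, h⟩ := hf
  obtain ⟨K', hK', h'⟩ := hg
  refine ⟨K + K', by positivity, fun x => (abs_add_le _ _).trans ?_⟩
  rw [add_mul]
  exact add_le_add (h x) (h' x)

theorem Dom.const_mul (hf : Dom w f) (a : ℝ) : Dom w (fun x => a * f x) := by
  obtain ⟨K, hK, h⟩ := hf
  refine ⟨|a| * K, by positivity, fun x => ?_⟩
  rw [abs_mul, mul_assoc]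
  exact mul_le_mul_of_nonneg_left (h x) (abs_nonneg a)

/-- A product is dominated by `w²`, and boundedness of `w` reduces this to a multiple of `w`. Hence
the class is closed under the nonlinearity. -/
theorem Dom.mul (hw : IsWeight w) (hf : Dom w f) (hg : Dom w g) :
    Dom w (fun x => f x * g x) := by
  obtain ⟨K, hK, h⟩ := hf
  obtain ⟨K', hK', h'⟩ := hg
  obtain ⟨A, hA⟩ := hw.bdd
  have hA0 : 0 ≤ A := (hw.pos 0).le.trans (hA 0)
  refine ⟨K * K' * A, by positivity, fun x => ?_⟩
  have := (hw.pos x).le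
  calc |f x * g x| = |f x| * |g x| := abs_mul _ _
    _ ≤ (K * w x) * (K' * w x) := by gcongr; exacts [h x, h' x]
    _ = K * K' * w x * w x := by ring
    _ ≤ K * K' * A * w x := by gcongr; exact hA x

theorem Dom.memLp (hw : IsWeight w) (hf : Dom w f) (hc : Continuous f) : MemLp f 2 volume := by
  obtain ⟨K, hK, h⟩ := hf
  refine hw.memLp.of_le_mul (c := K) hc.aestronglyMeasurable (Eventually.of_forall fun x => ?_)
  simp only [Real.norm_eq_abs, abs_of_pos (hw.pos x)]
  exact h x

theorem Nice.dom (h : Nice w n f) : Dom w f := by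
  cases n <;> exact h.1

theorem Nice.continuous (h : Nice w n f) : Continuous f := by
  cases n
  · exact h.2
  · exact h.2.1.continuous

theorem Nice.memLp (hw : IsWeight w) (h : Nice w n f) : MemLp f 2 volume :=
  h.dom.memLp hw h.continuous

theorem Nice.deriv (h : Nice w (n + 1) f) : Nice w n (deriv f) := h.2.2

theorem Nice.hasDerivAt (h : Nice w (n + 1) f) (x : ℝ) : HasDerivAt f (_root_.deriv f x) x :=
  (h.2.1 x).hasDerivAt

theorem Nice.of_succ (h : Nice w (n + 1) f) : Nice w n f := by
  induction n generalizing f with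
  | zero => exact ⟨h.1, h.2.1.continuous⟩
  | succ n ih => exact ⟨h.1, h.2.1, ih h.2.2⟩

theorem Nice.add (hf : Nice w n f) (hg : Nice w n g) : Nice w n (fun x => f x + g x) := by
  induction n generalizing f g with
  | zero => exact ⟨hf.1.add hg.1, hf.2.add hg.2⟩
  | succ n ih =>
    refine ⟨hf.1.add hg.1, hf.2.1.add hg.2.1, ?_⟩
    rw [show _root_.deriv (fun x => f x + g x) = fun x => _root_.deriv f x + _root_.deriv g x from
      funext fun x => ((hf.hasDerivAt x).fun_add (hg.hasDerivAt x)).deriv]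
    exact ih hf.2.2 hg.2.2

theorem Nice.const_mul (hf : Nice w n f) (a : ℝ) : Nice w n (fun x => a * f x) := by
  induction n generalizing f with
  | zero => exact ⟨hf.1.const_mul a, continuous_const.mul hf.2⟩
  | succ n ih =>
    refine ⟨hf.1.const_mul a, hf.2.1.const_mul a, ?_⟩
    rw [show _root_.deriv (fun x => a * f x) = fun x => a * _root_.deriv f x from
      funext fun x => ((hf.hasDerivAt x).const_mul a).deriv]
    exact ih hf.2.2

theorem Nice.mul (hw : IsWeight w) (hf : Nice w n f) (hg : Nice w n g) :
    Nice w n (fun x => f x * g x) := by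
  induction n generalizing f g with
  | zero => exact ⟨hf.1.mul hw hg.1, hf.2.mul hg.2⟩
  | succ n ih =>
    refine ⟨hf.1.mul hw hg.1, hf.2.1.mul hg.2.1, ?_⟩
    rw [show _root_.deriv (fun x => f x * g x) =
        fun x => _root_.deriv f x * g x + f x * _root_.deriv g x from
      funext fun x => ((hf.hasDerivAt x).fun_mul (hg.hasDerivAt x)).deriv]
    exact (ih hf.2.2 hg.of_succ).add (ih hf.of_succ hg.2.2)

/-- The weight has no zeros, so `f / w` is continuous and therefore bounded on the support. This
brings the test functions of the weak formulation under the same consistency estimates as the wave.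
-/
theorem dom_of_hasCompactSupport (hw : IsWeight w) (hc : Continuous f) (hs : HasCompactSupport f) :
    Dom w f := by
  have hq : Continuous (fun x => f x / w x) := hc.div hw.continuous fun x => (hw.pos x).ne'
  obtain ⟨K, hK⟩ := hs.isCompact.exists_bound_of_continuousOn hq.continuousOn
  refine ⟨max K 0, le_max_right _ _, fun x => ?_⟩
  have hx := hw.pos x
  by_cases h : x ∈ tsupport f
  · have h1 := hK x h
    rw [Real.norm_eq_abs, abs_div, abs_of_pos hx, div_le_iff₀ hx] at h1
    exact h1.trans (by gcongr; exact le_max_left _ _)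
  · rw [image_eq_zero_of_notMem_tsupport h, abs_zero]
    positivity

theorem nice_of_hasCompactSupport (hw : IsWeight w) (hc : ContDiff ℝ (⊤ : ℕ∞) f)
    (hs : HasCompactSupport f) (n : ℕ) : Nice w n f := by
  induction n generalizing f with
  | zero => exact ⟨dom_of_hasCompactSupport hw hc.continuous hs, hc.continuous⟩
  | succ n ih =>
    exact ⟨dom_of_hasCompactSupport hw hc.continuous hs, hc.differentiable (by simp),
      ih (contDiff_infty_iff_deriv.1 hc).2 hs.deriv⟩

end Nice

/-! ### Taylor expansion of averages. -/

/-- The mean value inequality raises the order of vanishing by one. Repeated use integrates a bound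
on the highest derivative up to a Taylor remainder; the factors `1/(n+1)` are not needed and are
dropped. -/
theorem abs_le_mul_pow_succ {g g1 : ℝ → ℝ} (h : ∀ s, HasDerivAt g (g1 s) s) (h0 : g 0 = 0)
    {r K : ℝ} (hK : 0 ≤ K) (n : ℕ) (b : ∀ s ∈ Icc 0 r, |g1 s| ≤ K * s ^ n) :
    ∀ s ∈ Icc 0 r, |g s| ≤ K * s ^ (n + 1) := by
  intro s hs
  have := Convex.norm_image_sub_le_of_norm_hasDerivWithin_le (f := g) (f' := g1) (s := Icc 0 s)
    (C := K * s ^ n) (x := 0) (y := s)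
    (fun t _ => (h t).hasDerivWithinAt) (fun t ht => (b t ⟨ht.1, ht.2.trans hs.2⟩).trans (by
      have := ht.1
      have := ht.2
      gcongr)) (convex_Icc _ _) ⟨le_rfl, hs.1⟩ ⟨hs.1, le_rfl⟩
  rw [h0, sub_zero, sub_zero, Real.norm_eq_abs, Real.norm_eq_abs, abs_of_nonneg hs.1] at this
  rw [pow_succ]
  linarith

theorem avg_eq_integral_symm {f : ℝ → ℝ} (hf : Continuous f) (η x : ℝ) :
    avg η f x = 1 / η * ∫ s in (0 : ℝ)..(η / 2), (f (x + s) + f (x - s)) := by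
  have hi := fun a b => hf.intervalIntegrable (μ := volume) a b
  rw [intervalIntegral.integral_add (Continuous.intervalIntegrable (by fun_prop) _ _)
    (Continuous.intervalIntegrable (by fun_prop) _ _),
    intervalIntegral.integral_comp_add_left (fun t => f t),
    intervalIntegral.integral_comp_sub_left (fun t => f t), add_zero, sub_zero, add_comm,
    intervalIntegral.integral_add_adjacent_intervals (hi _ _) (hi _ _)]
  rfl

/-- Folding the average about its centre removes odd orders. The term `s² p` integrates to `η²/24 p`
after division by `η`, and the remainder to at most `(1/η) · 2K ηⁿ · η/2`. -/
theorem abs_avg_sub_le {f : ℝ → ℝ} (hf : Continuous f) {η x K p : ℝ} {n : ℕ} (hη : 0 < η)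
    (hK : 0 ≤ K)
    (h : ∀ s ∈ Icc 0 (η / 2), |f (x + s) + f (x - s) - 2 * f x - s ^ 2 * p| ≤ 2 * K * s ^ n) :
    |avg η f x - f x - η ^ 2 / 24 * p| ≤ K * η ^ n := by
  have e : avg η f x - f x - η ^ 2 / 24 * p =
      1 / η * ∫ s in (0 : ℝ)..(η / 2), (f (x + s) + f (x - s) - 2 * f x - s ^ 2 * p) := by
    rw [intervalIntegral.integral_sub, intervalIntegral.integral_sub, mul_sub, mul_sub,
      ← avg_eq_integral_symm hf]
    · simp
      field_simp
      ring
    all_goals exact Continuous.intervalIntegrable (by fun_prop) _ _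
  rw [e, abs_mul, abs_of_pos (by positivity : 0 < 1 / η)]
  have := intervalIntegral.norm_integral_le_of_norm_le_const (a := 0) (b := η / 2)
    (f := fun s => f (x + s) + f (x - s) - 2 * f x - s ^ 2 * p) (C := 2 * K * η ^ n)
    (fun s hs => by
      rw [uIoc_of_le (by positivity)] at hs
      refine (h s ⟨hs.1.le, hs.2⟩).trans ?_
      have := hs.1.le
      have : s ≤ η := by linarith [hs.2]
      gcongr)
  rw [sub_zero, abs_of_pos (by positivity : 0 < η / 2), Real.norm_eq_abs] at this
  calc _ ≤ 1 / η * (2 * K * η ^ n * (η / 2)) := by gcongr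
    _ = _ := by field_simp

theorem hasDerivAt_comp_add_left {f : ℝ → ℝ} {f' : ℝ} {x s : ℝ} (h : HasDerivAt f f' (x + s)) :
    HasDerivAt (fun s => f (x + s)) f' s := h.comp_const_add x s

theorem hasDerivAt_comp_sub_left {f : ℝ → ℝ} {f' : ℝ} {x s : ℝ} (h : HasDerivAt f f' (x - s)) :
    HasDerivAt (fun s => f (x - s)) (-f') s := h.comp_const_sub x s

theorem abs_avg_sub_self_le {f f1 f2 : ℝ → ℝ} (h1 : ∀ x, HasDerivAt f (f1 x) x)
    (h2 : ∀ x, HasDerivAt f1 (f2 x) x) {η x K : ℝ} (hη : 0 < η)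
    (hK : ∀ y, |x - y| ≤ η → |f2 y| ≤ K) : |avg η f x - f x| ≤ K * η ^ 2 := by
  have hf : Continuous f := continuous_iff_continuousAt.2 fun x => (h1 x).continuousAt
  have hK0 : 0 ≤ K := (abs_nonneg _).trans (hK x (by simpa using hη.le))
  have b1 : ∀ s ∈ Icc 0 (η / 2), |f1 (x + s) - f1 (x - s)| ≤ 2 * K * s ^ (0 + 1) := by
    refine abs_le_mul_pow_succ (g1 := fun s => f2 (x + s) + f2 (x - s)) (fun s => ?_) (by simp)
      (by positivity) 0 fun s hs => ?_
    · refine ((hasDerivAt_comp_add_left (h2 _)).fun_sub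
        (hasDerivAt_comp_sub_left (h2 _))).congr_deriv (by ring)
    · have k1 := hK (x + s) (by rw [sub_add_cancel_left, abs_neg, abs_of_nonneg hs.1]; linarith [hs.2])
      have k2 := hK (x - s) (by rw [sub_sub_cancel, abs_of_nonneg hs.1]; linarith [hs.2])
      have := abs_add_le (f2 (x + s)) (f2 (x - s))
      simp only [pow_zero, mul_one]
      linarith
  have b2 : ∀ s ∈ Icc 0 (η / 2), |f (x + s) + f (x - s) - 2 * f x - s ^ 2 * 0| ≤
      2 * K * s ^ (1 + 1) := by
    refine abs_le_mul_pow_succ (g1 := fun s => f1 (x + s) - f1 (x - s)) (fun s => ?_)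
      (by simp; ring) (by positivity) 1 b1
    simp only [mul_zero, sub_zero]
    exact (((hasDerivAt_comp_add_left (h1 _)).fun_add
      (hasDerivAt_comp_sub_left (h1 _))).sub_const (2 * f x)).congr_deriv (by ring)
  simpa using abs_avg_sub_le hf hη hK0 b2

theorem abs_avg_sub_self_sub_le {f f1 f2 f3 f4 : ℝ → ℝ} (h1 : ∀ x, HasDerivAt f (f1 x) x)
    (h2 : ∀ x, HasDerivAt f1 (f2 x) x) (h3 : ∀ x, HasDerivAt f2 (f3 x) x)
    (h4 : ∀ x, HasDerivAt f3 (f4 x) x) {η x K : ℝ} (hη : 0 < η)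
    (hK : ∀ y, |x - y| ≤ η → |f4 y| ≤ K) :
    |avg η f x - f x - η ^ 2 / 24 * f2 x| ≤ K * η ^ 4 := by
  have hf : Continuous f := continuous_iff_continuousAt.2 fun x => (h1 x).continuousAt
  have hK0 : 0 ≤ K := (abs_nonneg _).trans (hK x (by simpa using hη.le))
  have b1 : ∀ s ∈ Icc 0 (η / 2), |f3 (x + s) - f3 (x - s)| ≤ 2 * K * s ^ (0 + 1) := by
    refine abs_le_mul_pow_succ (g1 := fun s => f4 (x + s) + f4 (x - s)) (fun s => ?_) (by simp)
      (by positivity) 0 fun s hs => ?_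
    · refine ((hasDerivAt_comp_add_left (h4 _)).fun_sub
        (hasDerivAt_comp_sub_left (h4 _))).congr_deriv (by ring)
    · have k1 := hK (x + s) (by rw [sub_add_cancel_left, abs_neg, abs_of_nonneg hs.1]; linarith [hs.2])
      have k2 := hK (x - s) (by rw [sub_sub_cancel, abs_of_nonneg hs.1]; linarith [hs.2])
      have := abs_add_le (f4 (x + s)) (f4 (x - s))
      simp only [pow_zero, mul_one]
      linarith
  -- From here each step integrates the previous one, subtracting the value at `s = 0` so that every
  -- function in the chain vanishes there.
  have b2 : ∀ s ∈ Icc 0 (η / 2), |f2 (x + s) + f2 (x - s) - 2 * f2 x| ≤ 2 * K * s ^ (1 + 1) := by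
    refine abs_le_mul_pow_succ (g1 := fun s => f3 (x + s) - f3 (x - s)) (fun s => ?_)
      (by simp; ring) (by positivity) 1 b1
    exact (((hasDerivAt_comp_add_left (h3 _)).fun_add
      (hasDerivAt_comp_sub_left (h3 _))).sub_const (2 * f2 x)).congr_deriv (by ring)
  have b3 : ∀ s ∈ Icc 0 (η / 2), |f1 (x + s) - f1 (x - s) - 2 * f2 x * s| ≤
      2 * K * s ^ (2 + 1) := by
    refine abs_le_mul_pow_succ (g1 := fun s => f2 (x + s) + f2 (x - s) - 2 * f2 x) (fun s => ?_)
      (by simp) (by positivity) 2 b2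
    exact (((hasDerivAt_comp_add_left (h2 _)).fun_sub
      (hasDerivAt_comp_sub_left (h2 _))).fun_sub
        ((hasDerivAt_id s).const_mul (2 * f2 x))).congr_deriv (by ring)
  have b4 : ∀ s ∈ Icc 0 (η / 2), |f (x + s) + f (x - s) - 2 * f x - s ^ 2 * f2 x| ≤
      2 * K * s ^ (3 + 1) := by
    refine abs_le_mul_pow_succ (g1 := fun s => f1 (x + s) - f1 (x - s) - 2 * f2 x * s)
      (fun s => ?_) (by simp; ring) (by positivity) 3 b3
    exact ((((hasDerivAt_comp_add_left (h1 _)).fun_add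
      (hasDerivAt_comp_sub_left (h1 _))).sub_const (2 * f x)).fun_sub
        (((hasDerivAt_id s).fun_pow 2).mul_const (f2 x))).congr_deriv (by simp; ring)
  exact abs_avg_sub_le hf hη hK0 b4

theorem avg_sub {f g : ℝ → ℝ} (hf : MemLp f 2 volume) (hg : MemLp g 2 volume) (η : ℝ) :
    avg η (f - g) = avg η f - avg η g := by
  rw [sub_eq_add_neg, avg_add hf hg.neg, show -g = (-1 : ℝ) • g by simp, avg_smul]
  simp [sub_eq_add_neg]

theorem abs_avg_le_of_le {f : ℝ → ℝ} {η x K : ℝ} (hη : 0 < η)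
    (hK : ∀ y, |x - y| ≤ η → |f y| ≤ K) : |avg η f x| ≤ K := by
  have := intervalIntegral.norm_integral_le_of_norm_le_const (a := x - η / 2) (b := x + η / 2)
    (f := f) (C := K) (fun y hy => by
      rw [uIoc_of_le (by linarith)] at hy
      exact hK y (by rw [abs_le]; constructor <;> linarith [hy.1, hy.2]))
  rw [show x + η / 2 - (x - η / 2) = η by ring, abs_of_pos hη, Real.norm_eq_abs] at this
  rw [avg, abs_mul, abs_of_pos (by positivity : 0 < 1 / η)]
  calc _ ≤ 1 / η * (K * η) := by gcongr
    _ = _ := by field_simp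

section Weighted

variable {w f g : ℝ → ℝ}

theorem IsWeight.exists_slow (hw : IsWeight w) (R : ℝ) :
    ∃ C, 0 ≤ C ∧ ∀ x y, |x - y| ≤ R → w y ≤ C * w x := by
  obtain ⟨C, hC⟩ := hw.slow R
  refine ⟨max C 0, le_max_right _ _, fun x y h => (hC x y h).trans ?_⟩
  have := (hw.pos x).le
  gcongr
  exact le_max_left _ _

theorem IsWeight.abs_avg_le (hw : IsWeight w) (R : ℝ) : ∃ C, 0 ≤ C ∧ ∀ (f : ℝ → ℝ) (K : ℝ),
    0 ≤ K → (∀ x, |f x| ≤ K * w x) → ∀ η, 0 < η → η ≤ R → ∀ x, |avg η f x| ≤ K * C * w x := by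
  obtain ⟨C, hC, h⟩ := hw.exists_slow R
  refine ⟨C, hC, fun f K hK hf η hη hR x => abs_avg_le_of_le hη fun y hy => (hf y).trans ?_⟩
  rw [mul_assoc]
  gcongr
  exact h x y (hy.trans hR)

theorem Nice.abs_avg_sub_le (hw : IsWeight w) (hf : Nice w 2 f) (R : ℝ) :
    ∃ C, 0 ≤ C ∧ ∀ η, 0 < η → η ≤ R → ∀ x, |avg η f x - f x| ≤ C * η ^ 2 * w x := by
  obtain ⟨C, hC, h⟩ := hw.exists_slow R
  obtain ⟨K, hK, hk⟩ := hf.deriv.deriv.dom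
  refine ⟨K * C, by positivity, fun η hη hR x => ?_⟩
  have := abs_avg_sub_self_le hf.hasDerivAt hf.deriv.hasDerivAt hη (x := x) (K := K * (C * w x))
    fun y hy => (hk y).trans (by gcongr; exact h x y (hy.trans hR))
  refine this.trans (le_of_eq (by ring))

theorem Nice.abs_avg_sub_sub_le (hw : IsWeight w) (hf : Nice w 4 f) (R : ℝ) :
    ∃ C, 0 ≤ C ∧ ∀ η, 0 < η → η ≤ R → ∀ x,
      |avg η f x - f x - η ^ 2 / 24 * _root_.deriv (_root_.deriv f) x| ≤ C * η ^ 4 * w x := by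
  obtain ⟨C, hC, h⟩ := hw.exists_slow R
  obtain ⟨K, hK, hk⟩ := hf.deriv.deriv.deriv.deriv.dom
  refine ⟨K * C, by positivity, fun η hη hR x => ?_⟩
  have := abs_avg_sub_self_sub_le hf.hasDerivAt hf.deriv.hasDerivAt hf.deriv.deriv.hasDerivAt
    hf.deriv.deriv.deriv.hasDerivAt hη (x := x) (K := K * (C * w x))
    fun y hy => (hk y).trans (by gcongr; exact h x y (hy.trans hR))
  refine this.trans (le_of_eq (by ring))

theorem Nice.abs_avg_avg_sub_sub_le (hw : IsWeight w) (hf : Nice w 4 f) (R : ℝ) :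
    ∃ C, 0 ≤ C ∧ ∀ η, 0 < η → η ≤ R → ∀ x,
      |avg η (avg η f) x - f x - η ^ 2 / 12 * _root_.deriv (_root_.deriv f) x| ≤
        C * η ^ 4 * w x := by
  obtain ⟨C₁, hC₁, h₁⟩ := hf.abs_avg_sub_sub_le hw R
  obtain ⟨C₂, hC₂, h₂⟩ := hf.deriv.deriv.abs_avg_sub_le hw R
  obtain ⟨C₃, hC₃, h₃⟩ := hw.abs_avg_le R
  refine ⟨C₁ * C₃ + C₂ / 24 + C₁, by positivity, fun η hη hR x => ?_⟩
  have m1 : MemLp f 2 volume := hf.memLp hw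
  have m2 : MemLp (_root_.deriv (_root_.deriv f)) 2 volume := hf.deriv.deriv.memLp hw
  -- With `r = A f - f - (η²/24) f''`, the quantity to bound is `A r + (η²/24)(A f'' - f'') + r`.
  have e : avg η (fun x => avg η f x - f x - η ^ 2 / 24 * _root_.deriv (_root_.deriv f) x) x =
      avg η (avg η f) x - avg η f x - η ^ 2 / 24 * avg η (_root_.deriv (_root_.deriv f)) x := by
    have := avg_sub ((memLp_avg m1 η).sub m1) (m2.const_smul (η ^ 2 / 24)) η
    rw [avg_sub (memLp_avg m1 η) m1, avg_smul] at this
    exact congrFun this x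
  have b1 := h₃ _ (C₁ * η ^ 4) (by positivity) (h₁ η hη hR) η hη hR x
  rw [e] at b1
  have b2 := h₂ η hη hR x
  have b3 := h₁ η hη hR x
  have b4 : |η ^ 2 / 24 * (avg η (_root_.deriv (_root_.deriv f)) x -
      _root_.deriv (_root_.deriv f) x)| ≤ η ^ 2 / 24 * (C₂ * η ^ 2 * w x) := by
    rw [abs_mul, abs_of_nonneg (by positivity : 0 ≤ η ^ 2 / 24)]
    gcongr
  rw [abs_le] at b1 b3 b4 ⊢
  constructor <;> nlinarith

theorem Nice.abs_avg_mul_sub_le (hw : IsWeight w) (hf : Nice w 2 f) (hg : Nice w 2 g) (R : ℝ) :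
    ∃ C, 0 ≤ C ∧ ∀ η, 0 < η → η ≤ R → ∀ x,
      |avg η (fun y => avg η f y * avg η g y) x - f x * g x| ≤ C * η ^ 2 * w x := by
  obtain ⟨A, hA⟩ := hw.bdd
  have hA0 : 0 ≤ A := (hw.pos 0).le.trans (hA 0)
  obtain ⟨C₁, hC₁, h₁⟩ := hf.abs_avg_sub_le hw R
  obtain ⟨C₂, hC₂, h₂⟩ := hg.abs_avg_sub_le hw R
  obtain ⟨C₃, hC₃, h₃⟩ := hw.abs_avg_le R
  obtain ⟨C₄, hC₄, h₄⟩ := (hf.mul hw hg).abs_avg_sub_le hw R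
  obtain ⟨K, hK, hk⟩ := hf.dom
  obtain ⟨K', hK', hk'⟩ := hg.dom
  refine ⟨(C₁ * (K' * C₃) + K * C₂) * A * C₃ + C₄, by positivity, fun η hη hR x => ?_⟩
  have m1 := memLp_avg_mul (hf.memLp hw) (hg.memLp hw) η
  have m2 := (hf.mul hw hg).memLp hw
  have b : ∀ y, |avg η f y * avg η g y - f y * g y| ≤
      (C₁ * (K' * C₃) + K * C₂) * A * η ^ 2 * w y := by
    intro y
    have p := (hw.pos y).le
    have hAy := hA y
    calc |avg η f y * avg η g y - f y * g y|
        = |(avg η f y - f y) * avg η g y + f y * (avg η g y - g y)| := by ring_nf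
      _ ≤ |avg η f y - f y| * |avg η g y| + |f y| * |avg η g y - g y| := by
        rw [← abs_mul, ← abs_mul]; exact abs_add_le _ _
      _ ≤ (C₁ * η ^ 2 * w y) * (K' * C₃ * w y) + (K * w y) * (C₂ * η ^ 2 * w y) := by
        gcongr
        exacts [h₁ η hη hR y, h₃ g K' hK' hk' η hη hR y, hk y, h₂ η hη hR y]
      _ = (C₁ * (K' * C₃) + K * C₂) * w y * η ^ 2 * w y := by ring
      _ ≤ _ := by gcongr
  have e : avg η (fun y => avg η f y * avg η g y - f y * g y) x =
      avg η (fun y => avg η f y * avg η g y) x - avg η (fun y => f y * g y) x :=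
    congrFun (avg_sub m1 m2 η) x
  have b1 := h₃ _ _ (by positivity) b η hη hR x
  rw [e] at b1
  have b2 := h₄ η hη hR x
  rw [abs_le] at b1 b2 ⊢
  constructor <;> nlinarith

end Weighted

/-! ### Representatives of the operators, and the expansions in the `L²` norm. -/

theorem coe_toL2even {f : ℝ → ℝ} (hf : MemLp f 2 volume) (he : ∀ x, f (-x) = f x) :
    (toL2even f hf he : L2) =ᵐ[volume] f := hf.coeFn_toLp

theorem coe_opA (η : ℝ) (V : L2even) : (opA η V : L2) =ᵐ[volume] avg η (V : L2) :=
  coe_toL2even (memLp_avg (Lp.memLp _) η) (avg_even V.2 η)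

theorem coe_mulA (η : ℝ) (W V : L2even) :
    (mulA η W V : L2) =ᵐ[volume] fun x => avg η (W : L2) x * avg η (V : L2) x :=
  coe_toL2even (memLp_avg_mul (Lp.memLp _) (Lp.memLp _) η)
    (fun x => by rw [avg_even W.2, avg_even V.2])

theorem coe_superA (φ : ℝ → ℝ) (hφ : ContDiff ℝ 1 φ) (h0 : φ 0 = 0) (s η : ℝ) (W : L2even) :
    (superA φ hφ h0 s η W : L2) =ᵐ[volume] fun x => φ (s * avg η (W : L2) x) :=
  coe_toL2even (memLp_comp_avg (Lp.memLp _) η s hφ h0) (fun x => by rw [avg_even W.2])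

theorem coe_opA_of_ae {η : ℝ} {V : L2even} {f : ℝ → ℝ} (h : (V : L2) =ᵐ[volume] f) :
    (opA η V : L2) =ᵐ[volume] avg η f := by
  rw [← avg_congr h]; exact coe_opA η V

theorem coe_mulA_of_ae {η : ℝ} {V W : L2even} {f g : ℝ → ℝ} (hW : (W : L2) =ᵐ[volume] f)
    (hV : (V : L2) =ᵐ[volume] g) :
    (mulA η W V : L2) =ᵐ[volume] fun x => avg η f x * avg η g x := by
  rw [← avg_congr hW, ← avg_congr hV]; exact coe_mulA η W V

theorem coe_add (V W : L2even) :
    ((V + W : L2even) : L2) =ᵐ[volume] fun x => (V : L2) x + (W : L2) x :=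
  Lp.coeFn_add (V : L2) (W : L2)

theorem coe_sub (V W : L2even) :
    ((V - W : L2even) : L2) =ᵐ[volume] fun x => (V : L2) x - (W : L2) x :=
  Lp.coeFn_sub (V : L2) (W : L2)

theorem coe_smul (a : ℝ) (V : L2even) :
    ((a • V : L2even) : L2) =ᵐ[volume] fun x => a * (V : L2) x :=
  Lp.coeFn_smul a (V : L2)

theorem norm_le_of_ae_le {V : L2even} {f : ℝ → ℝ} (hf : MemLp f 2 volume) {C : ℝ} (hC : 0 ≤ C)
    (h : ∀ᵐ x, |(V : L2) x| ≤ C * |f x|) : ‖V‖ ≤ C * (eLpNorm f 2 volume).toReal := by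
  have h1 : eLpNorm (V : L2) 2 volume ≤ ENNReal.ofReal C * eLpNorm f 2 volume :=
    eLpNorm_le_mul_eLpNorm_of_ae_le_mul (by simpa using h) 2
  have := ENNReal.toReal_mono (ENNReal.mul_ne_top (by simp) hf.2.ne) h1
  rwa [ENNReal.toReal_mul, ENNReal.toReal_ofReal hC, ← Lp.norm_def] at this

section WeightedNorm

variable {w f g : ℝ → ℝ} {F F2 G H : L2even}

theorem norm_le_of_ae_eq (hw : IsWeight w) {h : ℝ → ℝ} (hF : (F : L2) =ᵐ[volume] h) {C : ℝ}
    (hC : 0 ≤ C) (hle : ∀ x, |h x| ≤ C * w x) : ‖F‖ ≤ C * (eLpNorm w 2 volume).toReal := by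
  refine norm_le_of_ae_le hw.memLp hC ?_
  filter_upwards [hF] with x hx
  rw [hx, abs_of_pos (hw.pos x)]
  exact hle x

theorem Nice.norm_opA_sub_le (hw : IsWeight w) (hf : Nice w 2 f) (hF : (F : L2) =ᵐ[volume] f)
    (R : ℝ) : ∃ C, 0 ≤ C ∧ ∀ η, 0 < η → η ≤ R → ‖opA η F - F‖ ≤ C * η ^ 2 := by
  obtain ⟨C, hC, h⟩ := hf.abs_avg_sub_le hw R
  refine ⟨C * (eLpNorm w 2 volume).toReal, by positivity, fun η hη hR => ?_⟩
  have e : ((opA η F - F : L2even) : L2) =ᵐ[volume] fun x => avg η f x - f x := by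
    filter_upwards [coe_sub (opA η F) F, coe_opA_of_ae hF, hF] with x h1 h2 h3
    rw [h1, h2, h3]
  exact (norm_le_of_ae_eq hw e (by positivity) (h η hη hR)).trans (le_of_eq (by ring))

theorem Nice.norm_sub_opA_opA_add_le (hw : IsWeight w) (hf : Nice w 4 f)
    (hF : (F : L2) =ᵐ[volume] f) (hF2 : (F2 : L2) =ᵐ[volume] _root_.deriv (_root_.deriv f))
    (R : ℝ) : ∃ C, 0 ≤ C ∧ ∀ η, 0 < η → η ≤ R →
      ‖F - opA η (opA η F) + (η ^ 2 / 12) • F2‖ ≤ C * η ^ 4 := by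
  obtain ⟨C, hC, h⟩ := hf.abs_avg_avg_sub_sub_le hw R
  refine ⟨C * (eLpNorm w 2 volume).toReal, by positivity, fun η hη hR => ?_⟩
  have e : ((F - opA η (opA η F) + (η ^ 2 / 12) • F2 : L2even) : L2) =ᵐ[volume] fun x =>
      f x - avg η (avg η f) x + η ^ 2 / 12 * _root_.deriv (_root_.deriv f) x := by
    filter_upwards [coe_add (F - opA η (opA η F)) ((η ^ 2 / 12) • F2), coe_sub F (opA η (opA η F)),
      coe_smul (η ^ 2 / 12) F2, coe_opA_of_ae (η := η) (coe_opA_of_ae (η := η) hF), hF, hF2]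
      with x h1 h2 h3 h4 h5 h6
    rw [h1, h2, h3, h4, h5, h6]
  refine (norm_le_of_ae_eq hw e (C := C * η ^ 4) (by positivity) fun x => ?_).trans
    (le_of_eq (by ring))
  rw [← abs_neg]
  refine le_trans (le_of_eq ?_) (h η hη hR x)
  ring_nf

theorem Nice.norm_opA_mulA_sub_le (hw : IsWeight w) (hf : Nice w 2 f) (hg : Nice w 2 g)
    (hF : (F : L2) =ᵐ[volume] f) (hG : (G : L2) =ᵐ[volume] g)
    (hH : (H : L2) =ᵐ[volume] fun x => f x * g x) (R : ℝ) :
    ∃ C, 0 ≤ C ∧ ∀ η, 0 < η → η ≤ R → ‖opA η (mulA η F G) - H‖ ≤ C * η ^ 2 := by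
  obtain ⟨C, hC, h⟩ := hf.abs_avg_mul_sub_le hw hg R
  refine ⟨C * (eLpNorm w 2 volume).toReal, by positivity, fun η hη hR => ?_⟩
  have e : ((opA η (mulA η F G) - H : L2even) : L2) =ᵐ[volume] fun x =>
      avg η (fun y => avg η f y * avg η g y) x - f x * g x := by
    filter_upwards [coe_sub (opA η (mulA η F G)) H, coe_opA_of_ae (coe_mulA_of_ae hF hG), hH]
      with x h1 h2 h3
    rw [h1, h2, h3]
  exact (norm_le_of_ae_eq hw e (by positivity) (h η hη hR)).trans (le_of_eq (by ring))

end WeightedNorm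

/-! ### The wave as a weight that dominates its own derivatives. -/

namespace Chain

variable {M : ℕ} (c : Chain M)

theorem isWeight_wave (hM : 0 < M) : IsWeight c.wave where
  continuous := c.continuous_wave
  pos := c.wave_pos hM
  memLp := c.memLp_wave hM
  bdd := ⟨_, c.wave_le hM⟩
  slow _ := ⟨_, fun _ _ h => soliton_le_exp_mul (c.ampl_pos hM) (c.rate_pos hM) h⟩

theorem deriv_wave : deriv c.wave = c.waveDeriv := funext fun x => (c.hasDerivAt_wave x).deriv

theorem deriv_waveDeriv (hM : 0 < M) :
    deriv c.waveDeriv = fun x => 1 / c.kdvA * (c.wave x + -c.kdvB * (c.wave x * c.wave x)) :=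
  funext fun x => by rw [(c.hasDerivAt_waveDeriv hM x).deriv]; ring

/-- Joint induction: the derivative of the wave is the second function, and by the differential
equation the derivative of the second is a polynomial in the wave without constant term. -/
theorem nice_wave_and_waveDeriv (hM : 0 < M) (n : ℕ) :
    Nice c.wave n c.wave ∧ Nice c.wave n c.waveDeriv := by
  have hw := c.isWeight_wave hM
  have d1 : Dom c.wave c.wave :=
    ⟨1, zero_le_one, fun x => by rw [abs_of_pos (c.wave_pos hM x), one_mul]⟩
  have d2 : Dom c.wave c.waveDeriv := ⟨2 * c.rate, by linarith [c.rate_pos hM],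
    abs_solitonDeriv_le (c.ampl_pos hM) (c.rate_pos hM)⟩
  have i1 : Differentiable ℝ c.wave := fun x => (c.hasDerivAt_wave x).differentiableAt
  have i2 : Differentiable ℝ c.waveDeriv := fun x =>
    (c.hasDerivAt_waveDeriv hM x).differentiableAt
  induction n with
  | zero => exact ⟨⟨d1, i1.continuous⟩, ⟨d2, i2.continuous⟩⟩
  | succ n ih =>
    refine ⟨⟨d1, i1, ?_⟩, ⟨d2, i2, ?_⟩⟩
    · rw [c.deriv_wave]; exact ih.2
    · rw [c.deriv_waveDeriv hM]
      exact (ih.1.add ((ih.1.mul hw ih.1).const_mul _)).const_mul _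

theorem nice_wave (hM : 0 < M) (n : ℕ) : Nice c.wave n c.wave :=
  (c.nice_wave_and_waveDeriv hM n).1

theorem nice_waveDeriv (hM : 0 < M) (n : ℕ) : Nice c.wave n c.waveDeriv :=
  (c.nice_wave_and_waveDeriv hM n).2

end Chain

/-! ### Self-adjointness, operator bounds and the quadratic form of `B_ε`. -/

theorem inner_eq_integral (V W : L2even) : inner ℝ V W = ∫ x, (V : L2) x * (W : L2) x := by
  change inner ℝ (V : L2) (W : L2) = _
  rw [L2.inner_def]
  refine integral_congr_ae (Eventually.of_forall fun x => ?_)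
  simp [mul_comm]

theorem inner_eq_integral_of_ae {V W : L2even} {f g : ℝ → ℝ} (hf : (V : L2) =ᵐ[volume] f)
    (hg : (W : L2) =ᵐ[volume] g) : inner ℝ V W = ∫ x, f x * g x := by
  rw [inner_eq_integral]
  refine integral_congr_ae ?_
  filter_upwards [hf, hg] with x h1 h2
  rw [h1, h2]

theorem norm_sq_eq_integral (V : L2even) : ‖V‖ ^ 2 = ∫ x, (V : L2) x ^ 2 := by
  rw [← real_inner_self_eq_norm_sq, inner_eq_integral]
  simp only [sq]

theorem avg_eq_integral_translate (η : ℝ) (f : ℝ → ℝ) (x : ℝ) :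
    avg η f x = 1 / η * ∫ s in (-(η / 2))..(η / 2), f (x + s) := by
  rw [intervalIntegral.integral_comp_add_left (fun t => f t), avg, ← sub_eq_add_neg]

theorem integrable_translate_mul {f g : ℝ → ℝ} (mf : Measurable f) (mg : Measurable g)
    (hf : MemLp f 2 volume) (hg : MemLp g 2 volume) (a b : ℝ) :
    Integrable (fun p : ℝ × ℝ => f (p.1 + p.2) * g p.1)
      ((volume : Measure ℝ).prod (volume.restrict (Ioc a b))) := by
  have m1 : Measurable fun p : ℝ × ℝ => f (p.1 + p.2) := mf.comp (measurable_fst.add measurable_snd)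
  have m2 : Measurable fun p : ℝ × ℝ => g p.1 := mg.comp measurable_fst
  -- The product is dominated by the sum of the two squares. Each square has a slice integral
  -- independent of the shift, and shifts range over a bounded interval, so Fubini applies.
  have key : ∀ h : ℝ → ℝ → ℝ, Measurable (Function.uncurry h) →
      (∀ s, Integrable (fun x => h x s ^ 2)) → (∃ C, ∀ s, ∫ x, h x s ^ 2 = C) →
      Integrable (fun p : ℝ × ℝ => h p.1 p.2 ^ 2)
        ((volume : Measure ℝ).prod (volume.restrict (Ioc a b))) := by
    rintro h mh hi ⟨C, hC⟩
    refine (integrable_prod_iff' (mh.pow_const 2).aestronglyMeasurable).2 ?_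
    refine ⟨Eventually.of_forall hi, ?_⟩
    simp only [Real.norm_eq_abs, abs_pow, sq_abs, Function.uncurry_apply_pair, hC]
    exact integrable_const C
  have i1 := key (fun x s => f (x + s)) m1 (fun s => hf.integrable_sq.comp_add_right s)
    ⟨_, fun s => integral_add_right_eq_self (fun x => f x ^ 2) s⟩
  have i2 := key (fun x _ => g x) m2 (fun _ => hg.integrable_sq) ⟨_, fun _ => rfl⟩
  refine (i1.add i2).mono' (m1.mul m2).aestronglyMeasurable (Eventually.of_forall fun p => ?_)
  simp only [Pi.add_apply, Real.norm_eq_abs]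
  rw [abs_le]
  constructor <;> nlinarith [sq_nonneg (f (p.1 + p.2) + g p.1), sq_nonneg (f (p.1 + p.2) - g p.1),
    sq_nonneg (f (p.1 + p.2)), sq_nonneg (g p.1)]

theorem integral_translate_mul {f g : ℝ → ℝ} (mf : Measurable f) (mg : Measurable g)
    (hf : MemLp f 2 volume) (hg : MemLp g 2 volume) {η : ℝ} (hη : 0 < η) :
    ∫ s in (-(η / 2))..(η / 2), ∫ x, f (x + s) * g x = η * ∫ x, avg η f x * g x := by
  have hle : -(η / 2) ≤ η / 2 := by linarith
  rw [intervalIntegral.integral_of_le hle,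
    ← integral_integral_swap (integrable_translate_mul mf mg hf hg _ _), ← integral_const_mul]
  refine integral_congr_ae (Eventually.of_forall fun x => ?_)
  simp only [avg_eq_integral_translate, integral_mul_const]
  rw [← intervalIntegral.integral_of_le hle]
  field_simp

/-- An average is a mean of translations over a symmetric range of shifts. The adjoint of a
translation is the opposite translation, and the reflection `s ↦ -s` preserves the range. -/
theorem integral_avg_mul {f g : ℝ → ℝ} (mf : Measurable f) (mg : Measurable g)
    (hf : MemLp f 2 volume) (hg : MemLp g 2 volume) {η : ℝ} (hη : 0 < η) :
    ∫ x, avg η f x * g x = ∫ x, f x * avg η g x := by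
  have h1 := integral_translate_mul mf mg hf hg hη
  have h2 := integral_translate_mul mg mf hg hf hη
  have h3 : ∫ s in (-(η / 2))..(η / 2), ∫ x, f (x + s) * g x =
      ∫ s in (-(η / 2))..(η / 2), ∫ x, g (x + s) * f x := by
    have hn := intervalIntegral.integral_comp_neg (a := -(η / 2)) (b := η / 2)
      (fun s => ∫ x, f (x + s) * g x)
    rw [neg_neg] at hn
    rw [← hn]
    refine intervalIntegral.integral_congr fun s _ => ?_
    rw [← integral_add_right_eq_self (fun x => f (x + -s) * g x) s]
    refine integral_congr_ae (Eventually.of_forall fun x => ?_)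
    simp only [add_neg_cancel_right]
    ring
  rw [h1, h2] at h3
  have := mul_left_cancel₀ hη.ne' h3
  rw [this]
  simp only [mul_comm]

theorem inner_opA_left {η : ℝ} (hη : 0 < η) (V W : L2even) :
    inner ℝ (opA η V) W = inner ℝ V (opA η W) := by
  rw [inner_eq_integral_of_ae (coe_opA η V) (ae_eq_refl _),
    inner_eq_integral_of_ae (ae_eq_refl _) (coe_opA η W)]
  exact integral_avg_mul (Lp.stronglyMeasurable _).measurable (Lp.stronglyMeasurable _).measurable
    (Lp.memLp _) (Lp.memLp _) hη

theorem inner_smul_left' (a : ℝ) (V W : L2even) : inner ℝ (a • V) W = a * inner ℝ V W := by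
  exact real_inner_smul_left (F := L2even) V W a

theorem inner_smul_right' (a : ℝ) (V W : L2even) : inner ℝ V (a • W) = a * inner ℝ V W := by
  exact real_inner_smul_right (F := L2even) V W a

theorem norm_opA_le (η : ℝ) (V : L2even) : ‖opA η V‖ ≤ ‖V‖ := by
  have := norm_le_of_ae_le (V := opA η V) (memLp_avg (Lp.memLp (V : L2)) η) zero_le_one (by
    filter_upwards [coe_opA η V] with x hx
    rw [hx, one_mul])
  rw [one_mul] at this
  refine this.trans ?_
  rw [Submodule.coe_norm, Lp.norm_def]
  exact ENNReal.toReal_mono (Lp.eLpNorm_ne_top _) (eLpNorm_avg_le (Lp.memLp _) η)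

theorem mulA_comm (η : ℝ) (V W : L2even) : mulA η V W = mulA η W V := by
  apply Subtype.ext
  apply Lp.ext
  filter_upwards [coe_mulA η V W, coe_mulA η W V] with x h1 h2
  rw [h1, h2, mul_comm]

theorem norm_mulA_le (η : ℝ) (V W : L2even) : ‖mulA η V W‖ ≤ (√|η|)⁻¹ * ‖V‖ * ‖W‖ := by
  have h : ‖mulA η V‖ ≤ (√|η|)⁻¹ * (eLpNorm (V : L2) 2 volume).toReal :=
    LinearMap.mkContinuous_norm_le _ (by positivity) _
  exact (mulA η V).le_of_opNorm_le h W

theorem norm_mulA_le_of_le {η B : ℝ} {V : L2even} (hB : 0 ≤ B)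
    (h : ∀ x, |avg η (V : L2) x| ≤ B) (W : L2even) : ‖mulA η V W‖ ≤ B * ‖W‖ := by
  have := norm_le_of_ae_le (V := mulA η V W) (memLp_avg (Lp.memLp (W : L2)) η) hB (by
    filter_upwards [coe_mulA η V W] with x hx
    rw [hx, abs_mul]
    gcongr
    exact h x)
  refine this.trans ?_
  gcongr
  rw [Submodule.coe_norm, Lp.norm_def]
  exact ENNReal.toReal_mono (Lp.eLpNorm_ne_top _) (eLpNorm_avg_le (Lp.memLp _) η)

theorem inner_mulA_left (η : ℝ) (V W Z : L2even) :
    inner ℝ (mulA η V W) (opA η Z) = inner ℝ (opA η W) (mulA η V Z) := by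
  rw [inner_eq_integral_of_ae (coe_mulA η V W) (coe_opA η Z),
    inner_eq_integral_of_ae (coe_opA η W) (coe_mulA η V Z)]
  refine integral_congr_ae (Eventually.of_forall fun x => ?_)
  ring

theorem mulA_self_sub (η : ℝ) (V W : L2even) :
    mulA η V V - mulA η W W = mulA η V (V - W) + mulA η W (V - W) := by
  rw [map_sub, map_sub, mulA_comm η W V]
  abel

namespace Chain

variable {M : ℕ} (c : Chain M)

theorem opB_apply (ε : ℝ) (V : L2even) : c.opB ε V = V + ∑ i, (c.α i * range i ^ 2 / ε ^ 2) •
    (V - opA (range i * ε) (opA (range i * ε) V)) := by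
  simp [opB]

theorem opM_apply (W₀ : L2even) (ε : ℝ) (V : L2even) : c.opM W₀ ε V =
    (2 : ℝ) • ∑ i, (c.β i * range i ^ 3) • opA (range i * ε) (mulA (range i * ε) W₀ V) := by
  simp [opM]

theorem opL_apply (W₀ : L2even) (ε : ℝ) (V : L2even) :
    c.opL W₀ ε V = c.opB ε V - c.opM W₀ ε V := rfl

variable {c} {ε : ℝ}

theorem inner_opB (hε : 0 < ε) (V W : L2even) :
    inner ℝ (c.opB ε V) W = inner ℝ V (c.opB ε W) := by
  rw [opB_apply, opB_apply, inner_add_left, inner_add_right, sum_inner, inner_sum]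
  congr 1
  refine Finset.sum_congr rfl fun i _ => ?_
  have := mul_pos (range_pos i) hε
  rw [inner_smul_left', inner_smul_right', inner_sub_left, inner_sub_right,
    inner_opA_left this, inner_opA_left this]

theorem inner_opM (W₀ : L2even) (hε : 0 < ε) (V W : L2even) :
    inner ℝ (c.opM W₀ ε V) W = inner ℝ V (c.opM W₀ ε W) := by
  rw [opM_apply, opM_apply, inner_smul_left', inner_smul_right', sum_inner, inner_sum]
  congr 1
  refine Finset.sum_congr rfl fun i _ => ?_
  have := mul_pos (range_pos i) hε
  rw [inner_smul_left', inner_smul_right', inner_opA_left this, inner_mulA_left,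
    inner_opA_left this]

theorem inner_opL (W₀ : L2even) (hε : 0 < ε) (V W : L2even) :
    inner ℝ (c.opL W₀ ε V) W = inner ℝ V (c.opL W₀ ε W) := by
  rw [opL_apply, opL_apply, inner_sub_left, inner_sub_right, inner_opB hε, inner_opM W₀ hε]

theorem inner_opB_self (hε : 0 < ε) (V : L2even) : inner ℝ (c.opB ε V) V =
    ‖V‖ ^ 2 + ∑ i, c.α i * range i ^ 2 / ε ^ 2 * (‖V‖ ^ 2 - ‖opA (range i * ε) V‖ ^ 2) := by
  rw [opB_apply, inner_add_left, real_inner_self_eq_norm_sq, sum_inner]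
  congr 1
  refine Finset.sum_congr rfl fun i _ => ?_
  rw [inner_smul_left', inner_sub_left, real_inner_self_eq_norm_sq,
    inner_opA_left (mul_pos (range_pos i) hε), real_inner_self_eq_norm_sq]

theorem energy_term_nonneg (ε : ℝ) (V : L2even) (i : Fin M) :
    0 ≤ c.α i * range i ^ 2 / ε ^ 2 * (‖V‖ ^ 2 - ‖opA (range i * ε) V‖ ^ 2) := by
  have h1 := (c.α_pos i).le
  have h2 : ‖opA (range i * ε) V‖ ^ 2 ≤ ‖V‖ ^ 2 := by
    gcongr; exact norm_opA_le _ _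
  have h3 := sub_nonneg.2 h2
  positivity

/-- Averaging is a contraction of `L²`, so every term of the quadratic form beyond `‖V‖²` is
nonnegative; Cauchy–Schwarz does the rest. -/
theorem norm_le_norm_opB (hε : 0 < ε) (V : L2even) : ‖V‖ ≤ ‖c.opB ε V‖ := by
  rcases (norm_nonneg V).eq_or_lt with h | h
  · rw [← h]; exact norm_nonneg _
  · have h1 : ‖V‖ ^ 2 ≤ ‖c.opB ε V‖ * ‖V‖ := by
      refine le_trans ?_ (real_inner_le_norm _ _)
      rw [inner_opB_self hε]
      exact le_add_of_nonneg_right (Finset.sum_nonneg fun i _ => energy_term_nonneg ε V i)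
    rw [sq] at h1
    exact le_of_mul_le_mul_right h1 h

end Chain

/-! ### Residual bounds and Lipschitz estimates for the nonlinear terms. -/

theorem even_deriv_deriv {f : ℝ → ℝ} (he : ∀ x, f (-x) = f x) (x : ℝ) :
    deriv (deriv f) (-x) = deriv (deriv f) x := by
  have h1 : deriv f = fun x => -deriv f (-x) := by
    funext x
    rw [← deriv_comp_neg]
    simp only [he]
  have h2 : deriv (deriv f) x = deriv (fun x => -deriv f (-x)) x := by rw [← h1]
  rw [h2, deriv.fun_neg, deriv_comp_neg, neg_neg]

theorem norm_sum_smul_le {M : ℕ} (r : Fin M → ℝ) (F : Fin M → L2even) (C : Fin M → ℝ)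
    (hr : ∀ i, 0 ≤ r i) (h : ∀ i, ‖F i‖ ≤ C i) : ‖∑ i, r i • F i‖ ≤ ∑ i, r i * C i := by
  refine norm_sum_le_of_le _ fun i _ => ?_
  rw [norm_smul, Real.norm_of_nonneg (hr i)]
  exact mul_le_mul_of_nonneg_left (h i) (hr i)

theorem range_mul_le {M : ℕ} (i : Fin M) {ε : ℝ} (hε : 0 < ε) (h1 : ε ≤ 1) :
    range i * ε ≤ M := by
  have := range_le i
  have := range_pos i
  nlinarith

namespace Chain

variable {M : ℕ} {c : Chain M} {w f g : ℝ → ℝ} {F F2 G H : L2even}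

theorem coeff_nonneg (i : Fin M) : 0 ≤ c.β i * range i ^ 3 :=
  mul_nonneg (c.β_pos i).le (pow_nonneg (range_pos i).le _)

theorem norm_opB_sub_le (hw : IsWeight w) (hf : Nice w 4 f) (hF : (F : L2) =ᵐ[volume] f)
    (hF2 : (F2 : L2) =ᵐ[volume] deriv (deriv f)) :
    ∃ C, 0 ≤ C ∧ ∀ ε, 0 < ε → ε ≤ 1 → ‖c.opB ε F - (F - c.kdvA • F2)‖ ≤ C * ε ^ 2 := by
  obtain ⟨C, hC, h⟩ := hf.norm_sub_opA_opA_add_le hw hF hF2 M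
  refine ⟨∑ i, c.α i * range i ^ 2 * (C * range i ^ 4), ?_, fun ε hε h1 => ?_⟩
  · refine Finset.sum_nonneg fun i _ => ?_
    have := (c.α_pos i).le
    positivity
  have e : c.opB ε F - (F - c.kdvA • F2) = ∑ i, (c.α i * range i ^ 2 / ε ^ 2) •
      (F - opA (range i * ε) (opA (range i * ε) F) + ((range i * ε) ^ 2 / 12) • F2) := by
    -- The limiting term is distributed over the ranges: `α m² / ε²` times `(mε)² / 12` is `α m⁴ /
    -- 12`. Each summand is then a fourth-order remainder divided by `ε²`.
    have : c.kdvA • F2 = ∑ i, (c.α i * range i ^ 2 / ε ^ 2) • ((range i * ε) ^ 2 / 12) • F2 := by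
      rw [kdvA, Finset.sum_div, Finset.sum_smul]
      refine Finset.sum_congr rfl fun i _ => ?_
      rw [smul_smul]
      congr 1
      field_simp
    rw [opB_apply, this, Finset.sum_congr rfl fun i _ => smul_add _ _ _, Finset.sum_add_distrib]
    abel
  rw [e, Finset.sum_mul]
  refine (norm_sum_smul_le _ _ _ (fun i => ?_) fun i =>
    h _ (mul_pos (range_pos i) hε) (range_mul_le i hε h1)).trans (le_of_eq ?_)
  · have := (c.α_pos i).le
    positivity
  · refine Finset.sum_congr rfl fun i _ => ?_
    field_simp

theorem norm_sum_opA_mulA_sub_le (hw : IsWeight w) (hf : Nice w 2 f) (hg : Nice w 2 g)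
    (hF : (F : L2) =ᵐ[volume] f) (hG : (G : L2) =ᵐ[volume] g)
    (hH : (H : L2) =ᵐ[volume] fun x => f x * g x) :
    ∃ C, 0 ≤ C ∧ ∀ ε, 0 < ε → ε ≤ 1 →
      ‖(∑ i, (c.β i * range i ^ 3) • opA (range i * ε) (mulA (range i * ε) F G)) -
        c.kdvB • H‖ ≤ C * ε ^ 2 := by
  obtain ⟨C, hC, h⟩ := hf.norm_opA_mulA_sub_le hw hg hF hG hH M
  refine ⟨∑ i, c.β i * range i ^ 3 * (C * range i ^ 2), ?_, fun ε hε h1 => ?_⟩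
  · exact Finset.sum_nonneg fun i _ => mul_nonneg (coeff_nonneg i) (by positivity)
  rw [kdvB, Finset.sum_smul, ← Finset.sum_sub_distrib,
    Finset.sum_congr rfl fun i _ => (smul_sub _ _ _).symm, Finset.sum_mul]
  refine (norm_sum_smul_le _ _ _ (fun i => coeff_nonneg i) fun i =>
    h _ (mul_pos (range_pos i) hε) (range_mul_le i hε h1)).trans (le_of_eq ?_)
  refine Finset.sum_congr rfl fun i _ => ?_
  ring

/-- The differential equation for the wave says that the limits of `Q_ε[W₀]` and `B_ε W₀` coincide.
Only the two consistency errors of order `ε²` remain, and the prefactor `ε⁻²` cancels them. -/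
theorem norm_resR_le (hM : 0 < M) {W₀ : L2even} (hW : c.IsKdVWave W₀) :
    ∃ C, 0 ≤ C ∧ ∀ ε, 0 < ε → ε ≤ 1 → ‖c.resR W₀ ε‖ ≤ C := by
  have hw := c.isWeight_wave hM
  have hae := IsKdVWave.ae_eq hM hW
  have n4 := c.nice_wave hM 4
  have n2 := c.nice_wave hM 2
  have m2 : MemLp (deriv (deriv c.wave)) 2 volume := n4.deriv.deriv.memLp hw
  have mm : MemLp (fun x => c.wave x * c.wave x) 2 volume := (n2.mul hw n2).memLp hw
  set F2 := toL2even (deriv (deriv c.wave)) m2 (even_deriv_deriv c.wave_neg)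
  have hF2 : (F2 : L2) =ᵐ[volume] deriv (deriv c.wave) := coe_toL2even _ _
  set H := toL2even _ mm (fun x => by rw [c.wave_neg])
  have hH : (H : L2) =ᵐ[volume] fun x => c.wave x * c.wave x := coe_toL2even _ _
  obtain ⟨C₁, hC₁, h₁⟩ := norm_opB_sub_le (c := c) hw n4 hae hF2
  obtain ⟨C₂, hC₂, h₂⟩ := norm_sum_opA_mulA_sub_le (c := c) hw n2 n2 hae hae hH
  have e : c.kdvB • H = W₀ - c.kdvA • F2 := by
    apply Subtype.ext
    apply Lp.ext
    filter_upwards [coe_smul c.kdvB H, coe_sub W₀ (c.kdvA • F2), coe_smul c.kdvA F2, hH, hF2, hae]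
      with x h1 h2 h3 h4 h5 h6
    rw [h1, h2, h3, h4, h5, h6, c.deriv_wave, c.deriv_waveDeriv hM]
    have := c.kdvA_pos hM
    field_simp
    ring
  refine ⟨C₂ + C₁, by positivity, fun ε hε h1 => ?_⟩
  have e2 : c.resR W₀ ε = (1 / ε ^ 2) • (((∑ i, (c.β i * range i ^ 3) •
      opA (range i * ε) (mulA (range i * ε) W₀ W₀)) - c.kdvB • H) -
        (c.opB ε W₀ - (W₀ - c.kdvA • F2))) := by
    rw [resR, opQ, e]; congr 1; abel
  rw [e2, norm_smul, Real.norm_of_nonneg (by positivity), one_div, inv_mul_le_iff₀ (by positivity)]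
  refine (norm_sub_le _ _).trans ((add_le_add (h₂ ε hε h1) (h₁ ε hε h1)).trans (le_of_eq ?_))
  ring

/-- Averaging over length `η` maps `L²` to bounded functions at the cost `η^(-1/2)`. The factor `ε²`
more than pays for it, as `mε ≥ ε ≥ ε²`. -/
theorem sq_mul_inv_sqrt_le {ε : ℝ} (hε : 0 < ε) (h1 : ε ≤ 1) (i : Fin M) :
    ε ^ 2 * (√|range i * ε|)⁻¹ ≤ ε := by
  have hm := one_le_range i
  have h2 : ε ≤ √|range i * ε| := by
    rw [abs_of_pos (by positivity)]
    refine Real.le_sqrt_of_sq_le ?_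
    nlinarith
  rw [← div_eq_mul_inv, div_le_iff₀ (hε.trans_le h2), sq]
  gcongr

theorem norm_opQ_sub_le {ε : ℝ} (hε : 0 < ε) (h1 : ε ≤ 1) (V W : L2even) :
    ‖ε ^ 2 • c.opQ ε V - ε ^ 2 • c.opQ ε W‖ ≤ c.kdvB * ε * (‖V‖ + ‖W‖) * ‖V - W‖ := by
  have e : ε ^ 2 • c.opQ ε V - ε ^ 2 • c.opQ ε W = ∑ i, (c.β i * range i ^ 3) •
      (ε ^ 2 • opA (range i * ε) (mulA (range i * ε) V (V - W) +
        mulA (range i * ε) W (V - W))) := by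
    rw [← smul_sub, opQ, opQ, ← Finset.sum_sub_distrib, Finset.smul_sum]
    refine Finset.sum_congr rfl fun i _ => ?_
    rw [← mulA_self_sub, map_sub, ← smul_sub, smul_comm]
  rw [e]
  refine (norm_sum_smul_le _ _ (fun _ => ε * (‖V‖ + ‖W‖) * ‖V - W‖) (fun i => coeff_nonneg i)
    fun i => ?_).trans (le_of_eq ?_)
  · rw [norm_smul, Real.norm_of_nonneg (by positivity)]
    calc ε ^ 2 * ‖opA (range i * ε) (mulA (range i * ε) V (V - W) +
            mulA (range i * ε) W (V - W))‖
        ≤ ε ^ 2 * ((√|range i * ε|)⁻¹ * ‖V‖ * ‖V - W‖ + (√|range i * ε|)⁻¹ * ‖W‖ * ‖V - W‖) := by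
          gcongr
          exact (norm_opA_le _ _).trans ((norm_add_le _ _).trans
            (add_le_add (norm_mulA_le _ _ _) (norm_mulA_le _ _ _)))
      _ = ε ^ 2 * (√|range i * ε|)⁻¹ * ((‖V‖ + ‖W‖) * ‖V - W‖) := by ring
      _ ≤ ε * ((‖V‖ + ‖W‖) * ‖V - W‖) := by
          gcongr
          exact sq_mul_inv_sqrt_le hε h1 i
      _ = _ := by ring
  · rw [← Finset.sum_mul, kdvB]
    ring

/-- Mean value inequality with the quadratic bound on `Ψ''`. The sign of `γ` is not assumed, whence
its absolute value. -/
theorem abs_deriv_Ψ_sub_le (i : Fin M) {ρ r s : ℝ} (hρ : ρ ≤ 1) (hr : |r| ≤ ρ) (hs : |s| ≤ ρ) :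
    |deriv (c.Ψ i) r - deriv (c.Ψ i) s| ≤ |c.γ i| * ρ ^ 2 * |r - s| := by
  have hd : Differentiable ℝ (deriv (c.Ψ i)) := (c.contDiff_deriv_Ψ i).differentiable (by norm_num)
  refine Convex.norm_image_sub_le_of_norm_hasDerivWithin_le (s := Icc (-ρ) ρ)
    (f' := deriv (deriv (c.Ψ i))) (fun t _ => (hd t).hasDerivAt.hasDerivWithinAt)
    (fun t ht => ?_) (convex_Icc _ _) (abs_le.1 hs) (abs_le.1 hr)
  have ht' : |t| ≤ ρ := abs_le.2 ht
  refine (c.abs_deriv_deriv_Ψ_le i t (ht'.trans hρ)).trans ?_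
  rw [← sq_abs t]
  gcongr
  exact le_abs_self _

/-- The arguments of `Ψ'` are of size `ρ = m ε² B`, so `Ψ'` has Lipschitz constant of order `ρ²`,
that is `ε⁴`; the inner factor `m ε²` supplies the remaining `ε²` that cancels `ε⁻⁶`. The smallness
condition keeps the arguments in `[-1, 1]`. -/
theorem norm_opP_sub_le (B : ℝ) (hB : 0 ≤ B) : ∃ C, 0 ≤ C ∧ ∀ ε, 0 < ε → M * ε ^ 2 * B ≤ 1 →
    ∀ V W : L2even, (∀ (i : Fin M) x, |avg (range i * ε) (V : L2) x| ≤ B) →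
      (∀ (i : Fin M) x, |avg (range i * ε) (W : L2) x| ≤ B) →
      ‖c.opP ε V - c.opP ε W‖ ≤ C * ‖V - W‖ := by
  refine ⟨∑ i, range i * (|c.γ i| * (range i * B) ^ 2 * range i), ?_,
    fun ε hε hεB V W hV hW => ?_⟩
  · refine Finset.sum_nonneg fun i _ => ?_
    have := (range_pos i).le
    positivity
  have e : c.opP ε V - c.opP ε W = (1 / ε ^ 6) • ∑ i, range i • opA (range i * ε)
      (superA (deriv (c.Ψ i)) (c.contDiff_deriv_Ψ i) (c.deriv_Ψ_zero i)
        (range i * ε ^ 2) (range i * ε) V -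
      superA (deriv (c.Ψ i)) (c.contDiff_deriv_Ψ i) (c.deriv_Ψ_zero i)
        (range i * ε ^ 2) (range i * ε) W) := by
    simp only [opP, map_sub, smul_sub, Finset.sum_sub_distrib]
  rw [e, norm_smul, Real.norm_of_nonneg (by positivity), one_div, inv_mul_le_iff₀ (by positivity),
    Finset.sum_mul, Finset.mul_sum]
  refine (norm_sum_smul_le _ _ (fun i => |c.γ i| * (range i * ε ^ 2 * B) ^ 2 *
    (range i * ε ^ 2) * ‖V - W‖) (fun i => (range_pos i).le) fun i => ?_).trans (le_of_eq ?_)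
  · refine (norm_opA_le _ _).trans ?_
    have hm := range_pos i
    have hm' := range_le i
    have hs : range i * ε ^ 2 * B ≤ 1 := le_trans (by gcongr) hεB
    have hb : ∀ Z : L2even, (∀ (i : Fin M) x, |avg (range i * ε) (Z : L2) x| ≤ B) → ∀ x,
        |range i * ε ^ 2 * avg (range i * ε) (Z : L2) x| ≤ range i * ε ^ 2 * B := by
      intro Z hZ x
      rw [abs_mul, abs_of_pos (by positivity : 0 < range i * ε ^ 2)]
      gcongr
      exact hZ i x
    have hsub : avg (range i * ε) ((V - W : L2even) : L2) =
        avg (range i * ε) (V : L2) - avg (range i * ε) (W : L2) := by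
      rw [← avg_sub (Lp.memLp _) (Lp.memLp _)]
      exact avg_congr (coe_sub V W) _
    refine (norm_le_of_ae_le (memLp_avg (Lp.memLp ((V - W : L2even) : L2)) (range i * ε))
      (C := |c.γ i| * (range i * ε ^ 2 * B) ^ 2 * (range i * ε ^ 2)) (by positivity) ?_).trans ?_
    · filter_upwards [coe_sub (superA (deriv (c.Ψ i)) (c.contDiff_deriv_Ψ i) (c.deriv_Ψ_zero i)
          (range i * ε ^ 2) (range i * ε) V) (superA (deriv (c.Ψ i)) (c.contDiff_deriv_Ψ i)
          (c.deriv_Ψ_zero i) (range i * ε ^ 2) (range i * ε) W),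
        coe_superA _ (c.contDiff_deriv_Ψ i) (c.deriv_Ψ_zero i) (range i * ε ^ 2) (range i * ε) V,
        coe_superA _ (c.contDiff_deriv_Ψ i) (c.deriv_Ψ_zero i) (range i * ε ^ 2) (range i * ε) W]
        with x h1 h2 h3
      rw [h1, h2, h3]
      refine (abs_deriv_Ψ_sub_le i hs (hb V hV x) (hb W hW x)).trans (le_of_eq ?_)
      rw [← mul_sub, abs_mul, abs_of_pos (by positivity : 0 < range i * ε ^ 2), hsub,
        Pi.sub_apply]
      ring
    · gcongr
      rw [Submodule.coe_norm, Lp.norm_def]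
      exact ENNReal.toReal_mono (Lp.eLpNorm_ne_top _) (eLpNorm_avg_le (Lp.memLp _) _)
  · refine Finset.sum_congr rfl fun i _ => ?_
    ring

theorem abs_avg_isKdVWave_le (hM : 0 < M) {W₀ : L2even} (hW : c.IsKdVWave W₀) {η : ℝ}
    (hη : 0 < η) (x : ℝ) : |avg η (W₀ : L2) x| ≤ c.ampl := by
  rw [avg_congr (IsKdVWave.ae_eq hM hW)]
  refine abs_avg_le_of_le hη fun y _ => ?_
  rw [abs_of_pos (c.wave_pos hM y)]
  exact c.wave_le hM y

theorem avg_zero (η x : ℝ) : avg η ((0 : L2even) : L2) x = 0 := by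
  have h : ((0 : L2even) : L2) =ᵐ[volume] (0 : ℝ → ℝ) := Lp.coeFn_zero ℝ 2 volume
  rw [avg_congr h]
  simp [avg]

theorem opP_zero (c : Chain M) (ε : ℝ) : c.opP ε 0 = 0 := by
  have : ∀ i, superA (deriv (c.Ψ i)) (c.contDiff_deriv_Ψ i) (c.deriv_Ψ_zero i)
      (range i * ε ^ 2) (range i * ε) 0 = 0 := by
    intro i
    apply Subtype.ext
    apply Lp.ext
    refine (coe_superA _ (c.contDiff_deriv_Ψ i) (c.deriv_Ψ_zero i) _ _ 0).trans ?_
    filter_upwards [Lp.coeFn_zero ℝ 2 (volume : Measure ℝ)] with x hx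
    rw [avg_zero, mul_zero, c.deriv_Ψ_zero]
    exact hx.symm
  simp [opP, this]

/-- Comparison with the zero profile, at which `P_ε` vanishes because `Ψ'(0) = 0`. -/
theorem norm_resS_le (hM : 0 < M) {W₀ : L2even} (hW : c.IsKdVWave W₀) :
    ∃ C, 0 ≤ C ∧ ∀ ε, 0 < ε → M * ε ^ 2 * c.ampl ≤ 1 → ‖c.resS W₀ ε‖ ≤ C := by
  obtain ⟨C, hC, h⟩ := norm_opP_sub_le (c := c) c.ampl (c.ampl_pos hM).le
  refine ⟨C * ‖W₀‖, by positivity, fun ε hε h1 => ?_⟩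
  have := h ε hε h1 W₀ 0 (fun i x => abs_avg_isKdVWave_le hM hW (mul_pos (range_pos i) hε) x)
    (fun i x => by rw [avg_zero, abs_zero]; exact (c.ampl_pos hM).le)
  rwa [opP_zero, sub_zero, sub_zero] at this

theorem norm_opN_sub_le (hM : 0 < M) {W₀ : L2even} (hW : c.IsKdVWave W₀) {D : ℝ} (hD : 0 ≤ D) :
    ∃ C, 0 ≤ C ∧ ∀ ε, 0 < ε → ε ≤ 1 → M * ε ^ 2 * (c.ampl + D) ≤ 1 → ∀ V W : L2even,
      ‖V‖ ≤ D → ‖W‖ ≤ D → ‖c.opN W₀ ε V - c.opN W₀ ε W‖ ≤ C * ‖V - W‖ := by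
  have hA := (c.ampl_pos hM).le
  obtain ⟨C, hC, h⟩ := norm_opP_sub_le (c := c) (c.ampl + D) (by positivity)
  refine ⟨C, hC, fun ε hε h1 h2 V W hV hW' => ?_⟩
  -- The averages of `W₀` are bounded by its amplitude, and those of `ε² Z` by `ε ‖Z‖ ≤ D`. A single
  -- sup bound thus serves all `V` in the ball.
  have hb : ∀ Z : L2even, ‖Z‖ ≤ D → ∀ (i : Fin M) x,
      |avg (range i * ε) ((W₀ + ε ^ 2 • Z : L2even) : L2) x| ≤ c.ampl + D := by
    intro Z hZ i x
    rw [avg_coe_add, avg_coe_smul]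
    refine (abs_add_le _ _).trans (add_le_add
      (abs_avg_isKdVWave_le hM hW (mul_pos (range_pos i) hε) x) ?_)
    rw [Pi.smul_apply, smul_eq_mul, abs_mul, abs_of_nonneg (by positivity : 0 ≤ ε ^ 2)]
    have h3 := FPU.abs_avg_le (Lp.memLp (Z : L2)) (range i * ε) x
    rw [← Lp.norm_def, ← Submodule.coe_norm] at h3
    calc _ ≤ ε ^ 2 * ((√|range i * ε|)⁻¹ * ‖Z‖) := by gcongr
      _ = ε ^ 2 * (√|range i * ε|)⁻¹ * ‖Z‖ := by ring
      _ ≤ 1 * D := by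
        gcongr
        exact (sq_mul_inv_sqrt_le hε h1 i).trans h1
      _ = D := one_mul D
  have h4 := h ε hε h2 _ _ (hb V hV) (hb W hW')
  rw [add_sub_add_left_eq_sub, ← smul_sub, norm_smul,
    Real.norm_of_nonneg (by positivity : 0 ≤ ε ^ 2)] at h4
  rw [opN, opN, ← smul_sub, sub_sub_sub_cancel_right, norm_smul,
    Real.norm_of_nonneg (by positivity), one_div, inv_mul_le_iff₀ (by positivity)]
  linarith

theorem opQ_zero (c : Chain M) (ε : ℝ) : c.opQ ε 0 = 0 := by simp [opQ]

theorem opN_zero (c : Chain M) (W₀ : L2even) (ε : ℝ) : c.opN W₀ ε 0 = 0 := by simp [opN]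

end Chain

/-! ### Hölder continuity of averages from small mass loss. -/

/-- The square of the `L²` distance of `f` and its translate over the length `η` is bounded by
the loss of `L²` mass under averaging over intervals of length `η`. -/
theorem integral_translate_sub_sq_le {f : ℝ → ℝ} (mf : Measurable f) (hf : MemLp f 2 volume)
    {η : ℝ} (hη : 0 < η) :
    ∫ x, (f (x + η) - f x) ^ 2 ≤ 16 * ((∫ x, f x ^ 2) - ∫ x, avg η f x ^ 2) := by
  set u := avg η f with hu
  have mu : Measurable u := (continuous_avg hf η).measurable
  have hu2 : MemLp u 2 volume := memLp_avg hf η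
  have ht : ∀ s, MemLp (fun x => f (x + s)) 2 volume := fun s =>
    hf.comp_measurePreserving (measurePreserving_add_right volume s)
  -- `J s` is the squared distance from the translate of `f` by `s` to its average `u`. Its integral
  -- over all shifts is `η (‖f‖² - ‖u‖²)`, because the cross term integrates to `η ‖u‖²`.
  set J : ℝ → ℝ := fun s => ∫ x, (f (x + s) - u x) ^ 2 with hJ
  have eJ : J = fun s => (∫ x, f x ^ 2) + (∫ x, u x ^ 2) - 2 * ∫ x, f (x + s) * u x := by
    funext s
    have i3 : Integrable (fun x => 2 * (f (x + s) * u x)) :=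
      ((ht s).integrable_mul hu2).const_mul 2
    have i12 : Integrable (fun x => f (x + s) ^ 2 + u x ^ 2) :=
      (ht s).integrable_sq.add hu2.integrable_sq
    rw [hJ, ← integral_add_right_eq_self (fun x => f x ^ 2) s, ← integral_const_mul,
      ← integral_add (ht s).integrable_sq hu2.integrable_sq,
      ← integral_sub i12 i3]
    refine integral_congr_ae (Eventually.of_forall fun x => ?_)
    ring
  have hle : -(η / 2) ≤ η / 2 := by linarith
  have ik : IntervalIntegrable (fun s => ∫ x, f (x + s) * u x) volume (-(η / 2)) (η / 2) := by
    rw [intervalIntegrable_iff_integrableOn_Ioc_of_le hle]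
    exact (integrable_translate_mul mf mu hf hu2 (-(η / 2)) (η / 2)).integral_prod_right
  have iJ : IntervalIntegrable J volume (-(η / 2)) (η / 2) := by
    rw [eJ]
    exact intervalIntegrable_const.sub (ik.const_mul 2)
  have sJ : ∫ s in (-(η / 2))..(η / 2), J s = η * ((∫ x, f x ^ 2) - ∫ x, u x ^ 2) := by
    rw [eJ, intervalIntegral.integral_sub intervalIntegrable_const (ik.const_mul 2),
      intervalIntegral.integral_const_mul, integral_translate_mul mf mu hf hu2 hη,
      intervalIntegral.integral_const]
    simp only [smul_eq_mul, ← hu, ← sq]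
    ring
  have iJ1 : IntervalIntegrable J volume (-(η / 2)) 0 := iJ.mono_set (by
    rw [uIcc_of_le hle, uIcc_of_le (by linarith)]
    exact Icc_subset_Icc_right (by linarith))
  have iJ2 : IntervalIntegrable J volume 0 (η / 2) := iJ.mono_set (by
    rw [uIcc_of_le hle, uIcc_of_le (by linarith)]
    exact Icc_subset_Icc_left (by linarith))
  have two : ∀ (p q r : ℝ → ℝ), MemLp p 2 volume → MemLp q 2 volume → MemLp r 2 volume →
      ∫ x, (p x - q x) ^ 2 ≤ 2 * (∫ x, (p x - r x) ^ 2) + 2 * ∫ x, (q x - r x) ^ 2 := by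
    intro p q r hp hq hr
    have i1 : Integrable fun x => 2 * (p x - r x) ^ 2 := (hp.sub hr).integrable_sq.const_mul 2
    have i2 : Integrable fun x => 2 * (q x - r x) ^ 2 := (hq.sub hr).integrable_sq.const_mul 2
    rw [← integral_const_mul, ← integral_const_mul, ← integral_add i1 i2]
    refine integral_mono (hp.sub hq).integrable_sq (i1.add i2) fun x => ?_
    nlinarith [sq_nonneg (p x - r x + (q x - r x))]
  -- A half step is compared through `u` for every shift `s`. Integration over `s` in `[-η/2, 0]`
  -- makes the two terms cover the whole range of `J`, which gives the factor `4`; two half steps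
  -- then give `16`.
  have hΦ : ∀ s, ∫ x, (f (x + η / 2) - f x) ^ 2 ≤ 2 * J (s + η / 2) + 2 * J s := by
    intro s
    rw [← integral_add_right_eq_self (fun x => (f (x + η / 2) - f x) ^ 2) s]
    simp only [add_assoc]
    exact two _ _ u (ht _) (ht s) hu2
  have h4 : ∫ x, (f (x + η / 2) - f x) ^ 2 ≤ 4 * ((∫ x, f x ^ 2) - ∫ x, u x ^ 2) := by
    have iJs : IntervalIntegrable (fun s => J (s + η / 2)) volume (-(η / 2)) 0 := by
      have := iJ2.comp_add_right (η / 2)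
      simpa using this
    have hm := intervalIntegral.integral_mono_on (a := -(η / 2)) (b := 0) (by linarith)
      intervalIntegrable_const ((iJs.const_mul 2).add (iJ1.const_mul 2)) fun s _ => hΦ s
    rw [intervalIntegral.integral_const, intervalIntegral.integral_add (iJs.const_mul 2)
      (iJ1.const_mul 2), intervalIntegral.integral_const_mul, intervalIntegral.integral_const_mul,
      intervalIntegral.integral_comp_add_right (fun s => J s), neg_add_cancel, zero_add,
      ← mul_add, add_comm (∫ s in (0 : ℝ)..(η / 2), J s),
      intervalIntegral.integral_add_adjacent_intervals iJ1 iJ2, sJ, smul_eq_mul] at hm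
    have : η / 2 * (∫ x, (f (x + η / 2) - f x) ^ 2) ≤
        η / 2 * (4 * ((∫ x, f x ^ 2) - ∫ x, u x ^ 2)) := by linarith
    exact le_of_mul_le_mul_left this (by positivity)
  have h5 := two (fun x => f (x + η)) f (fun x => f (x + η / 2)) (ht _) hf (ht _)
  have h6 : ∫ x, (f (x + η) - f (x + η / 2)) ^ 2 = ∫ x, (f (x + η / 2) - f x) ^ 2 := by
    rw [← integral_add_right_eq_self (fun x => (f (x + η / 2) - f x) ^ 2) (η / 2)]
    simp only [add_assoc, add_halves]
  have h7 : ∫ x, (f x - f (x + η / 2)) ^ 2 = ∫ x, (f (x + η / 2) - f x) ^ 2 := by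
    refine integral_congr_ae (Eventually.of_forall fun x => ?_)
    ring
  rw [h6, h7] at h5
  linarith

theorem toReal_eLpNorm_two {f : ℝ → ℝ} (hf : MemLp f 2 volume) :
    (eLpNorm f 2 volume).toReal = √(∫ x, f x ^ 2) := by
  have h : ‖hf.toLp f‖ ^ 2 = ∫ x, f x ^ 2 := by
    rw [← real_inner_self_eq_norm_sq, L2.inner_def]
    refine integral_congr_ae ?_
    filter_upwards [hf.coeFn_toLp] with x hx
    rw [hx]
    simp [sq]
  rw [← h, Lp.norm_toLp, Real.sqrt_sq ENNReal.toReal_nonneg]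

/-- Cauchy–Schwarz, read off from the sup bound for the average over the interval from `a` to `b`,
centred at its midpoint. -/
theorem abs_intervalIntegral_le {f : ℝ → ℝ} (hf : MemLp f 2 volume) (a b : ℝ) :
    |∫ x in a..b, f x| ≤ √|b - a| * √(∫ x, f x ^ 2) := by
  have h := abs_avg_le hf (b - a) ((a + b) / 2)
  rcases eq_or_ne a b with rfl | hne
  · simp
  have hpos : 0 < |b - a| := abs_pos.2 (sub_ne_zero.2 hne.symm)
  rw [avg, show (a + b) / 2 - (b - a) / 2 = a by ring, show (a + b) / 2 + (b - a) / 2 = b by ring,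
    abs_mul, abs_div, abs_one, toReal_eLpNorm_two hf, one_div, inv_mul_le_iff₀ hpos] at h
  refine h.trans (le_of_eq ?_)
  rw [← mul_assoc, ← div_eq_mul_inv, Real.div_sqrt]

/-- The difference of two averages is an integral of `f (s + η) - f s` over an interval of length
`|y - x|`. When the mass loss is of order `η²`, the Hölder constant does not depend on `η`. -/
theorem abs_avg_sub_avg_le {f : ℝ → ℝ} (mf : Measurable f) (hf : MemLp f 2 volume)
    {η : ℝ} (hη : 0 < η) (x y : ℝ) : |avg η f y - avg η f x| ≤
      √(16 * ((∫ x, f x ^ 2) - ∫ x, avg η f x ^ 2)) / η * √|y - x| := by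
  have hi := intervalIntegrable_of_memLp hf
  have ht : MemLp (fun x => f (x + η)) 2 volume :=
    hf.comp_measurePreserving (measurePreserving_add_right volume η)
  have e : avg η f y - avg η f x =
      1 / η * ∫ s in (x - η / 2)..(y - η / 2), (f (s + η) - f s) := by
    rw [intervalIntegral.integral_sub (intervalIntegrable_of_memLp ht _ _) (hi _ _),
      intervalIntegral.integral_comp_add_right (fun s => f s)]
    simp only [avg]
    rw [← mul_sub, show x - η / 2 + η = x + η / 2 by ring, show y - η / 2 + η = y + η / 2 by ring]
    congr 1
    have h1 := intervalIntegral.integral_add_adjacent_intervals (hi (x - η / 2) (x + η / 2))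
      (hi (x + η / 2) (y + η / 2))
    have h2 := intervalIntegral.integral_add_adjacent_intervals (hi (x - η / 2) (y - η / 2))
      (hi (y - η / 2) (y + η / 2))
    linarith
  rw [e, abs_mul, abs_of_pos (by positivity : 0 < 1 / η)]
  have h := abs_intervalIntegral_le (ht.sub hf) (x - η / 2) (y - η / 2)
  rw [sub_sub_sub_cancel_right] at h
  calc _ ≤ 1 / η * (√|y - x| * √(∫ x, (f (x + η) - f x) ^ 2)) := by gcongr; exact h
    _ ≤ 1 / η * (√|y - x| * √(16 * ((∫ x, f x ^ 2) - ∫ x, avg η f x ^ 2))) := by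
      gcongr
      exact integral_translate_sub_sq_le mf hf hη
    _ = _ := by ring

theorem abs_le_of_holder {u : ℝ → ℝ} (hu : MemLp u 2 volume) (hc : Continuous u) {H : ℝ}
    (hH : 0 ≤ H) (h : ∀ x y, |u y - u x| ≤ H * √|y - x|) (x : ℝ) :
    |u x| ≤ H + √(∫ x, u x ^ 2) := by
  have h1 := abs_intervalIntegral_le hu x (x + 1)
  rw [add_sub_cancel_left, abs_one, Real.sqrt_one, one_mul] at h1
  have h2 : ‖∫ y in x..(x + 1), (u y - u x)‖ ≤ H * |x + 1 - x| := by
    refine intervalIntegral.norm_integral_le_of_norm_le_const fun y hy => ?_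
    rw [uIoc_of_le (by linarith)] at hy
    refine (h x y).trans (mul_le_of_le_one_right hH (Real.sqrt_le_one.2 ?_))
    rw [abs_of_nonneg (by linarith [hy.1])]
    linarith [hy.2]
  rw [intervalIntegral.integral_sub (hc.intervalIntegrable _ _) intervalIntegrable_const,
    intervalIntegral.integral_const, add_sub_cancel_left, abs_one, one_smul, mul_one,
    Real.norm_eq_abs] at h2
  have h3 := abs_sub_abs_le_abs_sub (u x) (∫ y in x..(x + 1), u y)
  rw [abs_sub_comm] at h3
  linarith

/-! ### Compactness of Hölder sequences and regularity of weak solutions. -/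

/-- A uniformly bounded and uniformly `1/2`-Hölder sequence has a pointwise convergent
subsequence. -/
theorem exists_subseq_tendsto_of_holder {u : ℕ → ℝ → ℝ} {B H : ℝ} (hB : ∀ n x, |u n x| ≤ B)
    (hH : ∀ n x y, |u n y - u n x| ≤ H * √|y - x|) :
    ∃ φ : ℕ → ℕ, StrictMono φ ∧ ∃ U : ℝ → ℝ, ∀ x, Tendsto (fun n => u (φ n) x) atTop (𝓝 (U x)) := by
  -- Compactness of a countable product gives convergence at all rationals; equicontinuity extends
  -- it to every real point.
  have hK : IsCompact (Set.pi univ fun _ : ℚ => Icc (-B) B) :=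
    isCompact_univ_pi fun _ => isCompact_Icc
  obtain ⟨v, -, φ, hφ, hv⟩ := hK.tendsto_subseq (x := fun n (q : ℚ) => u n q)
    fun n q _ => abs_le.1 (hB n q)
  rw [tendsto_pi_nhds] at hv
  refine ⟨φ, hφ, ?_⟩
  have hc : ∀ x, ∃ l, Tendsto (fun n => u (φ n) x) atTop (𝓝 l) := by
    intro x
    refine cauchySeq_tendsto_of_complete (Metric.cauchySeq_iff'.2 fun ε hε => ?_)
    obtain ⟨δ, hδ, hs⟩ : ∃ δ > 0, ∀ y, |y - x| < δ → H * √|y - x| < ε / 3 := by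
      have : Tendsto (fun y => H * √|y - x|) (𝓝 x) (𝓝 (H * √|x - x|)) :=
        Continuous.tendsto (by fun_prop) x
      rw [sub_self, abs_zero, Real.sqrt_zero, mul_zero] at this
      obtain ⟨δ, hδ, h⟩ := Metric.eventually_nhds_iff.1
        (this.eventually (gt_mem_nhds (by positivity : (0 : ℝ) < ε / 3)))
      exact ⟨δ, hδ, fun y hy => h hy⟩
    obtain ⟨q, hq1, hq2⟩ := exists_rat_btwn (show x < x + δ by linarith)
    have hq : |(q : ℝ) - x| < δ := by rw [abs_of_pos (by linarith)]; linarith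
    obtain ⟨N, hN⟩ := Metric.cauchySeq_iff'.1 (hv q).cauchySeq (ε / 3) (by positivity)
    refine ⟨N, fun n hn => ?_⟩
    have h1 := hN n hn
    simp only [Function.comp_apply, Real.dist_eq] at h1 ⊢
    have h2 := (hH (φ n) x q).trans_lt (hs q hq)
    have h3 := (hH (φ N) x q).trans_lt (hs q hq)
    rw [abs_lt] at h1 h2 h3 ⊢
    constructor <;> linarith
  choose U hU using hc
  exact ⟨U, hU⟩

theorem eq_affine_of_deriv_deriv_eq_zero {f f1 : ℝ → ℝ} (h1 : ∀ x, HasDerivAt f (f1 x) x)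
    (h2 : ∀ x, HasDerivAt f1 0 x) (x : ℝ) : f x = f 0 + x * (f 1 - f 0) := by
  have hc : ∀ y, f1 y = f1 0 := fun y =>
    is_const_of_deriv_eq_zero (fun x => (h2 x).differentiableAt) (fun x => (h2 x).deriv) y 0
  have hd : ∀ y, HasDerivAt (fun y => f y - y * f1 0) 0 y := fun y =>
    ((h1 y).fun_sub ((hasDerivAt_id y).mul_const (f1 0))).congr_deriv (by rw [hc]; ring)
  have he : ∀ y, f y - y * f1 0 = f 0 - 0 * f1 0 := fun y =>
    is_const_of_deriv_eq_zero (fun x => (hd x).differentiableAt) (fun x => (hd x).deriv) y 0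
  linear_combination he x - x * he 1

/-- A continuous function with vanishing second distributional derivative is affine. -/
theorem eq_affine_of_integral_mul_deriv_deriv {h : ℝ → ℝ} (hc : Continuous h)
    (hz : ∀ χ : ℝ → ℝ, ContDiff ℝ (⊤ : ℕ∞) χ → HasCompactSupport χ →
      ∫ x, h x * deriv (deriv χ) x = 0) (x : ℝ) : h x = h 0 + x * (h 1 - h 0) := by
  let φ : ℕ → ContDiffBump (0 : ℝ) := fun n =>
    { rIn := 1 / ((n : ℝ) + 1) / 2, rOut := 1 / ((n : ℝ) + 1),
      rIn_pos := by positivity,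
      rIn_lt_rOut := half_lt_self (by positivity) }
  let ρ : ℕ → ℝ → ℝ := fun n => (φ n).normed volume
  let L := ContinuousLinearMap.lsmul ℝ ℝ (E := ℝ)
  have hφ : Tendsto (fun n => (φ n).rOut) atTop (𝓝 0) := tendsto_one_div_add_atTop_nhds_zero_nat
  have lim : ∀ y, Tendsto (fun n => (convolution (ρ n) h L volume) y) atTop (𝓝 (h y)) := fun y =>
    ContDiffBump.convolution_tendsto_right_of_continuous hφ hc y
  have hsm : ∀ n, ContDiff ℝ (⊤ : ℕ∞) (ρ n) := fun n => (φ n).contDiff_normed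
  have hcs : ∀ n, HasCompactSupport (ρ n) := fun n => (φ n).hasCompactSupport_normed
  have hloc : LocallyIntegrable h volume := hc.locallyIntegrable
  have hsm1 : ∀ n, ContDiff ℝ (⊤ : ℕ∞) (deriv (ρ n)) := fun n =>
    (contDiff_infty_iff_deriv.1 (hsm n)).2
  have d1 : ∀ n y, HasDerivAt (convolution (ρ n) h L volume)
      (convolution (deriv (ρ n)) h L volume y) y := fun n y =>
    (hcs n).hasDerivAt_convolution_left L ((hsm n).of_le (by exact_mod_cast le_top)) hloc y
  -- The second derivative of the mollification at `y` is the pairing of `h` with the second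
  -- derivative of `t ↦ ρ (y - t)`, which vanishes by assumption. Mollifications are thus affine,
  -- and so is their pointwise limit.
  have d2 : ∀ n y, HasDerivAt (convolution (deriv (ρ n)) h L volume) 0 y := by
    intro n y
    refine ((hcs n).deriv.hasDerivAt_convolution_left L
      ((hsm1 n).of_le (by exact_mod_cast le_top)) hloc y).congr_deriv ?_
    rw [convolution_eq_swap]
    have hr := hz (fun t => ρ n (y - t)) ((hsm n).comp (contDiff_const.sub contDiff_id))
      ((hcs n).comp_homeomorph (Homeomorph.subLeft y))
    have e1 : deriv (fun t => ρ n (y - t)) = fun t => -deriv (ρ n) (y - t) :=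
      funext fun t => deriv_comp_const_sub ..
    have e2 : deriv (deriv fun t => ρ n (y - t)) = fun t => deriv (deriv (ρ n)) (y - t) := by
      rw [e1]
      funext t
      rw [deriv.fun_neg, deriv_comp_const_sub, neg_neg]
    rw [e2] at hr
    rw [← hr]
    refine integral_congr_ae (Eventually.of_forall fun t => ?_)
    simp only [L, ContinuousLinearMap.lsmul_apply, smul_eq_mul, mul_comm]
  have key : ∀ n, convolution (ρ n) h L volume x = convolution (ρ n) h L volume 0 +
      x * (convolution (ρ n) h L volume 1 - convolution (ρ n) h L volume 0) := fun n =>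
    eq_affine_of_deriv_deriv_eq_zero (d1 n) (d2 n) x
  refine tendsto_nhds_unique (lim x) ?_
  simp only [key]
  exact (lim 0).add (((lim 1).sub (lim 0)).const_mul x)

/-- A continuous distributional solution of `U'' = g` with continuous `g` is a classical one. -/
theorem exists_hasDerivAt_of_integral_mul_deriv_deriv {U g : ℝ → ℝ} (hU : Continuous U)
    (hg : Continuous g) (hz : ∀ χ : ℝ → ℝ, ContDiff ℝ (⊤ : ℕ∞) χ → HasCompactSupport χ →
      ∫ x, U x * deriv (deriv χ) x = ∫ x, g x * χ x) :
    ∃ U1 : ℝ → ℝ, (∀ x, HasDerivAt U (U1 x) x) ∧ ∀ x, HasDerivAt U1 (g x) x := by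
  let Z1 : ℝ → ℝ := fun x => ∫ t in (0 : ℝ)..x, g t
  let Z : ℝ → ℝ := fun x => ∫ t in (0 : ℝ)..x, Z1 t
  have h2 : ∀ x, HasDerivAt Z1 (g x) x := fun x => hg.integral_hasStrictDerivAt 0 x |>.hasDerivAt
  have c1 : Continuous Z1 := continuous_iff_continuousAt.2 fun x => (h2 x).continuousAt
  have h1 : ∀ x, HasDerivAt Z (Z1 x) x := fun x => c1.integral_hasStrictDerivAt 0 x |>.hasDerivAt
  have c0 : Continuous Z := continuous_iff_continuousAt.2 fun x => (h1 x).continuousAt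
  -- `Z` is the double primitive of `g`. Two integrations by parts show that `U - Z` has vanishing
  -- second distributional derivative.
  have haff := eq_affine_of_integral_mul_deriv_deriv (h := fun x => U x - Z x) (hU.sub c0) (by
    intro χ hχ hs
    have hχ1 := (contDiff_infty_iff_deriv.1 hχ).2
    have hχ2 := (contDiff_infty_iff_deriv.1 hχ1).2
    have i : ∀ {p q : ℝ → ℝ}, Continuous p → Continuous q → HasCompactSupport q →
        Integrable (fun x => p x * q x) := fun hp hq hs =>
      (hp.mul hq).integrable_of_hasCompactSupport hs.mul_left
    have d1 : ∀ x, HasDerivAt χ (deriv χ x) x := fun x =>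
      (hχ.differentiable (by simp) x).hasDerivAt
    have d2 : ∀ x, HasDerivAt (deriv χ) (deriv (deriv χ) x) x := fun x =>
      (hχ1.differentiable (by simp) x).hasDerivAt
    have p1 := integral_mul_deriv_eq_deriv_mul_of_integrable (fun x _ => h1 x) (fun x _ => d2 x)
      (i c0 hχ2.continuous hs.deriv.deriv) (i c1 hχ1.continuous hs.deriv)
      (i c0 hχ1.continuous hs.deriv)
    have p2 := integral_mul_deriv_eq_deriv_mul_of_integrable (fun x _ => h2 x) (fun x _ => d1 x)
      (i c1 hχ1.continuous hs.deriv) (i hg hχ.continuous hs) (i c1 hχ.continuous hs)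
    simp only [sub_mul]
    rw [integral_sub (i hU hχ2.continuous hs.deriv.deriv) (i c0 hχ2.continuous hs.deriv.deriv),
      hz χ hχ hs, p1, p2]
    ring)
  set p := U 0 - Z 0
  set q := U 1 - Z 1 - p
  have eU : U = fun x => Z x + p + x * q := by
    funext x
    have := haff x
    linarith
  refine ⟨fun x => Z1 x + q, fun x => ?_, fun x => (h2 x).add_const q⟩
  rw [eU]
  exact (((h1 x).add_const p).fun_add ((hasDerivAt_id x).mul_const q)).congr_deriv (by simp)

/-! ### Nondegeneracy of the solitary wave among even functions. -/

namespace Chain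

variable {M : ℕ} (c : Chain M)

theorem waveDeriv_zero : c.waveDeriv 0 = 0 := by simp [waveDeriv, solitonDeriv]

theorem tendsto_mul_wave (hM : 0 < M) : Tendsto (fun x => x * c.wave x) atTop (𝓝 0) := by
  have hk := c.rate_pos hM
  have hA := c.ampl_pos hM
  have h : Tendsto (fun x : ℝ => c.ampl / c.rate ^ 2 * x⁻¹) atTop (𝓝 0) := by
    simpa using tendsto_inv_atTop_zero.const_mul (c.ampl / c.rate ^ 2)
  refine squeeze_zero' ((eventually_ge_atTop 0).mono fun x hx => ?_)
    ((eventually_gt_atTop 0).mono fun x hx => ?_) h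
  · exact mul_nonneg hx (c.wave_pos hM x).le
  · have := soliton_le_inv_one_add_sq (k := c.rate) hA x
    calc x * c.wave x ≤ x * (c.ampl * (1 + (c.rate * x) ^ 2)⁻¹) := by gcongr; exact this
      _ ≤ x * (c.ampl * ((c.rate * x) ^ 2)⁻¹) := by gcongr; linarith
      _ = _ := by field_simp

/-- Nondegeneracy: the linearization of the limiting equation at the solitary wave has no
nontrivial bounded even solutions. -/
theorem eq_zero_of_linearized (hM : 0 < M) {U : ℝ → ℝ} (hU : Continuous U)
    (he : ∀ x, U (-x) = U x) {B : ℝ} (hB : ∀ x, |U x| ≤ B)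
    (hz : ∀ ψ : ℝ → ℝ, ContDiff ℝ (⊤ : ℕ∞) ψ → HasCompactSupport ψ → (∀ x, ψ (-x) = ψ x) →
      ∫ x, U x * (ψ x - c.kdvA * deriv (deriv ψ) x - 2 * c.kdvB * (c.wave x * ψ x)) = 0)
    (x : ℝ) : U x = 0 := by
  have ha := c.kdvA_pos hM
  have hb := c.kdvB_pos hM
  have hB0 : 0 ≤ B := (abs_nonneg _).trans (hB 0)
  have cw := c.continuous_wave
  -- Even test functions suffice: `U` and the wave are even, so the integral for `χ x + χ (-x)` is
  -- twice the integral for `χ`.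
  have hz' : ∀ χ : ℝ → ℝ, ContDiff ℝ (⊤ : ℕ∞) χ → HasCompactSupport χ →
      ∫ x, U x * (χ x - c.kdvA * deriv (deriv χ) x - 2 * c.kdvB * (c.wave x * χ x)) = 0 := by
    intro χ hχ hs
    have hχ1 := (contDiff_infty_iff_deriv.1 hχ).2
    have hχ2 := (contDiff_infty_iff_deriv.1 hχ1).2
    have hsn : HasCompactSupport fun x => χ (-x) := hs.comp_homeomorph (Homeomorph.neg ℝ)
    have h := hz (fun x => χ x + χ (-x)) (hχ.add (hχ.comp contDiff_neg)) (hs.add hsn)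
      (fun x => by rw [neg_neg, add_comm])
    have d1 : ∀ x, HasDerivAt χ (deriv χ x) x := fun x =>
      (hχ.differentiable (by simp) x).hasDerivAt
    have d2 : ∀ x, HasDerivAt (deriv χ) (deriv (deriv χ) x) x := fun x =>
      (hχ1.differentiable (by simp) x).hasDerivAt
    have neg_d : ∀ {p p' : ℝ → ℝ}, (∀ x, HasDerivAt p (p' x) x) → ∀ x,
        HasDerivAt (fun x => p (-x)) (-p' (-x)) x := fun hp x => by
      have := (hp (-x)).scomp x (hasDerivAt_neg x)
      simpa [Function.comp_def] using this
    have e1 : deriv (fun x => χ x + χ (-x)) = fun x => deriv χ x + -deriv χ (-x) :=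
      funext fun x => ((d1 x).fun_add (neg_d d1 x)).deriv
    have e2 : deriv (deriv fun x => χ x + χ (-x)) =
        fun x => deriv (deriv χ) x + deriv (deriv χ) (-x) := by
      rw [e1]
      exact funext fun x => (((d2 x).fun_add (neg_d d2 x).fun_neg).congr_deriv (by ring)).deriv
    rw [e2] at h
    set G : ℝ → ℝ := fun x =>
      U x * (χ x - c.kdvA * deriv (deriv χ) x - 2 * c.kdvB * (c.wave x * χ x)) with hG
    have iG : Integrable G := by
      refine Continuous.integrable_of_hasCompactSupport ?_ (HasCompactSupport.mul_left ?_)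
      · have := hχ.continuous
        have := hχ2.continuous
        fun_prop
      · exact (hs.sub (hs.deriv.deriv.mul_left)).sub (HasCompactSupport.mul_left hs.mul_left)
    have e3 : ∀ x, U x * (χ x + χ (-x) - c.kdvA * (deriv (deriv χ) x + deriv (deriv χ) (-x)) -
        2 * c.kdvB * (c.wave x * (χ x + χ (-x)))) = G x + G (-x) := by
      intro x
      simp only [hG, he, c.wave_neg]
      ring
    simp only [e3] at h
    rw [integral_add iG iG.comp_neg, integral_neg_eq_self] at h
    linarith
  set g : ℝ → ℝ := fun x => (U x - 2 * c.kdvB * c.wave x * U x) / c.kdvA with hg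
  have cg : Continuous g := by fun_prop
  obtain ⟨U1, h1, h2⟩ := exists_hasDerivAt_of_integral_mul_deriv_deriv hU cg (by
    intro χ hχ hs
    have hχ2 := (contDiff_infty_iff_deriv.1 (contDiff_infty_iff_deriv.1 hχ).2).2
    have h := hz' χ hχ hs
    have i1 : Integrable (fun x => U x * deriv (deriv χ) x) :=
      (hU.mul hχ2.continuous).integrable_of_hasCompactSupport hs.deriv.deriv.mul_left
    have i2 : Integrable (fun x => g x * χ x) :=
      (cg.mul hχ.continuous).integrable_of_hasCompactSupport hs.mul_left
    have e : ∀ x, U x * (χ x - c.kdvA * deriv (deriv χ) x - 2 * c.kdvB * (c.wave x * χ x)) =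
        c.kdvA * (g x * χ x - U x * deriv (deriv χ) x) := by
      intro x
      simp only [hg]
      field_simp
      ring
    simp only [e] at h
    rw [integral_const_mul, integral_sub i2 i1] at h
    have := (mul_eq_zero.1 h).resolve_left ha.ne'
    linarith)
  have U10 : U1 0 = 0 := hasDerivAt_zero_of_even he (h1 0)
  have eg : g = fun x => (1 - 2 * c.kdvB * c.wave x) / c.kdvA * U x := by
    funext x; simp only [hg]; ring
  set K := (1 + 2 * c.kdvB * c.ampl) / c.kdvA * B with hK
  have hA := c.ampl_pos hM
  have bg : ∀ x, |g x| ≤ K := by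
    intro x
    have hwx := c.wave_pos hM x
    have hwx' := c.wave_le hM x
    rw [eg, abs_mul, abs_div, abs_of_pos ha, hK]
    gcongr
    · rw [abs_le]
      have : c.kdvB * c.wave x ≤ c.kdvB * c.ampl := by gcongr
      have : 0 ≤ c.kdvB * c.wave x := by positivity
      constructor <;> linarith
    · exact hB x
  -- Linear growth of `U'` suffices, since `x` times the wave still tends to zero.
  have bU1 : ∀ x, 0 ≤ x → |U1 x| ≤ K * x := by
    intro x hx
    have := Convex.norm_image_sub_le_of_norm_hasDerivWithin_le (f := U1) (f' := g) (s := univ)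
      (C := K) (x := 0) (y := x) (fun t _ => (h2 t).hasDerivWithinAt) (fun t _ => bg t)
      convex_univ (mem_univ _) (mem_univ _)
    rwa [U10, sub_zero, sub_zero, Real.norm_eq_abs, Real.norm_eq_abs, abs_of_nonneg hx] at this
  obtain ⟨K₁, hK₁, hk₁⟩ := (c.nice_waveDeriv hM 1).dom
  obtain ⟨K₂, hK₂, hk₂⟩ := (c.nice_waveDeriv hM 1).deriv.dom
  -- The derivative of the wave solves the same linear equation as `U`, so their Wronskian is
  -- constant; by decay it is zero. At the origin only `w''(0) U(0)` remains of it.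
  have hω : ∀ x, HasDerivAt (fun x => c.waveDeriv x * U1 x - deriv c.waveDeriv x * U x) 0 x := by
    intro x
    have d0 := c.hasDerivAt_wave x
    have d1 := (c.nice_waveDeriv hM 1).hasDerivAt x
    have d2 : HasDerivAt (deriv c.waveDeriv)
        (1 / c.kdvA * (c.waveDeriv x + -c.kdvB * (c.waveDeriv x * c.wave x +
          c.wave x * c.waveDeriv x))) x := by
      rw [c.deriv_waveDeriv hM]
      exact (d0.fun_add ((d0.fun_mul d0).const_mul (-c.kdvB))).const_mul (1 / c.kdvA)
    refine ((d1.fun_mul (h2 x)).fun_sub (d2.fun_mul (h1 x))).congr_deriv ?_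
    simp only [hg]
    ring
  have hlim : Tendsto (fun x => c.waveDeriv x * U1 x - deriv c.waveDeriv x * U x) atTop (𝓝 0) := by
    have l1 := c.tendsto_mul_wave hM
    have l2 : Tendsto c.wave atTop (𝓝 0) := by
      refine squeeze_zero' (Eventually.of_forall fun x => (c.wave_pos hM x).le)
        ((eventually_ge_atTop 1).mono fun x hx => ?_) l1
      exact le_mul_of_one_le_left (c.wave_pos hM x).le hx
    have l3 := (l1.const_mul (K₁ * K)).add (l2.const_mul (K₂ * B))
    rw [mul_zero, mul_zero, add_zero] at l3
    refine squeeze_zero_norm' ((eventually_ge_atTop 0).mono fun x hx => ?_) l3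
    have hwx := c.wave_pos hM x
    rw [Real.norm_eq_abs]
    calc _ ≤ |c.waveDeriv x| * |U1 x| + |deriv c.waveDeriv x| * |U x| := by
          rw [← abs_mul, ← abs_mul]; exact abs_sub _ _
      _ ≤ (K₁ * c.wave x) * (K * x) + (K₂ * c.wave x) * B := by
          gcongr
          exacts [hk₁ x, bU1 x hx, hk₂ x, hB x]
      _ = _ := by ring
  have hω0 : c.waveDeriv 0 * U1 0 - deriv c.waveDeriv 0 * U 0 = 0 := by
    refine tendsto_nhds_unique (tendsto_const_nhds.congr fun x => ?_) hlim
    exact is_const_of_deriv_eq_zero (fun x => (hω x).differentiableAt) (fun x => (hω x).deriv) 0 x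
  -- At the crest `b w(0) = 3/2`, so `w''(0)` is a nonzero multiple of `1 - 3/2`.
  have hne : deriv c.waveDeriv 0 ≠ 0 := by
    have h0 : c.wave 0 = c.ampl := by simp [wave, soliton]
    have := c.two_mul_kdvB_mul_ampl hM
    rw [(c.hasDerivAt_waveDeriv hM 0).deriv, h0]
    refine div_ne_zero ?_ ha.ne'
    nlinarith
  have U0 : U 0 = 0 := by
    rw [c.waveDeriv_zero, zero_mul, zero_sub, neg_eq_zero] at hω0
    exact (mul_eq_zero.1 hω0).resolve_left hne
  refine even_eq_zero_of_linear_ode h1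
    (q := fun x => (1 - 2 * c.kdvB * c.wave x) / c.kdvA) (fun x => ?_) (by fun_prop) he U0 x
  have := h2 x
  rwa [eg] at this

end Chain

/-! ### The uniform lower bound for the linearized operators. -/

namespace Chain

variable {M : ℕ} {c : Chain M}

theorem norm_opM_le (W₀ : L2even) (ε : ℝ) (V : L2even) : ‖c.opM W₀ ε V‖ ≤
    2 * ∑ i, c.β i * range i ^ 3 * ‖mulA (range i * ε) W₀ V‖ := by
  rw [opM_apply, norm_smul, Real.norm_two]
  gcongr
  exact norm_sum_smul_le _ _ _ (fun i => coeff_nonneg i) fun i => norm_opA_le _ _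

theorem norm_opM_le_of_isKdVWave (hM : 0 < M) {W₀ : L2even} (hW : c.IsKdVWave W₀) {ε : ℝ}
    (hε : 0 < ε) (V : L2even) : ‖c.opM W₀ ε V‖ ≤ 2 * c.kdvB * c.ampl * ‖V‖ := by
  refine (norm_opM_le W₀ ε V).trans ?_
  rw [kdvB, Finset.mul_sum, Finset.mul_sum, Finset.sum_mul, Finset.sum_mul]
  refine Finset.sum_le_sum fun i _ => ?_
  have h1 := coeff_nonneg (c := c) i
  have h2 := norm_mulA_le_of_le (c.ampl_pos hM).le
    (abs_avg_isKdVWave_le hM hW (mul_pos (range_pos i) hε)) V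
  calc 2 * (c.β i * range i ^ 3 * ‖mulA (range i * ε) W₀ V‖)
      ≤ 2 * (c.β i * range i ^ 3 * (c.ampl * ‖V‖)) := by gcongr
    _ = _ := by ring

/-- The energy estimate: the loss of mass under averaging is controlled by `L_ε`. -/
theorem mass_loss_le (hM : 0 < M) {W₀ : L2even} (hW : c.IsKdVWave W₀) (i : Fin M) {ε : ℝ}
    (hε : 0 < ε) {V : L2even} (hV : ‖V‖ = 1) (hL : ‖c.opL W₀ ε V‖ ≤ 1) :
    ‖V‖ ^ 2 - ‖opA (range i * ε) V‖ ^ 2 ≤ 4 / (c.α i * range i ^ 2) * ε ^ 2 := by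
  have h1 := inner_opB_self (c := c) hε V
  have h2 := Finset.single_le_sum (fun i _ => energy_term_nonneg (c := c) ε V i)
    (Finset.mem_univ i)
  have h3 : c.opB ε V = c.opL W₀ ε V + c.opM W₀ ε V := by rw [opL_apply, sub_add_cancel]
  -- `4 = 1 + 3`: the bound on `L_ε V`, plus the norm bound `2 b A = 3` for `M_ε`, with `A` the
  -- amplitude.
  have h4 : inner ℝ (c.opB ε V) V ≤ 4 := by
    refine (real_inner_le_norm _ _).trans ?_
    rw [hV, mul_one, h3]
    refine (norm_add_le _ _).trans ?_
    have := norm_opM_le_of_isKdVWave hM hW hε V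
    rw [c.two_mul_kdvB_mul_ampl hM, hV] at this
    linarith
  have h5 : c.α i * range i ^ 2 / ε ^ 2 * (‖V‖ ^ 2 - ‖opA (range i * ε) V‖ ^ 2) ≤ 4 := by
    have := sq_nonneg ‖V‖
    linarith
  have := c.α_pos i
  have := range_pos i
  rw [div_mul_eq_mul_div, le_div_iff₀ (by positivity)]
  rw [div_mul_eq_mul_div, div_le_iff₀ (by positivity)] at h5
  linarith

/-- Uniform Hölder and sup bounds for the averages of normalized functions with bounded energy. -/
theorem exists_holder_bound (hM : 0 < M) {W₀ : L2even} (hW : c.IsKdVWave W₀) (i : Fin M) :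
    ∃ H, 0 ≤ H ∧ ∀ ε, 0 < ε → ∀ V : L2even, ‖V‖ = 1 → ‖c.opL W₀ ε V‖ ≤ 1 →
      (∀ x y, |avg (range i * ε) (V : L2) y - avg (range i * ε) (V : L2) x| ≤ H * √|y - x|) ∧
      ∀ x, |avg (range i * ε) (V : L2) x| ≤ H + 1 := by
  have ha := c.α_pos i
  have hm := range_pos i
  refine ⟨√(64 / (c.α i * range i ^ 4)), by positivity, fun ε hε V hV hL => ?_⟩
  have hη : 0 < range i * ε := by positivity
  have h1 := mass_loss_le hM hW i hε hV hL
  have e1 : ∫ x, avg (range i * ε) (V : L2) x ^ 2 = ‖opA (range i * ε) V‖ ^ 2 := by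
    rw [← real_inner_self_eq_norm_sq, inner_eq_integral_of_ae (coe_opA _ V) (coe_opA _ V)]
    simp only [sq]
  -- `64 = 16 · 4`: the translation estimate times the energy bound. The factor `ε²` of the mass
  -- loss cancels against `(mε)²`.
  have h2 : √(16 * ((∫ x, (V : L2) x ^ 2) - ∫ x, avg (range i * ε) (V : L2) x ^ 2)) /
      (range i * ε) ≤ √(64 / (c.α i * range i ^ 4)) := by
    rw [← norm_sq_eq_integral, e1, div_le_iff₀ hη]
    refine Real.sqrt_le_iff.2 ⟨by positivity, ?_⟩
    rw [mul_pow, Real.sq_sqrt (by positivity)]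
    calc _ ≤ 16 * (4 / (c.α i * range i ^ 2) * ε ^ 2) := by gcongr
      _ = _ := by field_simp; norm_num
  have h3 : ∀ x y, |avg (range i * ε) (V : L2) y - avg (range i * ε) (V : L2) x| ≤
      √(64 / (c.α i * range i ^ 4)) * √|y - x| := fun x y =>
    (abs_avg_sub_avg_le (Lp.stronglyMeasurable _).measurable (Lp.memLp _) hη x y).trans
      (by gcongr)
  refine ⟨h3, fun x => ?_⟩
  refine (abs_le_of_holder (memLp_avg (Lp.memLp _) _) (continuous_avg (Lp.memLp _) _)
    (by positivity) h3 x).trans ?_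
  gcongr
  rw [e1, Real.sqrt_sq (norm_nonneg _), ← hV]
  exact norm_opA_le _ _

/-- Averages of approximate null functions of `L_ε` are approximately orthogonal to the range of
the limiting linearized operator. -/
theorem abs_integral_avg_mul_le (hM : 0 < M) {W₀ : L2even} (hW : c.IsKdVWave W₀) {ψ : ℝ → ℝ}
    (hψ : ContDiff ℝ (⊤ : ℕ∞) ψ) (hs : HasCompactSupport ψ) (he : ∀ x, ψ (-x) = ψ x) :
    ∃ C, 0 ≤ C ∧ ∀ ε, 0 < ε → ε ≤ 1 → ∀ (i : Fin M) (V : L2even),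
      |∫ x, avg (range i * ε) (V : L2) x *
        (ψ x - c.kdvA * deriv (deriv ψ) x - 2 * c.kdvB * (c.wave x * ψ x))| ≤
        C * (ε ^ 2 * ‖V‖ + ‖c.opL W₀ ε V‖) := by
  have hw := c.isWeight_wave hM
  have hae := IsKdVWave.ae_eq hM hW
  have n4 := nice_of_hasCompactSupport hw hψ hs 4
  have n2 := nice_of_hasCompactSupport hw hψ hs 2
  have nw := c.nice_wave hM 2
  have nwψ := nw.mul hw n2
  have nG : Nice c.wave 2 fun x =>
      ψ x - c.kdvA * deriv (deriv ψ) x - 2 * c.kdvB * (c.wave x * ψ x) := by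
    have := (n2.add (n4.deriv.deriv.const_mul (-c.kdvA))).add (nwψ.const_mul (-(2 * c.kdvB)))
    convert this using 2
    ring
  have e2 := even_deriv_deriv he
  set Ψ := toL2even ψ (n2.memLp hw) he
  have hΨ : (Ψ : L2) =ᵐ[volume] ψ := coe_toL2even _ _
  set Ψ2 := toL2even (deriv (deriv ψ)) (n4.deriv.deriv.memLp hw) e2
  have hΨ2 : (Ψ2 : L2) =ᵐ[volume] deriv (deriv ψ) := coe_toL2even _ _
  set H := toL2even _ (nwψ.memLp hw) (fun x => by rw [c.wave_neg, he])
  have hH : (H : L2) =ᵐ[volume] fun x => c.wave x * ψ x := coe_toL2even _ _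
  set G : L2even := Ψ - c.kdvA • Ψ2 - (2 : ℝ) • c.kdvB • H with hGdef
  have hG : (G : L2) =ᵐ[volume] fun x =>
      ψ x - c.kdvA * deriv (deriv ψ) x - 2 * c.kdvB * (c.wave x * ψ x) := by
    filter_upwards [coe_sub (Ψ - c.kdvA • Ψ2) ((2 : ℝ) • c.kdvB • H), coe_sub Ψ (c.kdvA • Ψ2),
      coe_smul c.kdvA Ψ2, coe_smul 2 (c.kdvB • H), coe_smul c.kdvB H, hΨ, hΨ2, hH]
      with x h1 h2 h3 h4 h5 h6 h7 h8
    rw [h1, h2, h3, h4, h5, h6, h7, h8, mul_assoc]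
  clear_value G
  obtain ⟨C₁, hC₁, h₁⟩ := norm_opB_sub_le (c := c) hw n4 hΨ hΨ2
  obtain ⟨C₂, hC₂, h₂⟩ := norm_sum_opA_mulA_sub_le (c := c) hw nw n2 hae hΨ hH
  obtain ⟨C₃, hC₃, h₃⟩ := nG.norm_opA_sub_le hw hG M
  refine ⟨C₃ * M ^ 2 + C₁ + 2 * C₂ + ‖Ψ‖, by positivity, fun ε hε h1 i V => ?_⟩
  have hη := mul_pos (range_pos i) hε
  have hL : ‖c.opL W₀ ε Ψ - G‖ ≤ (C₁ + 2 * C₂) * ε ^ 2 := by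
    have : c.opL W₀ ε Ψ - G = (c.opB ε Ψ - (Ψ - c.kdvA • Ψ2)) -
        (2 : ℝ) • ((∑ i, (c.β i * range i ^ 3) •
          opA (range i * ε) (mulA (range i * ε) W₀ Ψ)) - c.kdvB • H) := by
      rw [opL_apply, opM_apply, hGdef, smul_sub]
      abel
    rw [this]
    refine (norm_sub_le _ _).trans ?_
    rw [norm_smul, Real.norm_two]
    linarith [h₁ ε hε h1, h₂ ε hε h1]
  have hA : ‖opA (range i * ε) G - G‖ ≤ C₃ * M ^ 2 * ε ^ 2 := by
    refine (h₃ _ hη (range_mul_le i hε h1)).trans ?_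
    rw [mul_assoc, ← mul_pow]
    have := range_le i
    gcongr
  rw [← inner_eq_integral_of_ae (coe_opA _ V) hG, inner_opA_left hη]
  -- `G` is the limiting operator applied to `ψ`. It is replaced first for its average and then by
  -- `L_ε ψ`, and symmetry moves `L_ε` onto `V`.
  have e : inner ℝ V (opA (range i * ε) G) = inner ℝ V (opA (range i * ε) G - G) -
      inner ℝ V (c.opL W₀ ε Ψ - G) + inner ℝ (c.opL W₀ ε V) Ψ := by
    rw [inner_opL W₀ hε, inner_sub_right, inner_sub_right]
    ring
  rw [e]
  have b1 := abs_real_inner_le_norm V (opA (range i * ε) G - G)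
  have b2 := abs_real_inner_le_norm V (c.opL W₀ ε Ψ - G)
  have b3 := abs_real_inner_le_norm (c.opL W₀ ε V) Ψ
  have b4 := mul_le_mul_of_nonneg_left hA (norm_nonneg V)
  have b5 := mul_le_mul_of_nonneg_left hL (norm_nonneg V)
  calc _ ≤ |inner ℝ V (opA (range i * ε) G - G)| + |inner ℝ V (c.opL W₀ ε Ψ - G)| +
        |inner ℝ (c.opL W₀ ε V) Ψ| :=
        (abs_add_le _ _).trans (add_le_add_left (abs_sub _ _) _)
    _ ≤ ‖V‖ * (C₃ * M ^ 2 * ε ^ 2) + ‖V‖ * ((C₁ + 2 * C₂) * ε ^ 2) + ‖c.opL W₀ ε V‖ * ‖Ψ‖ := by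
        linarith
    _ ≤ _ := by
        have p1 : 0 ≤ C₃ * M ^ 2 + C₁ + 2 * C₂ := by positivity
        have p2 := mul_nonneg p1 (norm_nonneg (c.opL W₀ ε V))
        have p3 : 0 ≤ ‖Ψ‖ * (ε ^ 2 * ‖V‖) := by positivity
        nlinarith

/-- This is the compactness that the wave provides. Every subsequence of the averages of `V n` has a
pointwise convergent further subsequence, whose limit is zero by nondegeneracy. The averaged wave,
bounded by a multiple of the wave itself, turns pointwise convergence of the product into
convergence in `L²`. -/
theorem tendsto_norm_mulA (hM : 0 < M) {W₀ : L2even} (hW : c.IsKdVWave W₀) (i : Fin M)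
    {ε : ℕ → ℝ} {V : ℕ → L2even} (hε : ∀ n, 0 < ε n) (h1 : ∀ n, ε n ≤ 1)
    (hlim : Tendsto ε atTop (𝓝 0)) (hV : ∀ n, ‖V n‖ = 1) (hL : ∀ n, ‖c.opL W₀ (ε n) (V n)‖ ≤ 1)
    (hL0 : Tendsto (fun n => ‖c.opL W₀ (ε n) (V n)‖) atTop (𝓝 0)) :
    Tendsto (fun n => ‖mulA (range i * ε n) W₀ (V n)‖) atTop (𝓝 0) := by
  have hw := c.isWeight_wave hM
  have hae := IsKdVWave.ae_eq hM hW
  obtain ⟨H, hH, hb⟩ := exists_holder_bound hM hW i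
  obtain ⟨C, hC, hCw⟩ := hw.abs_avg_le M
  refine tendsto_of_subseq_tendsto fun ns hns => ?_
  set u : ℕ → ℝ → ℝ := fun n => avg (range i * ε n) (V n : L2) with hu
  have hcont : ∀ n, Continuous (u n) := fun n => continuous_avg (Lp.memLp _) _
  obtain ⟨φ, hφ, U, hU⟩ := exists_subseq_tendsto_of_holder (u := fun n => u (ns n))
    (fun n x => (hb _ (hε _) _ (hV _) (hL _)).2 x) fun n x y =>
      (hb _ (hε _) _ (hV _) (hL _)).1 x y
  have hsub : Tendsto (fun n => ns (φ n)) atTop atTop := hns.comp hφ.tendsto_atTop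
  have hUb : ∀ x, |U x| ≤ H + 1 := fun x => le_of_tendsto (hU x).abs
    (Eventually.of_forall fun n => (hb _ (hε _) _ (hV _) (hL _)).2 x)
  have hUH : ∀ x y, |U y - U x| ≤ H * √|y - x| := fun x y =>
    le_of_tendsto ((hU y).sub (hU x)).abs
      (Eventually.of_forall fun n => (hb _ (hε _) _ (hV _) (hL _)).1 x y)
  have hUc : Continuous U := by
    refine continuous_iff_continuousAt.2 fun x => ?_
    rw [ContinuousAt, tendsto_iff_dist_tendsto_zero]
    have : Tendsto (fun y => H * √|y - x|) (𝓝 x) (𝓝 (H * √|x - x|)) :=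
      Continuous.tendsto (by fun_prop) x
    rw [sub_self, abs_zero, Real.sqrt_zero, mul_zero] at this
    exact squeeze_zero (fun y => dist_nonneg) (fun y => hUH x y) this
  have hUe : ∀ x, U (-x) = U x := fun x => by
    refine tendsto_nhds_unique (hU (-x)) ((hU x).congr fun n => ?_)
    exact (avg_even (V _).2 _ x).symm
  have hU0 : ∀ x, U x = 0 := by
    refine c.eq_zero_of_linearized hM hUc hUe hUb fun ψ hψ hs he => ?_
    set G : ℝ → ℝ := fun x =>
      ψ x - c.kdvA * deriv (deriv ψ) x - 2 * c.kdvB * (c.wave x * ψ x) with hG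
    have cG : Continuous G := by
      have := hψ.continuous
      have := (contDiff_infty_iff_deriv.1 (contDiff_infty_iff_deriv.1 hψ).2).2.continuous
      have := c.continuous_wave
      fun_prop
    have sG : HasCompactSupport G :=
      (hs.sub (hs.deriv.deriv.mul_left)).sub (HasCompactSupport.mul_left hs.mul_left)
    have iG : Integrable G := cG.integrable_of_hasCompactSupport sG
    obtain ⟨K, hK, hk⟩ := abs_integral_avg_mul_le hM hW hψ hs he
    have l1 : Tendsto (fun n => ∫ x, u n x * G x) atTop (𝓝 0) := by
      have l2 : Tendsto (fun n => K * (ε n ^ 2 * 1 + ‖c.opL W₀ (ε n) (V n)‖)) atTop (𝓝 0) := by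
        simpa using (((hlim.pow 2).mul_const 1).add hL0).const_mul K
      refine squeeze_zero_norm (fun n => ?_) l2
      have := hk (ε n) (hε n) (h1 n) i (V n)
      rwa [hV] at this
    have l3 : Tendsto (fun n => ∫ x, u (ns (φ n)) x * G x) atTop (𝓝 (∫ x, U x * G x)) := by
      refine tendsto_integral_of_dominated_convergence (fun x => (H + 1) * ‖G x‖)
        (fun n => ((hcont _).mul cG).aestronglyMeasurable) (iG.norm.const_mul _)
        (fun n => Eventually.of_forall fun x => ?_)
        (Eventually.of_forall fun x => (hU x).mul_const (G x))
      rw [norm_mul]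
      gcongr
      exact (hb _ (hε _) _ (hV _) (hL _)).2 x
    exact tendsto_nhds_unique l3 (l1.comp hsub)
  refine ⟨φ, ?_⟩
  -- Dominated convergence with a multiple of the squared wave as envelope: the averages of `V n`
  -- are only bounded, and all integrability comes from `W₀`.
  have hsq : Tendsto (fun n => ∫ x, (avg (range i * ε (ns (φ n))) c.wave x *
      u (ns (φ n)) x) ^ 2) atTop (𝓝 (∫ _ : ℝ, (0 : ℝ))) := by
    refine tendsto_integral_of_dominated_convergence
      (fun x => (C * (H + 1)) ^ 2 * c.wave x ^ 2)
      (fun n => (((continuous_avg hw.memLp _).mul (hcont _)).pow 2).aestronglyMeasurable)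
      (hw.memLp.integrable_sq.const_mul _) (fun n => Eventually.of_forall fun x => ?_)
      (Eventually.of_forall fun x => ?_)
    · have b1 := hCw c.wave 1 zero_le_one
        (fun x => by rw [abs_of_pos (c.wave_pos hM x), one_mul]) _
        (mul_pos (range_pos i) (hε (ns (φ n)))) (range_mul_le i (hε _) (h1 _)) x
      have b2 := (hb _ (hε (ns (φ n))) _ (hV _) (hL _)).2 x
      have hwx := c.wave_pos hM x
      rw [norm_pow, norm_mul, ← mul_pow]
      refine pow_le_pow_left₀ (by positivity) ?_ 2
      calc _ ≤ (1 * C * c.wave x) * (H + 1) := by gcongr; exacts [b1, b2]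
        _ = _ := by ring
    · have l := hU x
      rw [hU0 x] at l
      refine squeeze_zero_norm (fun n => ?_)
        (by simpa using ((l.norm).const_mul (C * c.wave x)).pow 2)
      have b1 := hCw c.wave 1 zero_le_one
        (fun x => by rw [abs_of_pos (c.wave_pos hM x), one_mul]) _
        (mul_pos (range_pos i) (hε (ns (φ n)))) (range_mul_le i (hε _) (h1 _)) x
      rw [one_mul] at b1
      have hwx := c.wave_pos hM x
      rw [norm_pow, norm_mul]
      refine pow_le_pow_left₀ (by positivity) ?_ 2
      exact mul_le_mul_of_nonneg_right b1 (norm_nonneg _)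
  rw [integral_zero] at hsq
  have := hsq.sqrt
  rw [Real.sqrt_zero] at this
  refine this.congr fun n => ?_
  rw [← Real.sqrt_sq (norm_nonneg (mulA _ _ _)), ← real_inner_self_eq_norm_sq]
  have hm := coe_mulA_of_ae (η := range i * ε (ns (φ n))) hae (ae_eq_refl (V (ns (φ n)) : L2))
  rw [inner_eq_integral_of_ae hm hm]
  simp only [sq, hu]

/-- The linearized operators `L_ε` are uniformly bounded from below. -/
theorem exists_lower_bound (hM : 0 < M) {W₀ : L2even} (hW : c.IsKdVWave W₀) :
    ∃ κ, 0 < κ ∧ ∃ ε₁, 0 < ε₁ ∧ ε₁ ≤ 1 ∧ ∀ ε, 0 < ε → ε ≤ ε₁ → ∀ V : L2even,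
      κ * ‖V‖ ≤ ‖c.opL W₀ ε V‖ := by
  by_contra hcon
  push Not at hcon
  have hn : ∀ n : ℕ, ∃ ε : ℝ, 0 < ε ∧ ε ≤ 1 / ((n : ℝ) + 1) ∧ ∃ V : L2even, ‖V‖ = 1 ∧
      ‖c.opL W₀ ε V‖ ≤ 1 / ((n : ℝ) + 1) := by
    intro n
    obtain ⟨ε, hε, h1, V, hV⟩ := hcon (1 / ((n : ℝ) + 1)) (by positivity) (1 / ((n : ℝ) + 1))
      (by positivity) (by rw [div_le_one (by positivity)]; linarith [n.cast_nonneg (α := ℝ)])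
    have hV0 : 0 < ‖V‖ := by
      rcases (norm_nonneg V).eq_or_lt with h | h
      · rw [← h, mul_zero] at hV
        exact absurd hV (norm_nonneg _).not_gt
      · exact h
    refine ⟨ε, hε, h1, ‖V‖⁻¹ • V, ?_, ?_⟩
    · rw [norm_smul, norm_inv, norm_norm, inv_mul_cancel₀ hV0.ne']
    · rw [map_smul, norm_smul, norm_inv, norm_norm, inv_mul_le_iff₀ hV0]
      linarith
  choose ε hε h1 V hV hL using hn
  have h1' : ∀ n : ℕ, 1 / ((n : ℝ) + 1) ≤ 1 := fun n => by
    rw [div_le_one (by positivity)]; linarith [n.cast_nonneg (α := ℝ)]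
  have l0 : Tendsto (fun n : ℕ => 1 / ((n : ℝ) + 1)) atTop (𝓝 0) :=
    tendsto_one_div_add_atTop_nhds_zero_nat
  have le : Tendsto ε atTop (𝓝 0) := squeeze_zero (fun n => (hε n).le) h1 l0
  have lL : Tendsto (fun n => ‖c.opL W₀ (ε n) (V n)‖) atTop (𝓝 0) :=
    squeeze_zero (fun n => norm_nonneg _) hL l0
  have lm := fun i => tendsto_norm_mulA hM hW i hε (fun n => (h1 n).trans (h1' n)) le hV
    (fun n => (hL n).trans (h1' n)) lL
  have lM : Tendsto (fun n => ‖c.opL W₀ (ε n) (V n)‖ +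
      2 * ∑ i, c.β i * range i ^ 3 * ‖mulA (range i * ε n) W₀ (V n)‖) atTop (𝓝 0) := by
    have := lL.add ((tendsto_finsetSum Finset.univ fun i _ =>
      (lm i).const_mul (c.β i * range i ^ 3)).const_mul 2)
    simpa using this
  -- `B_ε = L_ε + M_ε` does not decrease norms, so `L_ε V_n` and `M_ε V_n` cannot both tend to zero.
  have hge : ∀ n, (1 : ℝ) ≤ ‖c.opL W₀ (ε n) (V n)‖ +
      2 * ∑ i, c.β i * range i ^ 3 * ‖mulA (range i * ε n) W₀ (V n)‖ := by
    intro n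
    have h2 : c.opB (ε n) (V n) = c.opL W₀ (ε n) (V n) + c.opM W₀ (ε n) (V n) := by
      rw [opL_apply, sub_add_cancel]
    calc (1 : ℝ) = ‖V n‖ := (hV n).symm
      _ ≤ ‖c.opB (ε n) (V n)‖ := norm_le_norm_opB (hε n) _
      _ ≤ ‖c.opL W₀ (ε n) (V n)‖ + ‖c.opM W₀ (ε n) (V n)‖ := by rw [h2]; exact norm_add_le _ _
      _ ≤ _ := by gcongr; exact norm_opM_le _ _ _
  linarith [ge_of_tendsto' lM hge]

end Chain

/-! ### Invertibility of `L_ε` and the contraction estimate. -/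

/-- The even functions are the fixed points of the isometry induced by reflection. Completeness is
needed both for inverting `L_ε` and for Banach's fixed point theorem. -/
theorem isClosed_L2even : IsClosed (L2even : Set L2) := by
  let T := Lp.compMeasurePreservingₗᵢ ℝ (E := ℝ) (p := 2) (fun x : ℝ => -x)
    (Measure.measurePreserving_neg (volume : Measure ℝ))
  have h : (L2even : Set L2) = {V | T V = V} := by
    ext V
    have hT : (T V : L2) =ᵐ[volume] fun x => V (-x) :=
      Lp.coeFn_compMeasurePreserving V (Measure.measurePreserving_neg volume)
    change (∀ᵐ x : ℝ, V (-x) = V x) ↔ T V = V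
    constructor
    · intro hV
      apply Lp.ext
      filter_upwards [hT, hV] with x h1 h2
      rw [h1, h2]
    · intro hV
      rw [hV] at hT
      filter_upwards [hT] with x h1
      rw [← h1]
  rw [h]
  exact isClosed_eq T.continuous continuous_id

instance : CompleteSpace L2even := isClosed_L2even.completeSpace_coe

/-- A symmetric bounded operator which is bounded from below is invertible. -/
theorem isInvertible_of_symmetric {E : Type*} [NormedAddCommGroup E] [InnerProductSpace ℝ E]
    [CompleteSpace E] (T : E →L[ℝ] E) (hT : ∀ x y, inner ℝ (T x) y = inner ℝ x (T y)) {κ : ℝ}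
    (hκ : 0 < κ) (h : ∀ x, κ * ‖x‖ ≤ ‖T x‖) : T.IsInvertible := by
  have hanti : AntilipschitzWith (Real.toNNReal κ⁻¹) T := by
    refine T.antilipschitz_of_bound fun x => ?_
    rw [Real.coe_toNNReal _ (by positivity), ← div_eq_inv_mul, le_div_iff₀ hκ]
    linarith [h x]
  have hclosed : IsClosed (T.range : Set E) := by
    rw [LinearMap.coe_range]
    exact hanti.isClosed_range T.uniformContinuous
  -- The range is closed. A vector `y` orthogonal to it satisfies `‖T y‖² = ⟨T (T y), y⟩ = 0`, so `y
  -- = 0` by the lower bound.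
  have htop : T.range = ⊤ := by
    have : CompleteSpace T.range := hclosed.completeSpace_coe
    rw [← Submodule.orthogonal_eq_bot_iff, Submodule.eq_bot_iff]
    intro y hy
    rw [Submodule.mem_orthogonal] at hy
    have h0 : T y = 0 := by
      rw [← inner_self_eq_zero (𝕜 := ℝ), ← hT]
      exact hy _ ⟨T y, rfl⟩
    have := h y
    rw [h0, norm_zero] at this
    have : ‖y‖ ≤ 0 := by by_contra hc; push Not at hc; linarith [mul_pos hκ hc]
    exact norm_le_zero_iff.1 this
  have hker : T.ker = ⊥ := LinearMap.ker_eq_bot.2 hanti.injective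
  exact ⟨ContinuousLinearEquiv.ofBijective T hker htop,
    ContinuousLinearEquiv.coe_ofBijective T hker htop⟩

namespace Chain

variable {M : ℕ} {c : Chain M}

theorem opL_opF {W₀ : L2even} {ε : ℝ} (h : (c.opL W₀ ε).IsInvertible) (V : L2even) :
    c.opL W₀ ε (c.opF W₀ ε V) =
      c.resR W₀ ε + c.resS W₀ ε + ε ^ 2 • c.opQ ε V + ε ^ 2 • c.opN W₀ ε V := by
  obtain ⟨e, he⟩ := h
  rw [opF, ← he, ContinuousLinearMap.inverse_equiv]
  simp

/-- Quantitative form of the fixed point problem: for small `ε` the operator `L_ε` is invertible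
and `F_ε` is a `1/2`-contraction of a ball into itself. -/
theorem exists_contraction (hM : 0 < M) {W₀ : L2even} (hW : c.IsKdVWave W₀) :
    ∃ D, 0 < D ∧ ∃ ε₀, 0 < ε₀ ∧ ε₀ ≤ 1 ∧ ∀ ε, 0 < ε → ε ≤ ε₀ →
      (c.opL W₀ ε).IsInvertible ∧ (∀ V, ‖V‖ ≤ D → ‖c.opF W₀ ε V‖ ≤ D) ∧
      ∀ V₁ V₂, ‖V₁‖ ≤ D → ‖V₂‖ ≤ D →
        ‖c.opF W₀ ε V₁ - c.opF W₀ ε V₂‖ ≤ 1 / 2 * ‖V₁ - V₂‖ := by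
  obtain ⟨κ, hκ, ε₁, hε₁, hε₁', hlow⟩ := exists_lower_bound hM hW
  obtain ⟨C₁, hC₁, hR⟩ := norm_resR_le hM hW
  obtain ⟨C₂, hC₂, hS⟩ := norm_resS_le hM hW
  -- `‖F_ε[0]‖ ≤ (C₁ + C₂)/κ`, so a `1/2`-contraction maps this ball into itself; the `+ 1` makes
  -- `D` positive. The radius is fixed before `C₃`, which depends on it.
  set D := 2 * (C₁ + C₂) / κ + 1 with hD
  have hD0 : 0 < D := by positivity
  obtain ⟨C₃, hC₃, hN⟩ := norm_opN_sub_le hM hW hD0.le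
  have hA := c.ampl_pos hM
  have hb := c.kdvB_pos hM
  have hM' : (0 : ℝ) < M := by exact_mod_cast hM
  -- The three thresholds serve the lower bound for `L_ε`, the restriction of the arguments of `Ψ'`
  -- to `[-1, 1]`, and the Lipschitz constant `ε (2 b D + C₃)/κ ≤ 1/2`.
  refine ⟨D, hD0, min ε₁ (min (1 / (M * (c.ampl + D))) (κ / (2 * (2 * c.kdvB * D + C₃)))),
    by positivity, (min_le_left _ _).trans hε₁', fun ε hε hle => ?_⟩
  have h1 : ε ≤ ε₁ := hle.trans (min_le_left _ _)
  have h2 : ε ≤ 1 / (M * (c.ampl + D)) := hle.trans ((min_le_right _ _).trans (min_le_left _ _))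
  have h3 : ε ≤ κ / (2 * (2 * c.kdvB * D + C₃)) :=
    hle.trans ((min_le_right _ _).trans (min_le_right _ _))
  have h4 : ε ≤ 1 := h1.trans hε₁'
  have hsq : ε ^ 2 ≤ ε := by rw [sq]; exact mul_le_of_le_one_left hε.le h4
  rw [le_div_iff₀ (by positivity)] at h2 h3
  have h5 : M * ε ^ 2 * (c.ampl + D) ≤ 1 := by
    refine le_trans ?_ h2
    calc M * ε ^ 2 * (c.ampl + D) ≤ M * ε * (c.ampl + D) := by gcongr
      _ = _ := by ring
  have h6 : M * ε ^ 2 * c.ampl ≤ 1 := le_trans (by gcongr; linarith) h5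
  have hinv : (c.opL W₀ ε).IsInvertible :=
    isInvertible_of_symmetric _ (inner_opL W₀ hε) hκ (hlow ε hε h1)
  have hcontr : ∀ V₁ V₂, ‖V₁‖ ≤ D → ‖V₂‖ ≤ D →
      ‖c.opF W₀ ε V₁ - c.opF W₀ ε V₂‖ ≤ 1 / 2 * ‖V₁ - V₂‖ := by
    intro V₁ V₂ hV₁ hV₂
    have e : c.opL W₀ ε (c.opF W₀ ε V₁ - c.opF W₀ ε V₂) =
        (ε ^ 2 • c.opQ ε V₁ - ε ^ 2 • c.opQ ε V₂) +
          ε ^ 2 • (c.opN W₀ ε V₁ - c.opN W₀ ε V₂) := by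
      rw [map_sub, opL_opF hinv, opL_opF hinv, smul_sub]
      abel
    have b := hlow ε hε h1 (c.opF W₀ ε V₁ - c.opF W₀ ε V₂)
    rw [e] at b
    have b1 := norm_opQ_sub_le (c := c) hε h4 V₁ V₂
    have b2 := hN ε hε h4 h5 V₁ V₂ hV₁ hV₂
    have b3 : ‖ε ^ 2 • (c.opN W₀ ε V₁ - c.opN W₀ ε V₂)‖ ≤ ε * (C₃ * ‖V₁ - V₂‖) := by
      rw [norm_smul, Real.norm_of_nonneg (by positivity)]
      gcongr
    have b4 : c.kdvB * ε * (‖V₁‖ + ‖V₂‖) * ‖V₁ - V₂‖ ≤ c.kdvB * ε * (D + D) * ‖V₁ - V₂‖ := by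
      gcongr
    have b5 : κ * ‖c.opF W₀ ε V₁ - c.opF W₀ ε V₂‖ ≤ κ * (1 / 2 * ‖V₁ - V₂‖) := by
      calc _ ≤ ‖ε ^ 2 • c.opQ ε V₁ - ε ^ 2 • c.opQ ε V₂‖ +
            ‖ε ^ 2 • (c.opN W₀ ε V₁ - c.opN W₀ ε V₂)‖ := b.trans (norm_add_le _ _)
        _ ≤ 1 / 2 * (ε * (2 * (2 * c.kdvB * D + C₃))) * ‖V₁ - V₂‖ := by linarith
        _ ≤ 1 / 2 * κ * ‖V₁ - V₂‖ := by gcongr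
        _ = _ := by ring
    exact le_of_mul_le_mul_left b5 hκ
  refine ⟨hinv, fun V hV => ?_, hcontr⟩
  have h0 : ‖c.opF W₀ ε 0‖ ≤ (C₁ + C₂) / κ := by
    rw [le_div_iff₀ hκ, mul_comm]
    refine (hlow ε hε h1 _).trans ?_
    rw [opL_opF hinv, opQ_zero, opN_zero, smul_zero, add_zero, add_zero]
    exact (norm_add_le _ _).trans (add_le_add (hR ε hε h4) (hS ε hε h6))
  have hd := hcontr V 0 hV (by rw [norm_zero]; exact hD0.le)
  rw [sub_zero] at hd
  have ht := norm_add_le (c.opF W₀ ε V - c.opF W₀ ε 0) (c.opF W₀ ε 0)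
  rw [sub_add_cancel] at ht
  have : D = 2 * ((C₁ + C₂) / κ) + 1 := by rw [hD]; ring
  linarith

/-- A fixed point of `F_ε` yields a solution of the rescaled traveling wave equation. -/
theorem opB_eq_of_fixedPoint {W₀ : L2even} {ε : ℝ} (hε : 0 < ε)
    (h : (c.opL W₀ ε).IsInvertible) {V : L2even} (hV : c.opF W₀ ε V = V) :
    c.opB ε (W₀ + ε ^ 2 • V) =
      c.opQ ε (W₀ + ε ^ 2 • V) + ε ^ 2 • c.opP ε (W₀ + ε ^ 2 • V) := by
  have e := opL_opF h V
  rw [hV] at e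
  have hε2 : ε ^ 2 ≠ 0 := by positivity
  -- `Q_ε` is quadratic and `M_ε` is its derivative at `W₀`, so this expansion is exact.
  have q : c.opQ ε (W₀ + ε ^ 2 • V) =
      c.opQ ε W₀ + ε ^ 2 • c.opM W₀ ε V + ε ^ 2 • ε ^ 2 • c.opQ ε V := by
    have h1 : ∀ η, mulA η (W₀ + ε ^ 2 • V) (W₀ + ε ^ 2 • V) =
        mulA η W₀ W₀ + ε ^ 2 • (2 : ℝ) • mulA η W₀ V + ε ^ 2 • ε ^ 2 • mulA η V V := by
      intro η
      rw [map_add, map_smul, mulA_comm η (W₀ + ε ^ 2 • V) W₀, mulA_comm η (W₀ + ε ^ 2 • V) V,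
        map_add, map_add, map_smul, map_smul, mulA_comm η V W₀]
      module
    simp only [opQ, opM_apply, h1, map_add, map_smul, Finset.smul_sum, ← Finset.sum_add_distrib]
    refine Finset.sum_congr rfl fun i _ => ?_
    module
  have r : ε ^ 2 • c.resR W₀ ε = c.opQ ε W₀ - c.opB ε W₀ := by
    rw [resR, smul_smul, mul_one_div_cancel hε2, one_smul]
  have n : ε ^ 2 • c.opN W₀ ε V = c.opP ε (W₀ + ε ^ 2 • V) - c.opP ε W₀ := by
    rw [opN, smul_smul, mul_one_div_cancel hε2, one_smul]
  rw [n, resS, opL_apply, sub_eq_iff_eq_add] at e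
  rw [map_add, map_smul, e, q]
  simp only [smul_add, smul_sub, r]
  abel

end Chain

/-! ### Return to the lattice equation. -/

theorem hasDerivAt_avg {f : ℝ → ℝ} (hf : Continuous f) (η x : ℝ) :
    HasDerivAt (avg η f) (1 / η * (f (x + η / 2) - f (x - η / 2))) x := by
  have hi := fun a b => hf.intervalIntegrable (μ := volume) a b
  have e : avg η f = fun x => 1 / η *
      ((∫ ξ in (0 : ℝ)..(x + η / 2), f ξ) - ∫ ξ in (0 : ℝ)..(x - η / 2), f ξ) := by
    funext x
    rw [intervalIntegral.integral_interval_sub_left (hi _ _) (hi _ _)]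
    rfl
  have hp : ∀ y, HasDerivAt (fun y => ∫ ξ in (0 : ℝ)..y, f ξ) (f y) y := fun y =>
    (hf.integral_hasStrictDerivAt 0 y).hasDerivAt
  rw [e]
  exact (((hp _).comp_add_const x (η / 2)).fun_sub ((hp _).comp_sub_const x (η / 2))).const_mul _

/-- The forward difference of a primitive is an average centred half a step ahead. Differentiating
the outer average produces a centred difference, and the two half-step shifts combine into the
backward difference. -/
theorem forwardDiff_eq_avg {U W : ℝ → ℝ} (hU : ∀ x, HasDerivAt U (W x) x) (hW : Continuous W)
    (η y : ℝ) : forwardDiff η U y = avg η W (y + η / 2) := by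
  rw [forwardDiff, avg, ← intervalIntegral.integral_eq_sub_of_hasDerivAt (fun x _ => hU x)
    (hW.intervalIntegrable _ _), one_div, div_eq_inv_mul]
  ring_nf

theorem coe_sum {ι : Type*} (s : Finset ι) (F : ι → L2even) :
    ((∑ i ∈ s, F i : L2even) : L2) =ᵐ[volume] fun x => ∑ i ∈ s, (F i : L2) x := by
  classical
  induction s using Finset.induction_on with
  | empty => exact Lp.coeFn_zero ℝ 2 (volume : Measure ℝ)
  | insert a s ha ih =>
    simp only [Finset.sum_insert ha]
    filter_upwards [coe_add (F a) (∑ i ∈ s, F i), ih] with x h1 h2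
    rw [h1, h2]

namespace Chain

variable {M : ℕ} {c : Chain M}

theorem hasDerivAt_Φ (i : Fin M) (r : ℝ) :
    HasDerivAt (c.Φ i) (c.α i * r + c.β i * r ^ 2 + deriv (c.Ψ i) r) r := by
  have h1 := ((hasDerivAt_id r).fun_pow 2).const_mul (c.α i / 2)
  have h2 := ((hasDerivAt_id r).fun_pow 3).const_mul (c.β i / 3)
  have h3 := (c.differentiable_Ψ i r).hasDerivAt
  refine ((h1.fun_add h2).fun_add h3).congr_deriv ?_
  simp
  ring

theorem deriv_Φ (i : Fin M) :
    deriv (c.Φ i) = fun r => c.α i * r + c.β i * r ^ 2 + deriv (c.Ψ i) r :=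
  funext fun r => (hasDerivAt_Φ i r).deriv

theorem waveSpeed_sq (c : Chain M) (ε : ℝ) :
    c.waveSpeed ε ^ 2 = (∑ i, c.α i * range i ^ 2) + ε ^ 2 := by
  rw [waveSpeed, Real.sq_sqrt]
  have : 0 ≤ ∑ i, c.α i * range i ^ 2 := Finset.sum_nonneg fun i _ =>
    mul_nonneg (c.α_pos i).le (sq_nonneg _)
  positivity

/-- The rescaled traveling wave equation in integrated form. -/
theorem waveSpeed_sq_mul_ae_eq {ε : ℝ} (hε : 0 < ε) {W : L2even}
    (h : c.opB ε W = c.opQ ε W + ε ^ 2 • c.opP ε W) :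
    (fun x => c.waveSpeed ε ^ 2 * (W : L2) x) =ᵐ[volume] fun x => ∑ i, range i / ε ^ 2 *
      avg (range i * ε) (fun y => deriv (c.Φ i)
        (range i * ε ^ 2 * avg (range i * ε) (W : L2) y)) x := by
  set s : Fin M → L2even := fun i => superA (deriv (c.Ψ i)) (c.contDiff_deriv_Ψ i)
    (c.deriv_Ψ_zero i) (range i * ε ^ 2) (range i * ε) W with hs
  set F : Fin M → L2even := fun i => (c.α i * range i * ε ^ 2) • opA (range i * ε) W +
    (c.β i * range i ^ 2 * ε ^ 4) • mulA (range i * ε) W W + s i with hF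
  -- Multiplication by `ε²` turns `B_ε W` into `c_ε² W - ∑ α m² A² W`. Moved to the right, the sum
  -- provides the linear part of `Φ'` at `r = m ε² A W`, while `Q_ε` and `P_ε` provide the quadratic
  -- part and `Ψ'`.
  have key : c.waveSpeed ε ^ 2 • W =
      ∑ i, (range i / ε ^ 2) • opA (range i * ε) (F i) := by
    have h1 : c.waveSpeed ε ^ 2 • W = ε ^ 2 • c.opB ε W +
        ∑ i, (c.α i * range i ^ 2) • opA (range i * ε) (opA (range i * ε) W) := by
      rw [waveSpeed_sq, opB_apply, add_smul, Finset.sum_smul, smul_add, Finset.smul_sum,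
        add_comm, add_assoc, ← Finset.sum_add_distrib]
      congr 1
      refine Finset.sum_congr rfl fun i _ => ?_
      rw [smul_smul, mul_div_cancel₀ _ (by positivity : ε ^ 2 ≠ 0), ← smul_add, sub_add_cancel]
    have h2 : ε ^ 2 • c.opQ ε W =
        ∑ i, (range i / ε ^ 2 * (c.β i * range i ^ 2 * ε ^ 4)) •
          opA (range i * ε) (mulA (range i * ε) W W) := by
      rw [opQ, Finset.smul_sum]
      refine Finset.sum_congr rfl fun i _ => ?_
      rw [smul_smul]
      congr 1
      field_simp
    have h3 : ε ^ 2 • ε ^ 2 • c.opP ε W = ∑ i, (range i / ε ^ 2) • opA (range i * ε) (s i) := by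
      rw [opP, smul_smul, smul_smul, Finset.smul_sum]
      refine Finset.sum_congr rfl fun i _ => ?_
      rw [smul_smul]
      congr 1
      field_simp
    rw [h1, h, smul_add, h2, h3, ← Finset.sum_add_distrib, ← Finset.sum_add_distrib]
    refine Finset.sum_congr rfl fun i _ => ?_
    simp only [hF, map_add, map_smul, smul_add, smul_smul]
    have : range i / ε ^ 2 * (c.α i * range i * ε ^ 2) = c.α i * range i ^ 2 := by field_simp
    rw [this]
    abel
  have hFae : ∀ i, (F i : L2) =ᵐ[volume] fun y => deriv (c.Φ i)
      (range i * ε ^ 2 * avg (range i * ε) (W : L2) y) := by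
    intro i
    filter_upwards [coe_add ((c.α i * range i * ε ^ 2) • opA (range i * ε) W +
        (c.β i * range i ^ 2 * ε ^ 4) • mulA (range i * ε) W W) (s i),
      coe_add ((c.α i * range i * ε ^ 2) • opA (range i * ε) W)
        ((c.β i * range i ^ 2 * ε ^ 4) • mulA (range i * ε) W W),
      coe_smul (c.α i * range i * ε ^ 2) (opA (range i * ε) W),
      coe_smul (c.β i * range i ^ 2 * ε ^ 4) (mulA (range i * ε) W W),
      coe_opA (range i * ε) W, coe_mulA (range i * ε) W W,
      coe_superA _ (c.contDiff_deriv_Ψ i) (c.deriv_Ψ_zero i) (range i * ε ^ 2) (range i * ε) W]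
      with x h1 h2 h3 h4 h5 h6 h7
    rw [deriv_Φ]
    simp only [hF, hs]
    simp only [hs] at h1
    rw [h1, h2, h3, h4, h5, h6, h7]
    ring
  have hsum : ∀ᵐ x, ∀ i, (((range i / ε ^ 2) • opA (range i * ε) (F i) : L2even) : L2) x =
      range i / ε ^ 2 * avg (range i * ε) (fun y => deriv (c.Φ i)
        (range i * ε ^ 2 * avg (range i * ε) (W : L2) y)) x := by
    rw [ae_all_iff]
    intro i
    filter_upwards [coe_smul (range i / ε ^ 2) (opA (range i * ε) (F i)),
      coe_opA_of_ae (η := range i * ε) (hFae i)] with x h1 h2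
    rw [h1, h2]
  have h4 := coe_sum Finset.univ fun i => (range i / ε ^ 2) • opA (range i * ε) (F i)
  rw [← key] at h4
  filter_upwards [h4, coe_smul (c.waveSpeed ε ^ 2) W, hsum] with x h1 h2 h3
  rw [← h2, h1]
  exact Finset.sum_congr rfl fun i _ => h3 i

/-- The integrated equation expresses `W` through averages of continuous functions, as averages of
`L²` functions are continuous. Division by the positive `c_ε²` yields a `C¹` representative, whose
primitive is `U`. -/
theorem solvesTravelingWave {ε : ℝ} (hε : 0 < ε) {W : L2even}
    (h : c.opB ε W = c.opQ ε W + ε ^ 2 • c.opP ε W) : c.SolvesTravelingWave ε W := by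
  have hc : 0 < c.waveSpeed ε ^ 2 := by
    rw [waveSpeed_sq]
    have : 0 ≤ ∑ i, c.α i * range i ^ 2 := Finset.sum_nonneg fun i _ =>
      mul_nonneg (c.α_pos i).le (sq_nonneg _)
    positivity
  set g : Fin M → ℝ → ℝ := fun i y => deriv (c.Φ i)
    (range i * ε ^ 2 * avg (range i * ε) (W : L2) y) with hg
  have cg : ∀ i, Continuous (g i) := by
    intro i
    have h1 := (c.contDiff_deriv_Ψ i).continuous
    have h2 := continuous_avg (Lp.memLp (W : L2)) (range i * ε)
    simp only [hg, deriv_Φ]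
    fun_prop
  set w : ℝ → ℝ := fun x => (c.waveSpeed ε ^ 2)⁻¹ *
    ∑ i, range i / ε ^ 2 * avg (range i * ε) (g i) x with hw
  set w' : ℝ → ℝ := fun x => (c.waveSpeed ε ^ 2)⁻¹ * ∑ i, range i / ε ^ 2 *
    (1 / (range i * ε) * (g i (x + range i * ε / 2) - g i (x - range i * ε / 2))) with hw'
  have hd : ∀ x, HasDerivAt w (w' x) x := fun x =>
    (HasDerivAt.fun_sum fun i _ => (hasDerivAt_avg (cg i) (range i * ε) x).const_mul
      (range i / ε ^ 2)).const_mul _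
  have cw : Continuous w := continuous_iff_continuousAt.2 fun x => (hd x).continuousAt
  have cw' : Continuous w' := by
    have := cg
    fun_prop
  have hae : (W : L2) =ᵐ[volume] w := by
    filter_upwards [waveSpeed_sq_mul_ae_eq hε h] with x hx
    simp only [hw, hg]
    rw [← hx, inv_mul_cancel_left₀ hc.ne']
  have hU : ∀ x, HasDerivAt (fun x => ∫ t in (0 : ℝ)..x, w t) (w x) x := fun x =>
    (cw.integral_hasStrictDerivAt 0 x).hasDerivAt
  have dU : deriv (fun x => ∫ t in (0 : ℝ)..x, w t) = w := funext fun x => (hU x).deriv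
  have dw : deriv w = w' := funext fun x => (hd x).deriv
  refine ⟨fun x => ∫ t in (0 : ℝ)..x, w t, ?_, ?_, fun x => ?_⟩
  · rw [← one_add_one_eq_two, contDiff_succ_iff_deriv]
    refine ⟨fun x => (hU x).differentiableAt, by simp, ?_⟩
    rw [dU, contDiff_one_iff_deriv, dw]
    exact ⟨fun x => (hd x).differentiableAt, cw'⟩
  · rw [dU]; exact hae
  · rw [dU, dw, hw']
    simp only
    rw [mul_assoc, mul_inv_cancel_left₀ hc.ne', Finset.mul_sum]
    refine Finset.sum_congr rfl fun i _ => ?_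
    have e : ∀ y, deriv (c.Φ i) (range i * ε ^ 2 * forwardDiff (range i * ε)
        (fun x => ∫ t in (0 : ℝ)..x, w t) y) = g i (y + range i * ε / 2) := by
      intro y
      rw [forwardDiff_eq_avg hU cw, ← avg_congr hae]
    rw [backwardDiff, e, e, show x - range i * ε + range i * ε / 2 = x - range i * ε / 2 by ring]
    have := range_pos i
    field_simp

end Chain

/-! ### Banach's fixed point theorem on a ball, and the main theorem. -/

theorem existsUnique_fixedPoint {E : Type*} [NormedAddCommGroup E] [CompleteSpace E] {F : E → E}
    {D κ : ℝ} (hD : 0 < D) (hκ : κ < 1) (hF : ∀ V, ‖V‖ ≤ D → ‖F V‖ ≤ D)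
    (hc : ∀ V₁ V₂, ‖V₁‖ ≤ D → ‖V₂‖ ≤ D → ‖F V₁ - F V₂‖ ≤ κ * ‖V₁ - V₂‖) :
    ∃! V, ‖V‖ ≤ D ∧ F V = V := by
  have hs : IsComplete (Metric.closedBall (0 : E) D) := Metric.isClosed_closedBall.isComplete
  have hmaps : MapsTo F (Metric.closedBall 0 D) (Metric.closedBall 0 D) := fun V hV => by
    rw [mem_closedBall_zero_iff] at hV ⊢
    exact hF V hV
  have hcon : ContractingWith (Real.toNNReal κ) (hmaps.restrict F _ _) := by
    refine ⟨by rw [Real.toNNReal_lt_one]; exact hκ, LipschitzWith.of_dist_le_mul fun V₁ V₂ => ?_⟩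
    rw [Subtype.dist_eq, Subtype.dist_eq, dist_eq_norm, dist_eq_norm]
    refine (hc _ _ (mem_closedBall_zero_iff.1 V₁.2) (mem_closedBall_zero_iff.1 V₂.2)).trans ?_
    gcongr
    exact Real.le_coe_toNNReal κ
  obtain ⟨V, hV, hfix, -⟩ := hcon.exists_fixedPoint' hs hmaps
    (Metric.mem_closedBall_self hD.le) (edist_ne_top _ _)
  refine ⟨V, ⟨mem_closedBall_zero_iff.1 hV, hfix⟩, fun V' ⟨hV', hfix'⟩ => ?_⟩
  have h := hc V' V hV' (mem_closedBall_zero_iff.1 hV)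
  rw [hfix', hfix.eq] at h
  have : ‖V' - V‖ ≤ 0 := by
    by_contra hpos
    push Not at hpos
    nlinarith
  exact sub_eq_zero.1 (norm_le_zero_iff.1 this)

end FPU

theorem theorem3p4 (M : ℕ) (hM : 0 < M) (c : FPU.Chain M) :
    (∃! W₀ : FPU.L2even, c.IsKdVWave W₀) ∧
    ∀ W₀ : FPU.L2even, c.IsKdVWave W₀ →
      ∃ D : ℝ, 0 < D ∧ ∃ ε₀ : ℝ, 0 < ε₀ ∧ ε₀ ≤ 1 ∧ ∀ ε : ℝ, 0 < ε → ε ≤ ε₀ →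
        (c.opL W₀ ε).IsInvertible ∧
        (∀ V : FPU.L2even, ‖V‖ ≤ D → ‖c.opF W₀ ε V‖ ≤ D) ∧
        (∃ κ : ℝ, 0 ≤ κ ∧ κ < 1 ∧ ∀ V₁ V₂ : FPU.L2even, ‖V₁‖ ≤ D → ‖V₂‖ ≤ D →
          ‖c.opF W₀ ε V₁ - c.opF W₀ ε V₂‖ ≤ κ * ‖V₁ - V₂‖) ∧
        (∃! V : FPU.L2even, ‖V‖ ≤ D ∧ c.opF W₀ ε V = V) ∧
        ∀ V : FPU.L2even, ‖V‖ ≤ D → c.opF W₀ ε V = V →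
          c.opB ε (W₀ + ε ^ 2 • V) =
            c.opQ ε (W₀ + ε ^ 2 • V) + ε ^ 2 • c.opP ε (W₀ + ε ^ 2 • V) ∧
          c.SolvesTravelingWave ε (W₀ + ε ^ 2 • V) := by
  refine ⟨c.existsUnique_isKdVWave hM, fun W₀ hW => ?_⟩
  obtain ⟨D, hD, ε₀, hε₀, hε₀', h⟩ := FPU.Chain.exists_contraction hM hW
  refine ⟨D, hD, ε₀, hε₀, hε₀', fun ε hε hle => ?_⟩
  obtain ⟨hinv, hball, hcontr⟩ := h ε hε hle
  refine ⟨hinv, hball, ⟨1 / 2, by norm_num, by norm_num, hcontr⟩,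
    FPU.existsUnique_fixedPoint hD (by norm_num) hball hcontr, fun V _ hV => ?_⟩
  have heq := FPU.Chain.opB_eq_of_fixedPoint hε hinv hV
  exact ⟨heq, FPU.Chain.solvesTravelingWave hε heq⟩
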